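/- Let $k$ be an algebraically closed field and let $\Delta$ be a simply laced Dynkin diagram, with vertices labelled $1,\dots,n$ and oriented as follows: $1\to2\to\cdots\to n$ for $A_n$ ($n\ge1$); $1\to\cdots\to n-2$, $n-1\to n-2$, $n\to n-2$ for $D_n$ ($n\ge4$); $3\to2\to1$, $3\to4$, $3\to5\to\cdots\to n$ for $E_n$ ($n=6,7,8$). The repetition quiver $\mathbb Z\Delta$ has vertices $(p,q)$ with $p\in\mathbb Z$ and $q$ a vertex of $\Delta$, arrows $(p,a)\to(p,b)$ and $(p-1,b)\to(p,a)$ for each arrow $a\to b$ of $\Delta$ and $p\in\mathbb Z$, and translation $\tau(p,q)=(p-1,q)$. Let $\mathbb S$ be the Nakayama permutation of its vertices: $\mathbb S(p,q)=(p+q-1,n+1-q)$ for $A_n$; $\mathbb S=\tau^{-n+2}$ for $D_n$ with $n$ even, and $\tau^{-n+2}$ composed with the exchange of $n-1$ and $n$ for $n$ odd; $\mathbb S=\tau^{-5}$ composed with the exchanges $1\leftrightarrow6$, $2\leftrightarrow5$ for $E_6$; $\mathbb S=\tau^{-8}$ for $E_7$; $\mathbb S=\tau^{-14}$ for $E_8$.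 Put $[1]=\mathbb S\tau^{-1}$ on $\mathbb Z\Delta$. For $d\ge1$ let $\mathbb Z\Delta/\mathbb S[d]$ be the quotient translation quiver by the group generated by $\mathbb S[d]=\mathbb S\circ[1]^d$, with the induced permutation $[1]$, and let $\pi$ be the projection on vertices. A slice is a connected full subquiver of $\mathbb Z\Delta$ containing exactly one of the vertices $(r,q)$, $r\in\mathbb Z$, for each $q$; for each vertex $x$ there is a unique slice with $x$ as its unique source. An integer-valued function $f$ on the vertices is additive if $f(y)+f(\tau y)=\sum_{z\to y}f(z)$ for all $y$. Let $f_x$ be the unique additive function with value $1$ on the slice with unique source $x$, let $Q_x$ be the connected component containing $x$ of the full subquiver $\{y: f_x(y)>0\}$, and let $h_x=f_x$ on $Q_x$ and $h_x=0$ elsewhere. For a vertex $Y$ of $\mathbb Z\Delta/\mathbb S[d]$ put $\bar h_x(Y)=\sum_{\pi(z)=Y}h_x(z)$; this depends only on $X=\pi(x)$ and is written $\bar h_X(Y)$. A set $C$ of vertices of $\mathbb Z\Delta/\mathbb S[d]$ is a $(-d)$-combinatorial configuration if 1. $\bar h_X(Y)=\delta_{X,Y}$ for $X,Y\in C$; 2.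 $\bar h_X(Y[-j])=0$ for $X,Y\in C$ and $0<j\le d-1$; 3. for every vertex $Z$ there are $X\in C$ and $0\le j\le d-1$ with $\bar h_X(Z[-j])\ne0$. Let $\mathcal T$ be a $k$-linear Hom-finite Krull–Schmidt triangulated category, and let $\operatorname{ind}\mathcal T$ be the set of isomorphism classes of its indecomposable objects. A subset $C\subset\operatorname{ind}\mathcal T$ is a $(-d)$-Calabi–Yau configuration if 1. $\dim_k\operatorname{Hom}_{\mathcal T}(X,Y)=\delta_{X,Y}$ for $X,Y\in C$; 2. $\operatorname{Hom}_{\mathcal T}(X,Y[-j])=0$ for $X,Y\in C$ and $0<j\le d-1$; 3. for every indecomposable $M$ there are $X\in C$ and $0\le j\le d-1$ with $\operatorname{Hom}_{\mathcal T}(X,M[-j])\ne0$. **Theorem.** Let $d\ge1$, let $\mathcal T$ and $\Delta$ be as above, and suppose that the Auslander–Reiten quiver of $\mathcal T$ is isomorphic, as a translation quiver, to $\mathbb Z\Delta/\mathbb S[d]$; identify $\operatorname{ind}\mathcal T$ with the vertices of $\mathbb Z\Delta/\mathbb S[d]$ by such an isomorphism. Then a subset $C\subset\operatorname{ind}\mathcal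 T$ is a $(-d)$-Calabi–Yau configuration in $\mathcal T$ if and only if it is a $(-d)$-combinatorial configuration in $\mathbb Z\Delta/\mathbb S[d]$. -/

import Mathlib

open CategoryTheory CategoryTheory.Limits

namespace NegCY

/-! ## Repetition quivers of Dynkin diagrams -/

/-- The simply laced Dynkin diagrams. -/
inductive Dynkin : Type
  | A (n : ℕ) (hn : 1 ≤ n)
  | D (n : ℕ) (hn : 4 ≤ n)
  | E6
  | E7
  | E8

namespace Dynkin

/-- The number of vertices. -/
def rank : Dynkin → ℕ
  | A n _ => n
  | D n _ => n
  | E6 => 6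
  | E7 => 7
  | E8 => 8

/-- The vertices of the diagram, labelled `1, …, n`. -/
abbrev Vertex (Δ : Dynkin) : Type := {q : ℕ // 1 ≤ q ∧ q ≤ Δ.rank}

/-- The arrows of the fixed orientation, in terms of the labels:
`1 → 2 → ⋯ → n` for `A n`; `1 → 2 → ⋯ → n - 2` together with `n - 1 → n - 2` and `n → n - 2`
for `D n`; `3 → 2 → 1`, `3 → 4` and `3 → 5 → 6 → ⋯ → n` for `E n`. -/
def ArrowLabel : Dynkin → ℕ → ℕ → Prop
  | A _ _, a, b => b = a + 1
  | D n _, a, b => (b = a + 1 ∧ b ≤ n - 2) ∨ ((a = n - 1 ∨ a = n) ∧ b = n - 2)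
  | E6, a, b | E7, a, b | E8, a, b =>
      (a = 2 ∧ b = 1) ∨ (a = 3 ∧ b = 2) ∨ (a = 3 ∧ b = 4) ∨ (a = 3 ∧ b = 5) ∨
        (5 ≤ a ∧ b = a + 1)

/-- There is an arrow `a → b` in the oriented diagram. -/
def Arrow (Δ : Dynkin) (a b : Δ.Vertex) : Prop := Δ.ArrowLabel a.1 b.1

/-- The vertices of the repetition quiver `ℤΔ`. -/
abbrev ZVertex (Δ : Dynkin) : Type := ℤ × Δ.Vertex

/-- There is an arrow `x → y` in `ℤΔ`: the arrows are `(p, a) → (p, b)` and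
`(p - 1, b) → (p, a)` for every arrow `a → b` of `Δ` and every integer `p`.
(There are no double arrows.) -/
def ZArrow (Δ : Dynkin) (x y : Δ.ZVertex) : Prop :=
  (x.1 = y.1 ∧ Δ.Arrow x.2 y.2) ∨ (x.1 = y.1 - 1 ∧ Δ.Arrow y.2 x.2)

/-- The translation `τ (p, q) = (p - 1, q)`. -/
def tau (Δ : Dynkin) : Equiv.Perm Δ.ZVertex where
  toFun x := (x.1 - 1, x.2)
  invFun x := (x.1 + 1, x.2)
  left_inv x := by simp
  right_inv x := by simp

/-- The effect of the Nakayama permutation on labels. -/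
def nakayamaLabel : Dynkin → ℕ → ℕ
  | A n _, q => n + 1 - q
  | D n _, q => if Even n then q else if q = n then n - 1 else if q = n - 1 then n else q
  | E6, q => if q = 3 ∨ q = 4 then q else 7 - q
  | E7, q => q
  | E8, q => q

/-- The amount by which the Nakayama permutation moves the vertices `(p, q)` to the right. -/
def nakayamaAmount : Dynkin → ℕ → ℤ
  | A _ _, q => (q : ℤ) - 1
  | D n _, _ => (n : ℤ) - 2
  | E6, _ => 5
  | E7, _ => 8
  | E8, _ => 14

lemma nakayamaLabel_mem (Δ : Dynkin) (q : ℕ) (hq : 1 ≤ q ∧ q ≤ Δ.rank) :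
    1 ≤ Δ.nakayamaLabel q ∧ Δ.nakayamaLabel q ≤ Δ.rank := by
  cases Δ <;> simp only [rank, nakayamaLabel] at * <;> try split_ifs
  all_goals omega

lemma nakayamaLabel_invol (Δ : Dynkin) (q : ℕ) (hq : 1 ≤ q ∧ q ≤ Δ.rank) :
    Δ.nakayamaLabel (Δ.nakayamaLabel q) = q := by
  cases Δ <;> simp only [rank, nakayamaLabel] at * <;> (repeat' split_ifs) <;> omega

/-- The involution of the vertices of `Δ` underlying the Nakayama permutation. -/
def nakayamaVertex (Δ : Dynkin) (q : Δ.Vertex) : Δ.Vertex :=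
  ⟨Δ.nakayamaLabel q.1, Δ.nakayamaLabel_mem q.1 q.2⟩

lemma nakayamaVertex_invol (Δ : Dynkin) (q : Δ.Vertex) :
    Δ.nakayamaVertex (Δ.nakayamaVertex q) = q :=
  Subtype.ext (Δ.nakayamaLabel_invol q.1 q.2)

/-- The Nakayama permutation `𝕊` of `ℤΔ`: `(p, q) ↦ (p + q - 1, n + 1 - q)` for `A n`; `τ^(2 - n)`
for `D n`, composed with the exchange of `n - 1` and `n` if `n` is odd; `τ^(-5)` composed with the
exchanges of `1`, `6` and of `2`, `5` for `E6`; `τ^(-8)` for `E7`; `τ^(-14)` for `E8`. -/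
def nakayama (Δ : Dynkin) : Equiv.Perm Δ.ZVertex where
  toFun x := (x.1 + Δ.nakayamaAmount x.2.1, Δ.nakayamaVertex x.2)
  invFun x := (x.1 - Δ.nakayamaAmount (Δ.nakayamaVertex x.2).1, Δ.nakayamaVertex x.2)
  left_inv x := by simp [nakayamaVertex_invol]
  right_inv x := by simp [nakayamaVertex_invol]

/-- The shift permutation `[1] = 𝕊 τ⁻¹` of `ℤΔ`. -/
def shift (Δ : Dynkin) : Equiv.Perm Δ.ZVertex := Δ.nakayama * Δ.tau⁻¹

/-- The automorphism `𝕊[d]` of `ℤΔ`. -/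
def nakayamaShift (Δ : Dynkin) (d : ℕ) : Equiv.Perm Δ.ZVertex := Δ.nakayama * Δ.shift ^ d

lemma nakayama_commute_tau (Δ : Dynkin) : Commute Δ.nakayama Δ.tau := by
  ext x
  · simp [nakayama, tau]; ring
  · simp [nakayama, tau]

lemma nakayama_commute_shift (Δ : Dynkin) : Commute Δ.nakayama Δ.shift :=
  (Commute.refl _).mul_right Δ.nakayama_commute_tau.inv_right

lemma nakayamaShift_commute_tau (Δ : Dynkin) (d : ℕ) : Commute (Δ.nakayamaShift d) Δ.tau :=
  Δ.nakayama_commute_tau.mul_left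
    ((Δ.nakayama_commute_tau.mul_left (Commute.refl _).inv_left).pow_left d)

lemma nakayamaShift_commute_shift (Δ : Dynkin) (d : ℕ) : Commute (Δ.nakayamaShift d) Δ.shift :=
  Δ.nakayama_commute_shift.mul_left ((Commute.refl _).pow_left d)

/-! ## The quotient `ℤΔ / 𝕊[d]` -/

/-- Two vertices of `ℤΔ` are identified if they are in the same orbit of the group generated
by `𝕊[d]`. -/
def orbitSetoid (Δ : Dynkin) (d : ℕ) : Setoid Δ.ZVertex :=
  MulAction.orbitRel (Subgroup.zpowers (Δ.nakayamaShift d)) Δ.ZVertex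

/-- The vertices of `ℤΔ / 𝕊[d]`. -/
def QVertex (Δ : Dynkin) (d : ℕ) : Type := Quotient (Δ.orbitSetoid d)

/-- The natural projection `π : ℤΔ → ℤΔ / 𝕊[d]` on vertices. -/
def proj (Δ : Dynkin) (d : ℕ) (x : Δ.ZVertex) : Δ.QVertex d := Quotient.mk (Δ.orbitSetoid d) x

lemma orbitSetoid_map (Δ : Dynkin) (d : ℕ) (g : Equiv.Perm Δ.ZVertex)
    (hg : Commute (Δ.nakayamaShift d) g) (x y : Δ.ZVertex)
    (h : (Δ.orbitSetoid d).r x y) : (Δ.orbitSetoid d).r (g x) (g y) := by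
  obtain ⟨⟨_, m, rfl⟩, h⟩ := h
  refine ⟨⟨_, m, rfl⟩, ?_⟩
  have h' : (Δ.nakayamaShift d ^ m) y = x := h
  have e : (Δ.nakayamaShift d ^ m) (g y) = g ((Δ.nakayamaShift d ^ m) y) :=
    congrArg (fun p : Equiv.Perm Δ.ZVertex => p y) (hg.zpow_left m).eq
  change (Δ.nakayamaShift d ^ m) (g y) = g x
  rw [e, h']

/-- The translation of `ℤΔ / 𝕊[d]`, induced by that of `ℤΔ`. -/
def qTau (Δ : Dynkin) (d : ℕ) : Δ.QVertex d → Δ.QVertex d :=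
  Quotient.map Δ.tau (Δ.orbitSetoid_map d Δ.tau (Δ.nakayamaShift_commute_tau d))

/-- The permutation `[-1]` of `ℤΔ / 𝕊[d]`, induced by the inverse of the shift permutation
of `ℤΔ`. -/
def qUnshift (Δ : Dynkin) (d : ℕ) : Δ.QVertex d → Δ.QVertex d :=
  Quotient.map (Δ.shift⁻¹ : Equiv.Perm Δ.ZVertex)
    (Δ.orbitSetoid_map d Δ.shift⁻¹ (Δ.nakayamaShift_commute_shift d).inv_right)

/-- There is an arrow `a → b` in `ℤΔ / 𝕊[d]`, i.e. an arrow of `ℤΔ` between representatives.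
For `d ≥ 1` there are no double arrows: every arrow of `ℤΔ` raises the function
`(p, q) ↦ 2 * p + height q` by one, where `height` goes up by one along the arrows of `Δ`, and
`𝕊[d]` raises it by a positive constant, so two arrows of `ℤΔ` which start in the same
vertex and end in the same orbit are equal. -/
def QArrow (Δ : Dynkin) (d : ℕ) (a b : Δ.QVertex d) : Prop :=
  ∃ x y : Δ.ZVertex, Δ.proj d x = a ∧ Δ.proj d y = b ∧ Δ.ZArrow x y

/-! ## Slices, additive functions and combinatorial configurations -/

/-- `x` and `y` are joined by an unoriented path of the full subquiver of `ℤΔ` on `L`. -/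
def Joined (Δ : Dynkin) (L : Set Δ.ZVertex) (x y : Δ.ZVertex) : Prop :=
  Relation.ReflTransGen
    (fun a b => a ∈ L ∧ b ∈ L ∧ (Δ.ZArrow a b ∨ Δ.ZArrow b a)) x y

/-- A slice (given by its set of vertices): a connected full subquiver containing exactly one of
the vertices `(r, q)`, `r ∈ ℤ`, for each vertex `q` of `Δ`. -/
def IsSlice (Δ : Dynkin) (L : Set Δ.ZVertex) : Prop :=
  (∀ q : Δ.Vertex, ∃! r : ℤ, (r, q) ∈ L) ∧ ∀ x ∈ L, ∀ y ∈ L, Δ.Joined L x y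

/-- `L` is the slice starting at `x`: a slice with `x` as its unique source. -/
def IsSliceStartingAt (Δ : Dynkin) (x : Δ.ZVertex) (L : Set Δ.ZVertex) : Prop :=
  Δ.IsSlice L ∧ x ∈ L ∧ ∀ y ∈ L, (∀ z ∈ L, ¬ Δ.ZArrow z y) ↔ y = x

/-- Additive functions on `ℤΔ`: `f(x) + f(τ x)` is the sum of the values of `f` at the (finitely
many) direct predecessors of `x`. -/
def IsAdditive (Δ : Dynkin) (f : Δ.ZVertex → ℤ) : Prop :=
  ∀ x, f x + f (Δ.tau x) = ∑ᶠ (y : Δ.ZVertex) (_ : Δ.ZArrow y x), f y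

/-- The function `f_x`: the unique additive function with value `1` on the slice starting
at `x`. -/
noncomputable def addFun (Δ : Dynkin) (x : Δ.ZVertex) : Δ.ZVertex → ℤ :=
  Classical.epsilon fun f =>
    Δ.IsAdditive f ∧ ∃ L, Δ.IsSliceStartingAt x L ∧ ∀ y ∈ L, f y = 1

open Classical in
/-- The function `h_x`: it agrees with `f_x` on the connected component `Q_x` of `x` in the full
subquiver `{y | f_x(y) > 0}` and vanishes elsewhere. -/
noncomputable def hFun (Δ : Dynkin) (x y : Δ.ZVertex) : ℤ :=
  if Δ.Joined {z | 0 < Δ.addFun x z} x y then Δ.addFun x y else 0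

/-- The function `h^φ_x` for `φ = 𝕊[d]`, `x` a vertex of `ℤΔ` and `y` a vertex of `ℤΔ / 𝕊[d]`: the
sum of `h_x(z)` over all `z` with `π z = y` (`h_x` has finite support). -/
noncomputable def hBar (Δ : Dynkin) (d : ℕ) (x : Δ.ZVertex) (y : Δ.QVertex d) : ℤ :=
  ∑ᶠ (z : Δ.ZVertex) (_ : Δ.proj d z = y), Δ.hFun x z

open Classical in
/-- `(-d)`-combinatorial configurations of `ℤΔ / 𝕊[d]`. The function `h^φ_x` only depends on the
orbit of `x`; elements of `C` in the first argument are given by representatives. -/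
def IsCombConfiguration (Δ : Dynkin) (d : ℕ) (C : Set (Δ.QVertex d)) : Prop :=
  (∀ x : Δ.ZVertex, Δ.proj d x ∈ C → ∀ y ∈ C,
    Δ.hBar d x y = if Δ.proj d x = y then 1 else 0) ∧
  (∀ x : Δ.ZVertex, Δ.proj d x ∈ C → ∀ y ∈ C, ∀ j : ℕ, 0 < j → j < d →
    Δ.hBar d x ((Δ.qUnshift d)^[j] y) = 0) ∧
  (∀ z : Δ.QVertex d, ∃ x : Δ.ZVertex, Δ.proj d x ∈ C ∧ ∃ j : ℕ, j < d ∧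
    Δ.hBar d x ((Δ.qUnshift d)^[j] z) ≠ 0)

end Dynkin

/-! ## Krull–Schmidt categories, radicals, indecomposable objects -/

section Categories

universe w v u

/-- Krull–Schmidt categories: every object is a finite direct sum of objects with local
endomorphism rings. -/
def IsKrullSchmidt (T : Type u) [Category.{v} T] [Preadditive T] [HasFiniteBiproducts T] : Prop :=
  ∀ X : T, ∃ (n : ℕ) (Y : Fin n → T),
    (∀ i, IsLocalRing (End (Y i))) ∧ Nonempty (X ≅ ⨁ Y)

/-- Hom-finite `k`-linear categories. -/
def IsHomFinite (k : Type w) [Field k] (T : Type u) [Category.{v} T] [Preadditive T]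
    [Linear k T] : Prop :=
  ∀ X Y : T, Module.Finite k (X ⟶ Y)

section Radical

variable (k : Type w) [Field k] {T : Type u} [Category.{v} T] [Preadditive T] [Linear k T]

/-- The Jacobson radical `rad_T(X, Y)`: the morphisms `f : X ⟶ Y` such that `1 - g f` is
invertible for all `g : Y ⟶ X`. -/
def rad (X Y : T) : Submodule k (X ⟶ Y) where
  carrier := {f | ∀ g : Y ⟶ X, IsIso (𝟙 X - f ≫ g)}
  zero_mem' g := by simpa using (inferInstance : IsIso (𝟙 X))
  smul_mem' c f hf g := by
    simpa [Linear.smul_comp, Linear.comp_smul] using hf (c • g)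
  add_mem' {f₁ f₂} h₁ h₂ g := by
    have i₁ : IsIso (𝟙 X - f₁ ≫ g) := h₁ g
    have i₂ : IsIso (𝟙 X - f₂ ≫ g ≫ inv (𝟙 X - f₁ ≫ g)) := h₂ (g ≫ inv (𝟙 X - f₁ ≫ g))
    have e : 𝟙 X - (f₁ + f₂) ≫ g =
        (𝟙 X - f₂ ≫ g ≫ inv (𝟙 X - f₁ ≫ g)) ≫ (𝟙 X - f₁ ≫ g) := by
      rw [Preadditive.sub_comp]
      simp only [Category.assoc, IsIso.inv_hom_id, Category.id_comp, Category.comp_id,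
        Preadditive.add_comp]
      abel
    rw [e]
    infer_instance

/-- The square `rad²_T(X, Y)` of the radical: finite sums of composites of two radical morphisms
`X ⟶ Z ⟶ Y`. -/
def radSq (X Y : T) : Submodule k (X ⟶ Y) :=
  Submodule.span k {h | ∃ (Z : T) (f : X ⟶ Z) (g : Z ⟶ Y),
    f ∈ rad k X Z ∧ g ∈ rad k Z Y ∧ h = f ≫ g}

/-- The dimension of the space `rad_T(X, Y) / rad²_T(X, Y)` of irreducible morphisms; for
indecomposable `X`, `Y` it is the number of arrows from `X` to `Y` in the Auslander–Reiten
quiver. -/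
noncomputable def irrDim (X Y : T) : ℕ :=
  Module.finrank k (rad k X Y ⧸ (radSq k X Y).submoduleOf (rad k X Y))

end Radical

/-- The indecomposable objects of `T`. -/
abbrev IndecObj (T : Type u) [Category.{v} T] [HasZeroMorphisms T] [HasBinaryBiproducts T] :
    Type u :=
  {X : T // Indecomposable X}

/-- Isomorphism of indecomposable objects. -/
def indecSetoid (T : Type u) [Category.{v} T] [HasZeroMorphisms T] [HasBinaryBiproducts T] :
    Setoid (IndecObj T) where
  r X Y := Nonempty (X.1 ≅ Y.1)
  iseqv := ⟨fun _ => ⟨Iso.refl _⟩, fun ⟨e⟩ => ⟨e.symm⟩, fun ⟨e⟩ ⟨f⟩ => ⟨e ≪≫ f⟩⟩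

/-- `ind T`: the isomorphism classes of indecomposable objects of `T`. -/
def IndClass (T : Type u) [Category.{v} T] [HasZeroMorphisms T] [HasBinaryBiproducts T] : Type u :=
  Quotient (indecSetoid T)

/-- The isomorphism class of an indecomposable object. -/
def indMk {T : Type u} [Category.{v} T] [HasZeroMorphisms T] [HasBinaryBiproducts T]
    (X : IndecObj T) : IndClass T :=
  Quotient.mk (indecSetoid T) X

/-! ## The Auslander–Reiten quiver and Calabi–Yau configurations -/

section Triangulated

variable (k : Type w) [Field k] {T : Type u} [Category.{v} T] [Preadditive T] [Linear k T]
  [HasZeroObject T] [HasShift T ℤ] [∀ n : ℤ, (shiftFunctor T n).Additive] [Pretriangulated T]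

/-- An extension `δ : Y ⟶ X[1]` (the connecting morphism of a triangle `X ⟶ E ⟶ Y ⟶ X[1]`) is
almost split if it is non-split, its pushout along every non-section `X ⟶ X'` splits and its
pullback along every non-retraction `Y' ⟶ Y` splits. -/
def IsAlmostSplit {X Y : T} (δ : Y ⟶ X⟦(1 : ℤ)⟧) : Prop :=
  δ ≠ 0 ∧
  (∀ (X' : T) (a : X ⟶ X'), ¬ IsSplitMono a → δ ≫ a⟦(1 : ℤ)⟧' = 0) ∧
  (∀ (Y' : T) (c : Y' ⟶ Y), ¬ IsSplitEpi c → c ≫ δ = 0)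

open Classical in
/-- The bijection `e` is an isomorphism from the Auslander–Reiten quiver of `T` to `ℤΔ / 𝕊[d]` (as
translation quivers): the number of arrows between two vertices is the same on both sides (it is
`0` or `1` in `ℤΔ / 𝕊[d]`), and the Auslander–Reiten translation, which sends `Y` to `X` if there
is an almost split triangle `X ⟶ E ⟶ Y ⟶ X[1]`, corresponds to the translation. -/
def IsARQuiverIso (Δ : Dynkin) (d : ℕ) (e : IndClass T ≃ Δ.QVertex d) : Prop :=
  (∀ X Y : IndecObj T,
    irrDim k X.1 Y.1 = if Δ.QArrow d (e (indMk X)) (e (indMk Y)) then 1 else 0) ∧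
  (∀ X Y : IndecObj T,
    (∃ δ : Y.1 ⟶ X.1⟦(1 : ℤ)⟧, IsAlmostSplit δ) ↔ e (indMk X) = Δ.qTau d (e (indMk Y)))

open Classical in
/-- `(-d)`-Calabi–Yau configurations in `T`. -/
def IsCYConfiguration (d : ℕ) (C : Set (IndClass T)) : Prop :=
  (∀ X Y : IndecObj T, indMk X ∈ C → indMk Y ∈ C →
    Module.finrank k (X.1 ⟶ Y.1) = if indMk X = indMk Y then 1 else 0) ∧
  (∀ X Y : IndecObj T, indMk X ∈ C → indMk Y ∈ C → ∀ j : ℕ, 0 < j → j < d →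
    ∀ f : X.1 ⟶ Y.1⟦-(j : ℤ)⟧, f = 0) ∧
  (∀ M : IndecObj T, ∃ X : IndecObj T, indMk X ∈ C ∧ ∃ j : ℕ, j < d ∧
    ∃ f : X.1 ⟶ M.1⟦-(j : ℤ)⟧, f ≠ 0)

end Triangulated

end Categories

end NegCY

open NegCY

/-! Everything rests on one equality, dim Hom(X, Y) = h̄_x(Y) for any x over X, together with the
fact that the functor [1] acts on indecomposables as the shift permutation (`shift_and_finrank`).
Given both, the three conditions of the two definitions agree one by one.

Algebraic half. Fix an indecomposable X and filter Hom(X, -) by powers of the radical; the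
filtration is finite because there are finitely many indecomposables (`exists_radPow_eq_bot`).
Irreducible maps are chosen level by level so that consecutive levels form almost split triangles
(`exists_isMeshSystem`). The spans L_m of m-fold composites are then complements of rad^(m+1) in
rad^m (`radPow_eq_sup`, `disjoint_layer`), and for every c the sequence L_m(τc) → ⊕ L_{m+1}(b) →
L_{m+2}(c) → 0 is exact, with the socle part of L_m(τc) as kernel on the left. Almost split
triangles show that the socle of Hom(X, -) is one-dimensional and sits at τ(X[1]). Hence the graded
dimensions satisfy the additive recursion, except for a single extra 1 at one degree m₀ and at c =
X[1] (`exists_graded_dimension`). As the maps may vary with the level, T need not be standard.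

Combinatorial half. Read on ℤΔ, these dimensions start as the indicator of x, evolve by u(n+2) +
u(n) = A u(n+1) with A the adjacency matrix of Δ, receive one pulse and die out. The recursion can
be run backwards, so a solution that vanishes eventually vanishes always; applied after the pulse,
this says that the pulse cancels the wave at once (`wave_add_wave`). The dimensions therefore form a
truncated wave: it is non-negative because it counts dimensions, it vanishes at time m₀ + 2, and its
last value is the indicator of the position of the pulse. Since waves commute with A, m₀ does not
depend on x (`pulse_time_eq`); the explicit wave from vertex 1 gives m₀ + 2 = h, the Coxeter number
(`coxeterNumber_eq`); and the pulse sits at the Nakayama vertex (`top_eq_nakayamaVertex`), so X[1]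
is the shift of x. The additive function f_x is the same wave (`addFun_eq`). It vanishes just below
x and at the level where the truncation ends, so Q_x is confined to the strip between and h_x is the
truncated wave. Summing over levels gives h̄_x (`hBar_eq_sum`). -/

namespace NegCY

/-! ### The radical as an ideal, and irreducible morphisms. -/

section RadicalIdeal

universe w v u

variable {k : Type w} [Field k] {T : Type u} [Category.{v} T] [Preadditive T] [Linear k T]

/-- `1 - f g` is invertible if `1 - g f` is. -/
lemma isIso_one_sub_comp {X Y : T} (f : X ⟶ Y) (g : Y ⟶ X) (h : IsIso (𝟙 Y - g ≫ f)) :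
    IsIso (𝟙 X - f ≫ g) := by
  set i := inv (𝟙 Y - g ≫ f) with hi
  have h₁ : i - g ≫ f ≫ i = 𝟙 Y := by
    have : (𝟙 Y - g ≫ f) ≫ i = 𝟙 Y := IsIso.hom_inv_id (𝟙 Y - g ≫ f)
    simpa [Preadditive.sub_comp] using this
  have h₂ : i - i ≫ g ≫ f = 𝟙 Y := by
    have : i ≫ (𝟙 Y - g ≫ f) = 𝟙 Y := IsIso.inv_hom_id (𝟙 Y - g ≫ f)
    simpa [Preadditive.comp_sub] using this
  have h₁' : g ≫ f ≫ i = i - 𝟙 Y := by rw [← h₁]; abel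
  have h₂' : i ≫ g ≫ f = i - 𝟙 Y := by rw [← h₂]; abel
  -- The inverse suggested by the geometric series of `f ≫ g`.
  refine ⟨𝟙 X + f ≫ i ≫ g, ?_, ?_⟩
  · have : (f ≫ g) ≫ f ≫ i ≫ g = f ≫ (g ≫ f ≫ i) ≫ g := by simp
    rw [Preadditive.sub_comp, Preadditive.comp_add, Preadditive.comp_add, this, h₁']
    simp [Preadditive.comp_sub, Preadditive.sub_comp]
  · have : (f ≫ i ≫ g) ≫ f ≫ g = f ≫ (i ≫ g ≫ f) ≫ g := by simp
    rw [Preadditive.comp_sub, Preadditive.add_comp, Preadditive.add_comp, this, h₂']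
    simp [Preadditive.comp_sub, Preadditive.sub_comp]

lemma rad_comp {X Y Z : T} {f : X ⟶ Y} (hf : f ∈ rad k X Y) (g : Y ⟶ Z) :
    f ≫ g ∈ rad k X Z := fun h => by
  simpa using hf (g ≫ h)

lemma comp_rad {X Y Z : T} (f : X ⟶ Y) {g : Y ⟶ Z} (hg : g ∈ rad k Y Z) :
    f ≫ g ∈ rad k X Z := fun h => by
  have := isIso_one_sub_comp f (g ≫ h) (by simpa using hg (h ≫ f))
  simpa using this

lemma isIso_one_sub_of_mem_rad {X : T} {f : X ⟶ X} (hf : f ∈ rad k X X) : IsIso (𝟙 X - f) := by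
  simpa using hf (𝟙 X)

lemma isIso_or_isIso_one_sub {X : T} (hX : IsLocalRing (End X)) (f : X ⟶ X) :
    IsIso f ∨ IsIso (𝟙 X - f) := by
  have h : End.of f + End.of (𝟙 X - f) = 1 := add_sub_cancel f (𝟙 X)
  exact (IsLocalRing.isUnit_or_isUnit_of_add_one h).imp (isUnit_iff_isIso _).1
    (isUnit_iff_isIso _).1

lemma mem_rad_of_not_isSplitMono {X Y : T} (hX : IsLocalRing (End X)) {f : X ⟶ Y}
    (hf : ¬ IsSplitMono f) : f ∈ rad k X Y := fun g => by
  rcases isIso_or_isIso_one_sub hX (f ≫ g) with h | h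
  · exact (hf ⟨⟨⟨g ≫ inv (f ≫ g), by rw [← Category.assoc, IsIso.hom_inv_id]⟩⟩⟩).elim
  · exact h

lemma mem_rad_of_not_isSplitEpi {X Y : T} (hY : IsLocalRing (End Y)) {f : X ⟶ Y}
    (hf : ¬ IsSplitEpi f) : f ∈ rad k X Y := fun g => by
  apply isIso_one_sub_comp
  rcases isIso_or_isIso_one_sub hY (g ≫ f) with h | h
  · exact (hf ⟨⟨⟨inv (g ≫ f) ≫ g, by simp⟩⟩⟩).elim
  · exact h

lemma id_ne_zero_of_isLocalRing {X : T} (hX : IsLocalRing (End X)) : 𝟙 X ≠ 0 :=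
  fun h => one_ne_zero (α := End X) h

lemma id_notMem_rad {X : T} (hX : IsLocalRing (End X)) : 𝟙 X ∉ rad k X X := fun h => by
  have : IsIso (𝟙 X - 𝟙 X) := isIso_one_sub_of_mem_rad h
  have h0 := IsIso.hom_inv_id (𝟙 X - 𝟙 X)
  simp only [sub_self, zero_comp] at h0
  exact id_ne_zero_of_isLocalRing hX h0.symm

lemma not_isSplitMono_of_mem_rad {X Y : T} (hX : IsLocalRing (End X)) {f : X ⟶ Y}
    (hf : f ∈ rad k X Y) : ¬ IsSplitMono f := fun h => by
  have := rad_comp hf (retraction f)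
  rw [IsSplitMono.id] at this
  exact id_notMem_rad hX this

lemma not_isSplitEpi_of_mem_rad {X Y : T} (hY : IsLocalRing (End Y)) {f : X ⟶ Y}
    (hf : f ∈ rad k X Y) : ¬ IsSplitEpi f := fun h => by
  have := comp_rad (section_ f) hf
  rw [IsSplitEpi.id] at this
  exact id_notMem_rad hY this

lemma nonempty_iso_of_notMem_rad {X Y : T} (hX : IsLocalRing (End X)) (hY : IsLocalRing (End Y))
    {f : X ⟶ Y} (hf : f ∉ rad k X Y) : IsIso f := by
  have h₁ : IsSplitMono f := by
    by_contra h; exact hf (mem_rad_of_not_isSplitMono hX h)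
  have h₂ : IsSplitEpi f := by
    by_contra h; exact hf (mem_rad_of_not_isSplitEpi hY h)
  exact isIso_of_mono_of_isSplitEpi f

/-- An eigenvalue `c` of `f` makes `f - c` non-invertible, and non-units of a local endomorphism
ring are radical. So End modulo its radical is `k`; this is the source of every use of algebraic
closedness. -/
lemma exists_sub_smul_id_mem_rad [IsAlgClosed k] (hfin : IsHomFinite k T) {X : T}
    (hX : IsLocalRing (End X)) (f : X ⟶ X) : ∃ c : k, f - c • 𝟙 X ∈ rad k X X := by
  have : Module.Finite k (End X) := hfin X X
  obtain ⟨c, hc⟩ := spectrum.nonempty_of_isAlgClosed_of_finiteDimensional k (End.of f)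
  refine ⟨c, ?_⟩
  by_contra h
  have hi := nonempty_iso_of_notMem_rad hX hX h
  refine hc ?_
  have hu : IsUnit (End.of (f - c • 𝟙 X)) := (isUnit_iff_isIso _).2 hi
  have e : algebraMap k (End X) c - End.of f = -(End.of (f - c • 𝟙 X)) := by
    rw [Algebra.algebraMap_eq_smul_one]
    exact (neg_sub (End.of f) (c • (1 : End X))).symm
  have := hu.neg
  rw [← e] at this
  exact this

lemma comp_mem_radSq {X Y Z : T} {f : X ⟶ Y} {g : Y ⟶ Z} (hf : f ∈ rad k X Y)
    (hg : g ∈ rad k Y Z) : f ≫ g ∈ radSq k X Z :=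
  Submodule.subset_span ⟨Y, f, g, hf, hg, rfl⟩

/-- If the space of irreducible morphisms is one-dimensional, it is spanned by any morphism in
`rad` which is not in `rad²`. -/
lemma exists_sub_smul_mem_radSq (hfin : IsHomFinite k T) {X Y : T} (h : irrDim k X Y = 1)
    {a : X ⟶ Y} (ha : a ∈ rad k X Y) (ha' : a ∉ radSq k X Y) {f : X ⟶ Y} (hf : f ∈ rad k X Y) :
    ∃ c : k, f - c • a ∈ radSq k X Y := by
  have : Module.Finite k (X ⟶ Y) := hfin X Y
  set N := (radSq k X Y).submoduleOf (rad k X Y)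
  have hne : N.mkQ ⟨a, ha⟩ ≠ 0 := by
    intro h0
    rw [Submodule.mkQ_apply, Submodule.Quotient.mk_eq_zero] at h0
    exact ha' h0
  obtain ⟨c, hc⟩ := (finrank_eq_one_iff_of_nonzero' _ hne).1 h (N.mkQ ⟨f, hf⟩)
  refine ⟨c, ?_⟩
  have : N.mkQ (⟨f, hf⟩ - c • ⟨a, ha⟩) = 0 := by rw [map_sub, map_smul, hc, sub_self]
  rw [Submodule.mkQ_apply, Submodule.Quotient.mk_eq_zero] at this
  exact this

lemma exists_mem_rad_notMem_radSq {X Y : T} (h : irrDim k X Y = 1) :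
    ∃ a ∈ rad k X Y, a ∉ radSq k X Y := by
  by_contra! hc
  have : (radSq k X Y).submoduleOf (rad k X Y) = ⊤ := by
    ext x
    simpa [Submodule.submoduleOf] using hc x.1 x.2
  rw [irrDim, this, Module.finrank_zero_of_subsingleton] at h
  exact zero_ne_one h

lemma rad_le_radSq (hfin : IsHomFinite k T) {X Y : T} (h : irrDim k X Y = 0) :
    rad k X Y ≤ radSq k X Y := by
  have : Module.Finite k (X ⟶ Y) := hfin X Y
  have hs := Module.finrank_zero_iff.1 h
  rw [Submodule.Quotient.subsingleton_iff] at hs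
  intro f hf
  have : (⟨f, hf⟩ : rad k X Y) ∈ (radSq k X Y).submoduleOf (rad k X Y) := by
    rw [hs]; trivial
  exact this

end RadicalIdeal

/-! ### Krull–Schmidt decompositions. -/

section KrullSchmidt

universe w v u

variable {k : Type w} [Field k] {T : Type u} [Category.{v} T] [Preadditive T]

/-- A decomposition yields an idempotent `p`; one of `p`, `1 - p` is a unit, hence equal to 1, and
the complementary summand is zero. -/
lemma indecomposable_of_isLocalRing [HasBinaryBiproducts T] {X : T}
    (hX : IsLocalRing (End X)) : Indecomposable X := by
  refine ⟨fun h => id_ne_zero_of_isLocalRing hX ((IsZero.iff_id_eq_zero X).1 h), ?_⟩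
  intro Y Z e
  have key : ∀ a : End X, a * a = a → IsUnit a → a = 1 := by
    intro a ha hu
    simpa using hu.mul_left_cancel (ha.trans (mul_one a).symm)
  set p : End X := e.hom ≫ biprod.fst ≫ biprod.inl ≫ e.inv with hp
  have hpp : p * p = p := by
    rw [End.mul_def, hp]; simp
  rcases IsLocalRing.isUnit_or_isUnit_of_add_one (add_sub_cancel p 1) with h | h
  · right
    have h1 : e.hom ≫ biprod.fst ≫ biprod.inl ≫ e.inv = 𝟙 X := key p hpp h
    rw [IsZero.iff_id_eq_zero]
    have h2 : (biprod.inr ≫ e.inv) ≫ (e.hom ≫ biprod.fst ≫ biprod.inl ≫ e.inv) ≫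
      (e.hom ≫ biprod.snd) = 𝟙 Z := by rw [h1]; simp
    rw [← h2]; simp
  · left
    have h1 : 1 - p = 1 := key (1 - p) (by rw [mul_sub, sub_mul, sub_mul, hpp]; simp) h
    have h1' : e.hom ≫ biprod.fst ≫ biprod.inl ≫ e.inv = 0 := by
      have : p = 0 := by simpa using h1
      exact this
    rw [IsZero.iff_id_eq_zero]
    have h2 : (biprod.inl ≫ e.inv) ≫ (e.hom ≫ biprod.fst ≫ biprod.inl ≫ e.inv) ≫
      (e.hom ≫ biprod.fst) = 𝟙 Y := by simp
    rw [← h2, h1']; simp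

lemma isLocalRing_end_of_iso {X Y : T} (e : X ≅ Y) (hX : IsLocalRing (End X)) :
    IsLocalRing (End Y) := by
  have r : End X ≃+* End Y :=
    { toFun := fun f => e.inv ≫ f ≫ e.hom
      invFun := fun f => e.hom ≫ f ≫ e.inv
      left_inv := fun f => by simp
      right_inv := fun f => by simp
      map_add' := fun f g => by
        change e.inv ≫ ((f : X ⟶ X) + g) ≫ e.hom = e.inv ≫ f ≫ e.hom + e.inv ≫ g ≫ e.hom
        rw [Preadditive.add_comp, Preadditive.comp_add]
      map_mul' := fun f g => by simp [End.mul_def] }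
  have hn : Nontrivial (End Y) := Function.Injective.nontrivial r.injective
  refine { hn with isUnit_or_isUnit_of_add_one := fun {a b} hab => ?_ }
  have := IsLocalRing.isUnit_or_isUnit_of_add_one (a := r.symm a) (b := r.symm b)
    (by rw [← map_add, hab, map_one])
  refine this.imp (fun h => ?_) fun h => ?_ <;> simpa using h.map r

variable [HasZeroObject T] [HasShift T ℤ] [∀ n : ℤ, (shiftFunctor T n).Additive]
  [Pretriangulated T]

-- The cone of the split monomorphism `s` supplies the complement of `Y`, so no splitting of
-- idempotents has to be assumed.
open Pretriangulated in
lemma nonempty_iso_of_retract {X Y : T} (hX : Indecomposable X) (hY : ¬ IsZero Y)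
    (s : Y ⟶ X) (p : X ⟶ Y) (h : s ≫ p = 𝟙 Y) : Nonempty (X ≅ Y) := by
  obtain ⟨Z, g, δ, hT⟩ := distinguished_cocone_triangle s
  have : Mono s := mono_of_mono_fac h
  have h0 : (Triangle.mk s g δ).mor₃ = 0 :=
    (Triangle.mor₃_eq_zero_iff_mono₁ _ hT).2 this
  obtain ⟨e, -, -⟩ := exists_iso_binaryBiproduct_of_distTriang _ hT h0
  have e' : X ≅ Y ⊞ Z := e
  rcases hX.2 Y Z e' with h1 | h1
  · exact (hY h1).elim
  · exact ⟨e' ≪≫ (isoBiprodZero h1).symm⟩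

lemma exists_iso_summand (hKS : IsKrullSchmidt T) {X : T} (hX : Indecomposable X) :
    ∃ Y : T, IsLocalRing (End Y) ∧ Nonempty (X ≅ Y) := by
  obtain ⟨n, Y, hY, ⟨e⟩⟩ := hKS X
  have hn : Nonempty (Fin n) := by
    by_contra h
    rw [not_nonempty_iff] at h
    have h0 := biproduct.total (f := Y)
    rw [Finset.univ_eq_empty, Finset.sum_empty] at h0
    exact hX.1 (((IsZero.iff_id_eq_zero _).2 h0.symm).of_iso e)
  obtain ⟨i⟩ := hn
  refine ⟨Y i, hY i, nonempty_iso_of_retract hX ?_ (biproduct.ι Y i ≫ e.inv)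
    (e.hom ≫ biproduct.π Y i) (by simp)⟩
  intro hz
  exact id_ne_zero_of_isLocalRing (hY i) ((IsZero.iff_id_eq_zero _).1 hz)

lemma isLocalRing_end_of_indecomposable (hKS : IsKrullSchmidt T) {X : T}
    (hX : Indecomposable X) : IsLocalRing (End X) := by
  obtain ⟨Y, hY, ⟨e⟩⟩ := exists_iso_summand hKS hX
  exact isLocalRing_end_of_iso e.symm hY

/-- Every object is a finite direct sum of members of a family which contains all
indecomposable objects up to isomorphism. -/
lemma exists_decomposition (hKS : IsKrullSchmidt T) {ι : Type} (M : ι → T)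
    (hM : ∀ X : T, Indecomposable X → ∃ b, Nonempty (X ≅ M b)) (W : T) :
    ∃ (n : ℕ) (c : Fin n → ι) (p : ∀ i, W ⟶ M (c i)) (s : ∀ i, M (c i) ⟶ W),
      ∑ i, p i ≫ s i = 𝟙 W := by
  obtain ⟨n, Y, hY, ⟨e⟩⟩ := hKS W
  choose c hc using fun i => hM (Y i) (indecomposable_of_isLocalRing (hY i))
  have φ := fun i => (hc i).some
  refine ⟨n, c, fun i => e.hom ≫ biproduct.π Y i ≫ (φ i).hom,
    fun i => (φ i).inv ≫ biproduct.ι Y i ≫ e.inv, ?_⟩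
  have : ∀ i, (e.hom ≫ biproduct.π Y i ≫ (φ i).hom) ≫ (φ i).inv ≫ biproduct.ι Y i ≫ e.inv =
      e.hom ≫ (biproduct.π Y i ≫ biproduct.ι Y i) ≫ e.inv := by intro i; simp
  simp_rw [this]
  rw [← Preadditive.comp_sum, ← Preadditive.sum_comp, biproduct.total]
  simp

end KrullSchmidt

/-! ### Powers of the radical. -/

section RadicalPowers

universe w v u

variable (k : Type w) [Field k] {T : Type u} [Category.{v} T] [Preadditive T] [Linear k T]

/-- The powers of the radical, `rad^m(X, W)`. -/
def radPow (X : T) : ℕ → ∀ W : T, Submodule k (X ⟶ W)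
  | 0, _ => ⊤
  | m + 1, W => Submodule.span k {h | ∃ (Z : T) (f : X ⟶ Z) (g : Z ⟶ W),
      f ∈ radPow X m Z ∧ g ∈ rad k Z W ∧ h = f ≫ g}

variable {k} {X : T}

lemma radPow_comp_rad {m : ℕ} {W W' : T} {u : X ⟶ W} (hu : u ∈ radPow k X m W) {r : W ⟶ W'}
    (hr : r ∈ rad k W W') : u ≫ r ∈ radPow k X (m + 1) W' :=
  Submodule.subset_span ⟨W, u, r, hu, hr, rfl⟩

lemma radPow_comp {m : ℕ} {W W' : T} {u : X ⟶ W} (hu : u ∈ radPow k X m W) (t : W ⟶ W') :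
    u ≫ t ∈ radPow k X m W' := by
  cases m with
  | zero => trivial
  | succ m =>
    have : radPow k X (m + 1) W ≤ (radPow k X (m + 1) W').comap (Linear.rightComp k X t) := by
      refine Submodule.span_le.2 ?_
      rintro _ ⟨Z, f, g, hf, hg, rfl⟩
      simp only [Submodule.comap_coe, Set.mem_preimage, Linear.rightComp_apply, Category.assoc,
        SetLike.mem_coe]
      exact radPow_comp_rad hf (rad_comp hg t)
    exact this hu

lemma radPow_succ_le (m : ℕ) (W : T) : radPow k X (m + 1) W ≤ radPow k X m W := by
  refine Submodule.span_le.2 ?_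
  rintro _ ⟨Z, f, g, hf, hg, rfl⟩
  exact radPow_comp hf g

lemma radPow_antitone (W : T) : Antitone fun m => radPow k X m W :=
  antitone_nat_of_succ_le fun m => radPow_succ_le m W

lemma radPow_one (W : T) : radPow k X 1 W = rad k X W := by
  refine le_antisymm (Submodule.span_le.2 ?_) fun f hf => ?_
  · rintro _ ⟨Z, f, g, -, hg, rfl⟩
    exact comp_rad f hg
  · have := radPow_comp_rad (m := 0) (u := 𝟙 X) trivial hf
    simpa using this

lemma radPow_two (W : T) : radPow k X 2 W = radSq k X W := by
  change Submodule.span k _ = Submodule.span k _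
  simp_rw [radPow_one]

lemma radPow_comp_radSq {m : ℕ} {W W' : T} {u : X ⟶ W} (hu : u ∈ radPow k X m W) {r : W ⟶ W'}
    (hr : r ∈ radSq k W W') : u ≫ r ∈ radPow k X (m + 2) W' := by
  have : radSq k W W' ≤ (radPow k X (m + 2) W').comap (Linear.leftComp k W' u) := by
    refine Submodule.span_le.2 ?_
    rintro _ ⟨Z, f, g, hf, hg, rfl⟩
    have := radPow_comp_rad (radPow_comp_rad hu hf) hg
    simpa using this
  exact this hr

/-- Translates the categorical radical into the ring-theoretic one, so that Nakayama's lemma applies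
over End G. -/
lemma mem_ringJacobson_of_mem_rad {G : T} {r : G ⟶ G} (hr : r ∈ rad k G G) :
    End.of r ∈ Ring.jacobson (End G) := by
  rw [← Ideal.jacobson_bot, Ideal.mem_jacobson_iff]
  intro y
  have hi : IsIso (𝟙 G + r ≫ y.asHom) := by
    have := hr (-y.asHom)
    simpa using this
  refine ⟨End.of (inv (𝟙 G + r ≫ y.asHom)), ?_⟩
  rw [Ideal.mem_bot, sub_eq_zero, mul_assoc]
  have := IsIso.hom_inv_id (𝟙 G + r ≫ y.asHom)
  rw [Preadditive.add_comp, Category.id_comp, add_comm] at this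
  exact this

end RadicalPowers

/-! ### Nilpotency of the radical. -/

section Nilpotent

universe w v u

variable {k : Type w} [Field k] {T : Type u} [Category.{v} T] [Preadditive T] [Linear k T]
  [HasFiniteBiproducts T]

/-- The radical of a Hom-finite category with finitely many indecomposable objects is
nilpotent. -/
lemma exists_radPow_eq_bot (hfin : IsHomFinite k T) {ι : Type} [Finite ι] (M : ι → T)
    (hM : ∀ W : T, ∃ (n : ℕ) (c : Fin n → ι) (p : ∀ i, W ⟶ M (c i)) (s : ∀ i, M (c i) ⟶ W),
      ∑ i, p i ≫ s i = 𝟙 W) (X : T) :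
    ∃ N, ∀ W : T, radPow k X N W = ⊥ := by
  classical
  have := Fintype.ofFinite ι
  -- Every object is a retract of a finite sum of copies of summands of `G`, so it suffices to study
  -- the descending chain rad^m(X, G), which stabilizes for dimension reasons.
  set G := ⨁ M with hG
  have : Module.Finite k (X ⟶ G) := hfin X G
  obtain ⟨N, hN⟩ := IsArtinian.monotone_stabilizes
    (⟨fun m => OrderDual.toDual (radPow k X m G), fun a b h => radPow_antitone G h⟩ :
      ℕ →o (Submodule k (X ⟶ G))ᵒᵈ)
  have hN' : radPow k X N G = radPow k X (N + 1) G := hN (N + 1) (Nat.le_succ N)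
  let S : Submodule (End G) (X ⟶ G) :=
    { carrier := radPow k X N G
      zero_mem' := zero_mem _
      add_mem' := fun h₁ h₂ => add_mem h₁ h₂
      smul_mem' := fun r f hf => radPow_comp hf r.asHom }
  have hS : ∀ f : X ⟶ G, f ∈ S ↔ f ∈ radPow k X N G := fun f => Iff.rfl
  have hfg : S.FG := by
    obtain ⟨s, hs⟩ := (IsNoetherian.noetherian (radPow k X N G) : (radPow k X N G).FG)
    refine ⟨s, le_antisymm (Submodule.span_le.2 fun f hf => ?_) fun f hf => ?_⟩
    · rw [SetLike.mem_coe, hS, ← hs]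
      exact Submodule.subset_span hf
    · rw [hS, ← hs] at hf
      induction hf using Submodule.span_induction with
      | mem x h => exact Submodule.subset_span h
      | zero => exact zero_mem _
      | add x y _ _ hx hy => exact add_mem hx hy
      | smul a x _ hx =>
        have := Submodule.smul_mem _ (End.of (a • 𝟙 G)) hx
        have e : End.of (a • 𝟙 G) • x = a • x := by
          change x ≫ (a • 𝟙 G) = a • x
          simp
        rwa [e] at this
  -- Once stable, the term `S` satisfies S = rad · S: the intermediate object of a composite is
  -- decomposed and routed through `G`. Nakayama's lemma then gives S = 0.
  have hle : S ≤ Ring.jacobson (End G) • S := by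
    intro f hf
    rw [hS, hN'] at hf
    change f ∈ Submodule.span k _ at hf
    induction hf using Submodule.span_induction with
    | mem x h =>
      obtain ⟨Z, f, g, hf, hg, rfl⟩ := h
      obtain ⟨n, c, p, s, hps⟩ := hM Z
      have e : f ≫ g =
          ∑ i, (f ≫ p i ≫ biproduct.ι M (c i)) ≫ (biproduct.π M (c i) ≫ s i ≫ g) := by
        have : ∀ i, (f ≫ p i ≫ biproduct.ι M (c i)) ≫ (biproduct.π M (c i) ≫ s i ≫ g) =
            f ≫ (p i ≫ s i) ≫ g := fun i => by simp
        simp_rw [this]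
        rw [← Preadditive.comp_sum, ← Preadditive.sum_comp, hps, Category.id_comp]
      rw [e]
      refine sum_mem fun i _ => ?_
      exact Submodule.smul_mem_smul
        (mem_ringJacobson_of_mem_rad (k := k) (comp_rad _ (comp_rad _ hg)))
        ((hS _).2 (radPow_comp hf _))
    | zero => exact zero_mem _
    | add x y _ _ hx hy => exact add_mem hx hy
    | smul a x _ hx =>
      have e : End.of (a • 𝟙 G) • x = a • x := by
        change x ≫ (a • 𝟙 G) = a • x
        simp
      rw [← e]
      refine Submodule.smul_induction_on hx (fun r hr y hy => ?_) fun y z hy hz => ?_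
      · rw [smul_smul]
        have h1 : End.of (a • 𝟙 G) * r = r * End.of (a • 𝟙 G) := by
          change r.asHom ≫ (a • 𝟙 G) = (a • 𝟙 G) ≫ r.asHom
          simp
        rw [h1, mul_smul]
        exact Submodule.smul_mem_smul hr (S.smul_mem _ hy)
      · rw [smul_add]
        exact add_mem hy hz
  have h0 := hfg.eq_bot_of_le_jacobson_smul hle
  refine ⟨N, fun W => (Submodule.eq_bot_iff _).2 fun f hf => ?_⟩
  obtain ⟨n, c, p, s, hps⟩ := hM W
  rw [← Category.comp_id f, ← hps, Preadditive.comp_sum]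
  refine Finset.sum_eq_zero fun i _ => ?_
  have h1 : f ≫ p i ≫ biproduct.ι M (c i) ∈ S := (hS _).2 (radPow_comp hf _)
  rw [h0, Submodule.mem_bot] at h1
  have h2 : f ≫ p i = (f ≫ p i ≫ biproduct.ι M (c i)) ≫ biproduct.π M (c i) := by simp
  rw [← Category.assoc, h2, h1]
  simp

end Nilpotent

/-! ### Meshes from almost split triangles. -/

section Mesh

universe w v u

variable (k : Type w) [Field k] {T : Type u} [Category.{v} T] [Preadditive T] [Linear k T]

/-- The family `a`, `g` of radical morphisms `X ⟶ N j ⟶ Y` is a mesh: the composite vanishes, the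
middle is weakly exact, and `a`, `g` are left and right almost split. -/
structure IsMesh {J : Type} [Fintype J] {N : J → T} {X Y : T} (a : ∀ j, X ⟶ N j)
    (g : ∀ j, N j ⟶ Y) : Prop where
  left_rad : ∀ j, a j ∈ rad k X (N j)
  right_rad : ∀ j, g j ∈ rad k (N j) Y
  sum_comp : ∑ j, a j ≫ g j = 0
  exact : ∀ (W : T) (v : ∀ j, W ⟶ N j), ∑ j, v j ≫ g j = 0 → ∃ w : W ⟶ X, ∀ j, v j = w ≫ a j
  right_lift : ∀ (W : T) (h : W ⟶ Y), h ∈ rad k W Y → ∃ t : ∀ j, W ⟶ N j, h = ∑ j, t j ≫ g j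
  left_lift : ∀ (W : T) (h : X ⟶ W), h ∈ rad k X W → ∃ t : ∀ j, N j ⟶ W, h = ∑ j, a j ≫ t j

variable {k}

lemma IsMesh.radSq_lift {J : Type} [Fintype J] {N : J → T} {X Y : T} {a : ∀ j, X ⟶ N j}
    {g : ∀ j, N j ⟶ Y} (hm : IsMesh k a g) {W : T} {h : W ⟶ Y} (hh : h ∈ radSq k W Y) :
    ∃ r : ∀ j, W ⟶ N j, (∀ j, r j ∈ rad k W (N j)) ∧ h = ∑ j, r j ≫ g j := by
  induction hh using Submodule.span_induction with
  | mem x hx =>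
    obtain ⟨Z, r₁, r₂, h₁, h₂, rfl⟩ := hx
    obtain ⟨t, rfl⟩ := hm.right_lift Z r₂ h₂
    exact ⟨fun j => r₁ ≫ t j, fun j => rad_comp h₁ _, by simp [Preadditive.comp_sum]⟩
  | zero => exact ⟨fun j => 0, fun j => zero_mem _, by simp⟩
  | add x y _ _ hx hy =>
    obtain ⟨r, hr, rfl⟩ := hx
    obtain ⟨s, hs, rfl⟩ := hy
    exact ⟨fun j => r j + s j, fun j => add_mem (hr j) (hs j), by
      simp [Preadditive.add_comp, Finset.sum_add_distrib]⟩
  | smul c x _ hx =>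
    obtain ⟨r, hr, rfl⟩ := hx
    exact ⟨fun j => c • r j, fun j => Submodule.smul_mem _ _ (hr j), by
      simp [Finset.smul_sum, Linear.smul_comp]⟩

/-- If `g j` were in rad², then `g j = ∑ r i ≫ g i` with radical `r i`. Exactness factors the j-th
coordinate inclusion minus `r` through the radical family `a`, which would make the identity of `N
j` radical. -/
lemma IsMesh.notMem_radSq [HasFiniteBiproducts T] {J : Type} [Fintype J] {N : J → T} {X Y : T}
    {a : ∀ j, X ⟶ N j} {g : ∀ j, N j ⟶ Y} (hm : IsMesh k a g) (j : J)
    (hj : IsLocalRing (End (N j))) : g j ∉ radSq k (N j) Y := by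
  intro h
  obtain ⟨r, hr, e⟩ := hm.radSq_lift h
  obtain ⟨w, hw⟩ := hm.exact (N j) (fun i => biproduct.ι N j ≫ biproduct.π N i - r i) (by
    have h1 : ∀ i, (biproduct.ι N j ≫ biproduct.π N i) ≫ g i =
        biproduct.ι N j ≫ (biproduct.π N i ≫ biproduct.ι N i) ≫ biproduct.desc g := by simp
    simp only [Preadditive.sub_comp, Finset.sum_sub_distrib]
    simp_rw [h1, ← Preadditive.comp_sum, ← Preadditive.sum_comp, biproduct.total]
    simp [← e])
  have h1 := hw j
  simp only [biproduct.ι_π_self] at h1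
  refine id_notMem_rad (k := k) hj ?_
  rw [sub_eq_iff_eq_add.1 h1]
  exact add_mem (comp_rad _ (hm.left_rad j)) (hr j)

variable [HasZeroObject T] [HasShift T ℤ] [∀ n : ℤ, (shiftFunctor T n).Additive]
  [Pretriangulated T]

open Pretriangulated

section Exact

variable {X E Y W : T} {f : X ⟶ E} {g : E ⟶ Y} {δ : Y ⟶ X⟦(1 : ℤ)⟧}

/-- Exactness at the third vertex of the rotated triangle, pulled back along the full and faithful
shift; the sign is that of the rotation. -/
lemma exists_factor_of_shift_comp_eq_zero (hT : Triangle.mk f g δ ∈ distTriang T) (a : X ⟶ W)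
    (ha : δ ≫ a⟦(1 : ℤ)⟧' = 0) : ∃ b : E ⟶ W, a = f ≫ b := by
  obtain ⟨(b : E⟦(1 : ℤ)⟧ ⟶ W⟦(1 : ℤ)⟧), (hb : a⟦(1 : ℤ)⟧' = (-f⟦(1 : ℤ)⟧') ≫ b)⟩ :=
    Triangle.yoneda_exact₃ _ (rot_of_distTriang _ hT) (a⟦(1 : ℤ)⟧') ha
  obtain ⟨b', rfl⟩ := (shiftFunctor T (1 : ℤ)).map_surjective b
  refine ⟨-b', (shiftFunctor T (1 : ℤ)).map_injective ?_⟩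
  rw [hb]
  simp

lemma exists_factor_through_second (hT : Triangle.mk f g δ ∈ distTriang T) (a : E ⟶ W)
    (ha : f ≫ a = 0) : ∃ b : Y ⟶ W, a = g ≫ b :=
  Triangle.yoneda_exact₂ _ hT a ha

lemma exists_lift_first (hT : Triangle.mk f g δ ∈ distTriang T) (a : W ⟶ E)
    (ha : a ≫ g = 0) : ∃ b : W ⟶ X, a = b ≫ f :=
  Triangle.coyoneda_exact₂ _ hT a ha

lemma exists_lift_second (hT : Triangle.mk f g δ ∈ distTriang T) (a : W ⟶ Y)
    (ha : a ≫ δ = 0) : ∃ b : W ⟶ E, a = b ≫ g :=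
  Triangle.coyoneda_exact₃ _ hT a ha

end Exact

/-- A minimal left almost split family with source `X` can be completed to a mesh which ends in
`τ⁻¹ X`. -/
lemma exists_isMesh {X Y : T} (hX : IsLocalRing (End X)) (hY : IsLocalRing (End Y))
    {δ : Y ⟶ X⟦(1 : ℤ)⟧} (hδ : IsAlmostSplit δ) {J : Type} [Fintype J] {N : J → T}
    (a : ∀ j, X ⟶ N j) (ha : ∀ j, a j ∈ rad k X (N j))
    (hlift : ∀ (W : T) (h : X ⟶ W), h ∈ rad k X W → ∃ t : ∀ j, N j ⟶ W, h = ∑ j, a j ≫ t j)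
    (hmin : ∀ e : ∀ i j, N i ⟶ N j, (∀ j, ∑ i, a i ≫ e i j = 0) →
      ∀ i j, e i j ∈ rad k (N i) (N j)) :
    ∃ g : ∀ j, N j ⟶ Y, IsMesh k a g := by
  classical
  obtain ⟨E, f, g, hT⟩ := distinguished_cocone_triangle₂ δ
  have hf : f ∈ rad k X E := mem_rad_of_not_isSplitMono hX fun h =>
    hδ.1 ((Triangle.mor₃_eq_zero_iff_mono₁ _ hT).2 (inferInstanceAs (Mono f)))
  have hg : g ∈ rad k E Y := mem_rad_of_not_isSplitEpi hY fun h =>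
    hδ.1 ((Triangle.mor₃_eq_zero_iff_epi₂ _ hT).2 (inferInstanceAs (Epi g)))
  have hfg : f ≫ g = 0 := comp_distTriang_mor_zero₁₂ _ hT
  set α : X ⟶ ⨁ N := biproduct.lift a with hα
  have hα' : α = ∑ j, a j ≫ biproduct.ι N j := by
    rw [hα, biproduct.lift_eq]
  have hαr : α ∈ rad k X (⨁ N) := by
    rw [hα']
    exact sum_mem fun j _ => rad_comp (ha j) _
  -- Both `X ⟶ E` and `X ⟶ ⨁ N` are left almost split, so each factors through the other, by `θ` and
  -- `θ'`. The rest shows that both composites of `θ` and `θ'` are invertible.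
  obtain ⟨θ, hθ⟩ := exists_factor_of_shift_comp_eq_zero hT α
    (hδ.2.1 _ _ (not_isSplitMono_of_mem_rad hX hαr))
  obtain ⟨t, ht⟩ := hlift E f hf
  have hf' : f = α ≫ biproduct.desc t := by rw [ht, hα, biproduct.lift_desc]
  set θ' := biproduct.desc t
  -- The difference is killed by `f`, so it factors through the radical map `g`; subtracting it from
  -- the identity leaves an isomorphism.
  obtain ⟨s, hs⟩ := exists_factor_through_second hT (𝟙 E - θ ≫ θ') (by
    rw [Preadditive.comp_sub, ← Category.assoc, ← hθ, ← hf']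
    simp)
  have h₁ : IsIso (θ ≫ θ') := by
    have := hg s
    rwa [← hs, sub_sub_cancel] at this
  have hz : α ≫ (𝟙 (⨁ N) - θ' ≫ θ) = 0 := by
    rw [Preadditive.comp_sub, ← Category.assoc, ← hf', ← hθ]
    simp
  -- On the other side minimality of the family plays the role of the radical map `g`.
  have he := hmin (fun i j => biproduct.ι N i ≫ (𝟙 (⨁ N) - θ' ≫ θ) ≫ biproduct.π N j) (by
    intro j
    have : ∑ i, a i ≫ biproduct.ι N i ≫ (𝟙 (⨁ N) - θ' ≫ θ) ≫ biproduct.π N j =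
        (α ≫ (𝟙 (⨁ N) - θ' ≫ θ)) ≫ biproduct.π N j := by
      rw [hα']; simp only [Preadditive.sum_comp, Category.assoc]
    rw [this, hz, zero_comp])
  have hr : 𝟙 (⨁ N) - θ' ≫ θ ∈ rad k (⨁ N) (⨁ N) := by
    have e : 𝟙 (⨁ N) - θ' ≫ θ = ∑ i, ∑ j, biproduct.π N i ≫
        (biproduct.ι N i ≫ (𝟙 (⨁ N) - θ' ≫ θ) ≫ biproduct.π N j) ≫ biproduct.ι N j := by
      have : ∀ i j, biproduct.π N i ≫
          (biproduct.ι N i ≫ (𝟙 (⨁ N) - θ' ≫ θ) ≫ biproduct.π N j) ≫ biproduct.ι N j =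
          (biproduct.π N i ≫ biproduct.ι N i) ≫ (𝟙 (⨁ N) - θ' ≫ θ) ≫
            (biproduct.π N j ≫ biproduct.ι N j) := fun i j => by simp only [Category.assoc]
      simp_rw [this, ← Preadditive.comp_sum, ← Preadditive.sum_comp, biproduct.total]
      simp
    rw [e]
    exact sum_mem fun i _ => sum_mem fun j _ => comp_rad _ (rad_comp (he i j) _)
  have h₂ : IsIso (θ' ≫ θ) := by
    have := isIso_one_sub_of_mem_rad hr
    rwa [sub_sub_cancel] at this
  have h₃ : IsIso θ := by
    have : IsSplitMono θ := ⟨⟨⟨θ' ≫ inv (θ ≫ θ'), by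
      rw [← Category.assoc, IsIso.hom_inv_id]⟩⟩⟩
    have : IsSplitEpi θ := ⟨⟨⟨inv (θ' ≫ θ) ≫ θ', by simp⟩⟩⟩
    exact isIso_of_mono_of_isSplitEpi θ
  refine ⟨fun j => biproduct.ι N j ≫ inv θ ≫ g, ha, fun j => comp_rad _ (comp_rad _ hg), ?_, ?_,
    ?_, hlift⟩
  · have : ∑ j, a j ≫ biproduct.ι N j ≫ inv θ ≫ g = α ≫ inv θ ≫ g := by
      rw [hα']; simp only [Preadditive.sum_comp, Category.assoc]
    rw [this, hθ]
    simp [hfg]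
  · intro W v hv
    obtain ⟨w, hw⟩ := exists_lift_first hT (biproduct.lift v ≫ inv θ) (by
      rw [← hv, biproduct.lift_eq]
      simp only [Preadditive.sum_comp, Category.assoc])
    have hw'' : biproduct.lift v = w ≫ α := by
      rw [hθ, ← Category.assoc, ← hw]; simp
    refine ⟨w, fun j => ?_⟩
    have := congrArg (· ≫ biproduct.π N j) hw''
    simpa only [hα, Category.assoc, biproduct.lift_π] using this
  · intro W h hh
    obtain ⟨u, hu⟩ := exists_lift_second hT h
      (hδ.2.2 _ _ (not_isSplitEpi_of_mem_rad hY hh))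
    refine ⟨fun j => u ≫ θ ≫ biproduct.π N j, ?_⟩
    have : ∀ j, (u ≫ θ ≫ biproduct.π N j) ≫ biproduct.ι N j ≫ inv θ ≫ g =
        (u ≫ θ) ≫ (biproduct.π N j ≫ biproduct.ι N j) ≫ inv θ ≫ g := fun j => by
      simp only [Category.assoc]
    simp_rw [this, ← Preadditive.comp_sum, ← Preadditive.sum_comp, biproduct.total]
    simp [hu]

end Mesh

/-! ### Almost split maps read off from the Auslander–Reiten quiver. -/

section ARSystem

universe w v u

variable (k : Type w) [Field k] {T : Type u} [Category.{v} T] [Preadditive T] [Linear k T]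
  [HasZeroObject T] [HasShift T ℤ] [∀ n : ℤ, (shiftFunctor T n).Additive]
  [Pretriangulated T]

/-- The family `M` represents the indecomposable objects of a Hom-finite category, and `Arr`,
`tau` describe its Auslander–Reiten quiver, which has no multiple arrows. -/
structure IsARSystem {ι : Type} (M : ι → T) (Arr : ι → ι → Prop) (tau : ι → ι) : Prop where
  hfin : IsHomFinite k T
  isLocalRing : ∀ b, IsLocalRing (End (M b))
  eq_of_iso : ∀ b b', Nonempty (M b ≅ M b') → b = b'
  decomp : ∀ W : T, ∃ (n : ℕ) (c : Fin n → ι) (p : ∀ i, W ⟶ M (c i)) (s : ∀ i, M (c i) ⟶ W),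
      ∑ i, p i ≫ s i = 𝟙 W
  irr_one : ∀ b b', Arr b b' → irrDim k (M b) (M b') = 1
  irr_zero : ∀ b b', ¬ Arr b b' → irrDim k (M b) (M b') = 0
  arr_tau : ∀ b c, Arr (tau c) b ↔ Arr b c
  almostSplit : ∀ c, ∃ δ : M c ⟶ (M (tau c))⟦(1 : ℤ)⟧, IsAlmostSplit δ

variable {k} {ι : Type} {M : ι → T} {Arr : ι → ι → Prop} {tau : ι → ι}

namespace IsARSystem

variable (S : IsARSystem k M Arr tau)
include S

lemma mem_rad_of_ne {b b' : ι} (h : b ≠ b') (f : M b ⟶ M b') : f ∈ rad k (M b) (M b') := by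
  by_contra hf
  have := nonempty_iso_of_notMem_rad (S.isLocalRing b) (S.isLocalRing b') hf
  exact h (S.eq_of_iso b b' ⟨asIso f⟩)

/-- Modulo rad², a radical map from `M x` to an indecomposable is a multiple of some `a j` or zero.
Iterating pushes the error into arbitrarily high powers of the radical, which vanish. -/
lemma rad_le_of_arr [Finite ι] (x : ι) {J : Type} [Fintype J] (β : J → ι)
    (hβ : ∀ b, Arr x b → ∃ j, β j = b) (a : ∀ j, M x ⟶ M (β j))
    (ha : ∀ j, a j ∈ rad k (M x) (M (β j))) (ha' : ∀ j, a j ∉ radSq k (M x) (M (β j)))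
    (W : T) (h : M x ⟶ W) (hh : h ∈ rad k (M x) W) :
    ∃ t : ∀ j, M (β j) ⟶ W, h = ∑ j, a j ≫ t j := by
  classical
  let A : ∀ W : T, Submodule k (M x ⟶ W) := fun W =>
    ⨆ j, LinearMap.range (Linear.leftComp k W (a j))
  have hA : ∀ (W : T) (h : M x ⟶ W), h ∈ A W ↔ ∃ t : ∀ j, M (β j) ⟶ W, h = ∑ j, a j ≫ t j := by
    intro W h
    rw [Submodule.mem_iSup_iff_exists_finsupp]
    constructor
    · rintro ⟨f, hf, rfl⟩
      choose t ht using hf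
      refine ⟨t, ?_⟩
      rw [Finsupp.sum_fintype _ _ (fun _ => rfl)]
      exact Finset.sum_congr rfl fun j _ => (ht j).symm
    · rintro ⟨t, rfl⟩
      refine ⟨Finsupp.equivFunOnFinite.symm fun j => a j ≫ t j, fun j => ⟨t j, rfl⟩, ?_⟩
      rw [Finsupp.sum_fintype _ _ (fun _ => rfl)]
      rfl
  have hAc : ∀ {W W' : T} {f : M x ⟶ W} (_ : f ∈ A W) (t : W ⟶ W'), f ≫ t ∈ A W' := by
    intro W W' f hf t
    obtain ⟨s, rfl⟩ := (hA _ _).1 hf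
    exact (hA _ _).2 ⟨fun j => s j ≫ t, by simp [Preadditive.sum_comp]⟩
  have hind : ∀ b, rad k (M x) (M b) ≤ A (M b) ⊔ radSq k (M x) (M b) := by
    intro b f hf
    by_cases hb : Arr x b
    · obtain ⟨j, rfl⟩ := hβ b hb
      obtain ⟨c, hc⟩ := exists_sub_smul_mem_radSq S.hfin (S.irr_one _ _ hb) (ha j) (ha' j) hf
      rw [← add_sub_cancel (c • a j) f]
      refine Submodule.add_mem_sup (Submodule.smul_mem _ _ ?_) hc
      exact Submodule.mem_iSup_of_mem j ⟨𝟙 _, by simp⟩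
    · exact Submodule.mem_sup_right (rad_le_radSq S.hfin (S.irr_zero _ _ hb) hf)
  have hbase : ∀ W, rad k (M x) W ≤ A W ⊔ radSq k (M x) W := by
    intro W f hf
    obtain ⟨n, c, p, s, hps⟩ := S.decomp W
    rw [← Category.comp_id f, ← hps, Preadditive.comp_sum]
    refine sum_mem fun i _ => ?_
    rw [← Category.assoc]
    obtain ⟨y, hy, z, hz, e⟩ := Submodule.mem_sup.1 (hind (c i) (rad_comp hf (p i)))
    rw [← e, Preadditive.add_comp]
    rw [← radPow_two] at hz ⊢
    exact Submodule.add_mem_sup (hAc hy _) (radPow_comp hz _)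
  have hstep : ∀ m W, radPow k (M x) (m + 1) W ≤ A W ⊔ radPow k (M x) (m + 2) W := by
    intro m
    induction m with
    | zero =>
      intro W
      rw [radPow_one, radPow_two]
      exact hbase W
    | succ m ih =>
      intro W
      refine Submodule.span_le.2 ?_
      rintro _ ⟨Z, f, g, hf, hg, rfl⟩
      obtain ⟨y, hy, z, hz, rfl⟩ := Submodule.mem_sup.1 (ih Z hf)
      rw [SetLike.mem_coe, Preadditive.add_comp]
      exact Submodule.add_mem_sup (hAc hy _) (radPow_comp_rad hz hg)
  have hall : ∀ m W, rad k (M x) W ≤ A W ⊔ radPow k (M x) (m + 1) W := by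
    intro m
    induction m with
    | zero => intro W; rw [radPow_one]; exact le_sup_right
    | succ m ih =>
      intro W
      exact (ih W).trans (sup_le le_sup_left (hstep m W))
  obtain ⟨N, hN⟩ := exists_radPow_eq_bot S.hfin M S.decomp (M x)
  refine (hA W h).1 ?_
  have h1 := hall N W hh
  have h2 : radPow k (M x) (N + 1) W = ⊥ := le_bot_iff.1 ((radPow_succ_le N W).trans (hN W).le)
  rwa [h2, sup_bot_eq] at h1

/-- Irreducible morphisms from `τ c` can be completed to a mesh which ends in `c`. -/
lemma exists_mesh [IsAlgClosed k] [Finite ι] (c : ι) [Fintype {b // Arr b c}]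
    (a : ∀ j : {b // Arr b c}, M (tau c) ⟶ M j.1)
    (ha : ∀ j, a j ∈ rad k (M (tau c)) (M j.1)) (ha' : ∀ j, a j ∉ radSq k (M (tau c)) (M j.1)) :
    ∃ g : ∀ j : {b // Arr b c}, M j.1 ⟶ M c, IsMesh k a g ∧
      ∀ j, g j ∉ radSq k (M j.1) (M c) := by
  classical
  obtain ⟨δ, hδ⟩ := S.almostSplit c
  obtain ⟨g, hg⟩ := exists_isMesh (k := k) (S.isLocalRing (tau c)) (S.isLocalRing c) hδ a ha
    (fun W h hh => S.rad_le_of_arr (tau c) (fun j : {b // Arr b c} => j.1)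
      (fun b hb => ⟨⟨b, (S.arr_tau b c).1 hb⟩, rfl⟩) a ha ha' W h hh) (by
      intro e he i j
      by_cases hij : i = j
      · subst hij
        -- The diagonal entry is a scalar `r` plus a radical map. If `r ≠ 0`, the i-th relation
        -- writes `r • a i` as a sum of composites of radical maps, contradicting `a i ∉ rad²`. Off
        -- the diagonal the objects are not isomorphic.
        obtain ⟨r, hr⟩ := exists_sub_smul_id_mem_rad S.hfin (S.isLocalRing i.1) (e i i)
        by_cases hr0 : r = 0
        · simpa [hr0] using hr
        · exfalso
          refine ha' i ?_
          have h1 : a i ≫ e i i ∈ radSq k (M (tau c)) (M i.1) := by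
            have := he i
            rw [← Finset.add_sum_erase _ _ (Finset.mem_univ i)] at this
            rw [eq_neg_of_add_eq_zero_left this]
            refine neg_mem (sum_mem fun j hj => ?_)
            exact comp_mem_radSq (ha j) (S.mem_rad_of_ne
              (fun h => (Finset.ne_of_mem_erase hj) (Subtype.ext h)) _)
          have h2 : a i ≫ (e i i - r • 𝟙 _) ∈ radSq k (M (tau c)) (M i.1) :=
            comp_mem_radSq (ha i) hr
          have h3 : a i = r⁻¹ • (a i ≫ e i i - a i ≫ (e i i - r • 𝟙 _)) := by
            simp [smul_smul, hr0]
          rw [h3]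
          exact Submodule.smul_mem _ _ (sub_mem h1 h2)
      · exact S.mem_rad_of_ne (fun h => hij (Subtype.ext h)) _)
  exact ⟨g, hg, fun j => hg.notMem_radSq j (S.isLocalRing j.1)⟩

end IsARSystem

end ARSystem

/-! ### The socle of Hom(X, -). -/

section Socle

universe w v u

variable (k : Type w) [Field k] {T : Type u} [Category.{v} T] [Preadditive T] [Linear k T]

/-- The morphisms `X ⟶ Z` which are annihilated by the radical. -/
def socle (X Z : T) : Submodule k (X ⟶ Z) where
  carrier := {w | ∀ (W : T) (r : Z ⟶ W), r ∈ rad k Z W → w ≫ r = 0}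
  zero_mem' W r _ := by simp
  add_mem' h₁ h₂ W r hr := by rw [Preadditive.add_comp, h₁ W r hr, h₂ W r hr, add_zero]
  smul_mem' c w h W r hr := by rw [Linear.smul_comp, h W r hr, smul_zero]

variable {k} [HasZeroObject T] [HasShift T ℤ] [∀ n : ℤ, (shiftFunctor T n).Additive]

lemma isLocalRing_end_shift (n : ℤ) {X : T} (hX : IsLocalRing (End X)) :
    IsLocalRing (End (X⟦n⟧)) := by
  have hn : Nontrivial (End (X⟦n⟧)) := by
    refine ⟨1, 0, fun h => id_ne_zero_of_isLocalRing hX ((shiftFunctor T n).map_injective ?_)⟩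
    rw [CategoryTheory.Functor.map_id, Functor.map_zero]
    exact h
  refine { hn with isUnit_or_isUnit_of_add_one := fun {a b} hab => ?_ }
  obtain ⟨a', ha⟩ := (shiftFunctor T n).map_surjective a.asHom
  obtain ⟨b', hb⟩ := (shiftFunctor T n).map_surjective b.asHom
  have h1 : a' + b' = 𝟙 X := by
    apply (shiftFunctor T n).map_injective
    rw [Functor.map_add, ha, hb, CategoryTheory.Functor.map_id]
    exact hab
  rcases isIso_or_isIso_one_sub hX a' with h | h
  · left
    refine (isUnit_iff_isIso a).2 ?_
    change IsIso a.asHom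
    rw [← ha]; infer_instance
  · right
    refine (isUnit_iff_isIso b).2 ?_
    change IsIso b.asHom
    rw [← hb, eq_sub_of_add_eq' h1]; infer_instance

variable [Pretriangulated T]

open Pretriangulated

/-- The connecting morphism of an almost split triangle detects the socle. -/
lemma exists_shift_eq_comp {X Y Z : T} (hZ : IsLocalRing (End Z))
    {δ : Y ⟶ Z⟦(1 : ℤ)⟧} (hδ : IsAlmostSplit δ) {w : X ⟶ Z} (hw : w ∈ socle k X Z) :
    ∃ s : X⟦(1 : ℤ)⟧ ⟶ Y, w⟦(1 : ℤ)⟧' = s ≫ δ := by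
  obtain ⟨E, f, g, hT⟩ := distinguished_cocone_triangle₂ δ
  have hf : f ∈ rad k Z E := mem_rad_of_not_isSplitMono hZ fun h =>
    hδ.1 ((Triangle.mor₃_eq_zero_iff_mono₁ _ hT).2 (inferInstanceAs (Mono f)))
  refine Triangle.coyoneda_exact₁ _ hT (w⟦(1 : ℤ)⟧') ?_
  change w⟦(1 : ℤ)⟧' ≫ f⟦(1 : ℤ)⟧' = 0
  rw [← Functor.map_comp, hw E f hf, Functor.map_zero]

variable (k) in
include k in
lemma isIso_of_comp_ne_zero {X Y Z : T} (hX : IsLocalRing (End X)) (hY : IsLocalRing (End Y))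
    {δ : Y ⟶ Z⟦(1 : ℤ)⟧} (hδ : IsAlmostSplit δ) {s : X⟦(1 : ℤ)⟧ ⟶ Y} (hs : s ≫ δ ≠ 0) :
    IsIso s := by
  have h : IsSplitEpi s := by
    by_contra h; exact hs (hδ.2.2 _ _ h)
  exact nonempty_iso_of_notMem_rad (k := k) (isLocalRing_end_shift 1 hX) hY
    fun hr => not_isSplitEpi_of_mem_rad hY hr h

end Socle

namespace IsARSystem

universe w v u

variable {k : Type w} [Field k] {T : Type u} [Category.{v} T] [Preadditive T] [Linear k T]
  [HasZeroObject T] [HasShift T ℤ] [∀ n : ℤ, (shiftFunctor T n).Additive]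
  [Pretriangulated T] {ι : Type} {M : ι → T} {Arr : ι → ι → Prop} {tau : ι → ι}
  (S : IsARSystem k M Arr tau)
include S

/-- The shift of a nonzero socle element is `s ≫ δ` with `s : M x[1] ⟶ M c` invertible, which forces
`c = x'`. With the next two lemmas this plays the part of Serre duality: the socle is a single line
at `τ x'`. -/
lemma eq_of_mem_socle {x x' c : ι} (hx' : Nonempty ((M x)⟦(1 : ℤ)⟧ ≅ M x'))
    {w : M x ⟶ M (tau c)} (hw : w ∈ socle k (M x) (M (tau c))) (h0 : w ≠ 0) : c = x' := by
  obtain ⟨δ, hδ⟩ := S.almostSplit c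
  obtain ⟨s, hs⟩ := exists_shift_eq_comp (S.isLocalRing _) hδ hw
  have := isIso_of_comp_ne_zero k (S.isLocalRing _) (S.isLocalRing _) hδ (s := s) (by
    rw [← hs]
    exact fun h => h0 ((shiftFunctor T (1 : ℤ)).map_injective (by rw [h, Functor.map_zero])))
  exact S.eq_of_iso _ _ ⟨(asIso s).symm ≪≫ hx'.some⟩

/-- Two lifts through `δ` differ by an endomorphism of `M c`, which is a scalar up to radical maps,
and `δ` kills the latter. -/
lemma exists_smul_eq_of_mem_socle [IsAlgClosed k] [∀ n : ℤ, (shiftFunctor T n).Linear k]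
    {x c : ι} {w w' : M x ⟶ M (tau c)} (hw : w ∈ socle k (M x) (M (tau c))) (h0 : w ≠ 0)
    (hw' : w' ∈ socle k (M x) (M (tau c))) : ∃ r : k, w' = r • w := by
  obtain ⟨δ, hδ⟩ := S.almostSplit c
  obtain ⟨s, hs⟩ := exists_shift_eq_comp (S.isLocalRing _) hδ hw
  obtain ⟨s', hs'⟩ := exists_shift_eq_comp (S.isLocalRing _) hδ hw'
  have := isIso_of_comp_ne_zero k (S.isLocalRing _) (S.isLocalRing _) hδ (s := s) (by
    rw [← hs]
    exact fun h => h0 ((shiftFunctor T (1 : ℤ)).map_injective (by rw [h, Functor.map_zero])))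
  obtain ⟨r, hr⟩ := exists_sub_smul_id_mem_rad S.hfin (S.isLocalRing c) (inv s ≫ s')
  refine ⟨r, (shiftFunctor T (1 : ℤ)).map_injective ?_⟩
  have h1 : (inv s ≫ s' - r • 𝟙 _) ≫ δ = 0 :=
    hδ.2.2 _ _ (not_isSplitEpi_of_mem_rad (S.isLocalRing c) hr)
  have h2 : s' = s ≫ (inv s ≫ s' - r • 𝟙 _) + r • s := by
    simp [Preadditive.comp_sub]
  rw [Functor.map_smul, hs, hs', h2, Preadditive.add_comp, Category.assoc, h1]
  simp

lemma exists_mem_socle {x x' : ι} (hx' : Nonempty ((M x)⟦(1 : ℤ)⟧ ≅ M x')) :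
    ∃ w ∈ socle k (M x) (M (tau x')), w ≠ 0 := by
  obtain ⟨δ, hδ⟩ := S.almostSplit x'
  obtain ⟨φ⟩ := hx'
  obtain ⟨w, hw⟩ := (shiftFunctor T (1 : ℤ)).map_surjective (φ.hom ≫ δ)
  refine ⟨w, fun W r hr => (shiftFunctor T (1 : ℤ)).map_injective ?_, fun h => hδ.1 ?_⟩
  · rw [Functor.map_comp, hw, Category.assoc,
      hδ.2.1 _ _ (not_isSplitMono_of_mem_rad (S.isLocalRing _) hr), comp_zero, Functor.map_zero]
  · rw [h, Functor.map_zero] at hw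
    rw [← Iso.inv_hom_id_assoc φ δ, ← hw, comp_zero]

end IsARSystem

/-! ### Lifting powers of the radical along meshes. -/

section Lifts

universe w v u

variable {k : Type w} [Field k] {T : Type u} [Category.{v} T] [Preadditive T] [Linear k T]

lemma comp_radSq {X Y Z : T} (f : X ⟶ Y) {g : Y ⟶ Z} (hg : g ∈ radSq k Y Z) :
    f ≫ g ∈ radSq k X Z := by
  have : radSq k Y Z ≤ (radSq k X Z).comap (Linear.leftComp k Z f) := by
    refine Submodule.span_le.2 ?_
    rintro _ ⟨W, a, b, ha, hb, rfl⟩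
    have := comp_mem_radSq (comp_rad f ha) hb
    simpa using this
  exact this hg

lemma IsMesh.radPow_lift {J : Type} [Fintype J] {N : J → T} {X Y : T} {a : ∀ j, X ⟶ N j}
    {g : ∀ j, N j ⟶ Y} (hm : IsMesh k a g) {W : T} {m : ℕ} {h : W ⟶ Y}
    (hh : h ∈ radPow k W (m + 1) Y) :
    ∃ r : ∀ j, W ⟶ N j, (∀ j, r j ∈ radPow k W m (N j)) ∧ h = ∑ j, r j ≫ g j := by
  change h ∈ Submodule.span k _ at hh
  induction hh using Submodule.span_induction with
  | mem x hx =>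
    obtain ⟨Z, r₁, r₂, h₁, h₂, rfl⟩ := hx
    obtain ⟨t, rfl⟩ := hm.right_lift Z r₂ h₂
    exact ⟨fun j => r₁ ≫ t j, fun j => radPow_comp h₁ _, by simp [Preadditive.comp_sum]⟩
  | zero => exact ⟨fun j => 0, fun j => zero_mem _, by simp⟩
  | add x y _ _ hx hy =>
    obtain ⟨r, hr, rfl⟩ := hx
    obtain ⟨s, hs, rfl⟩ := hy
    exact ⟨fun j => r j + s j, fun j => add_mem (hr j) (hs j), by
      simp [Preadditive.add_comp, Finset.sum_add_distrib]⟩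
  | smul c x _ hx =>
    obtain ⟨r, hr, rfl⟩ := hx
    exact ⟨fun j => c • r j, fun j => Submodule.smul_mem _ _ (hr j), by
      simp [Finset.smul_sum, Linear.smul_comp]⟩

end Lifts

/-! ### Layers: a grading of Hom(X, -) splitting the radical filtration. -/

section Layers

universe w v u

variable (k : Type w) [Field k] {T : Type u} [Category.{v} T] [Preadditive T] [Linear k T]
  [HasZeroObject T] [HasShift T ℤ] [∀ n : ℤ, (shiftFunctor T n).Additive]
  [Pretriangulated T] {ι : Type} (M : ι → T) (Arr : ι → ι → Prop) (tau : ι → ι)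
  [Fintype ι] [DecidableRel Arr]

/-- A choice of irreducible morphisms `F n b b'` for the arrows of the Auslander–Reiten quiver at
all levels `n`, such that consecutive levels form meshes. -/
structure IsMeshSystem (F : ℕ → ∀ b b' : ι, M b ⟶ M b') : Prop where
  mem_rad : ∀ n b b', Arr b b' → F n b b' ∈ rad k (M b) (M b')
  notMem_radSq : ∀ n b b', Arr b b' → F n b b' ∉ radSq k (M b) (M b')
  mesh : ∀ n c, IsMesh k (fun j : {b // Arr b c} => F n (tau c) j.1) (fun j => F (n + 1) j.1 c)

/-- The span of the composites of `m` chosen irreducible morphisms which start in `M x`. -/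
noncomputable def layer (F : ℕ → ∀ b b' : ι, M b ⟶ M b') (x : ι) :
    ℕ → ∀ c : ι, Submodule k (M x ⟶ M c)
  -- A line if `c = x`, and zero otherwise. In the next clause the last arrow is taken from level
  -- `m`, so that successive arrows of a composite fit into the meshes of `F`.
  | 0, c => Classical.choose (exists_isCompl (rad k (M x) (M c)))
  | m + 1, c => LinearMap.range (∑ j : {b // Arr b c},
      Linear.rightComp k (M x) (F m j.1 c) ∘ₗ (layer F x m j.1).subtype ∘ₗ
        LinearMap.proj (R := k) (φ := fun j : {b // Arr b c} => layer F x m j.1) j)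

variable {k M Arr tau}

namespace IsARSystem

variable (S : IsARSystem k M Arr tau)
include S

/-- Level `n` provides the maps out of each `τ c`; completing them to meshes provides irreducible
maps into each `c`, which are level `n + 1`. The dependence on the level removes the need for one
choice that is consistent around the cycles of the quotient quiver. -/
lemma exists_isMeshSystem [IsAlgClosed k] :
    ∃ F : ℕ → ∀ b b' : ι, M b ⟶ M b', IsMeshSystem k M Arr tau F := by
  let P := {f : ∀ b b' : ι, M b ⟶ M b' // ∀ b b', Arr b b' →
    f b b' ∈ rad k (M b) (M b') ∧ f b b' ∉ radSq k (M b) (M b')}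
  have h0 : Nonempty P := by
    have : ∀ b b', ∃ f : M b ⟶ M b', Arr b b' →
        f ∈ rad k (M b) (M b') ∧ f ∉ radSq k (M b) (M b') := by
      intro b b'
      by_cases h : Arr b b'
      · obtain ⟨f, h1, h2⟩ := exists_mem_rad_notMem_radSq (S.irr_one b b' h)
        exact ⟨f, fun _ => ⟨h1, h2⟩⟩
      · exact ⟨0, fun h' => (h h').elim⟩
    choose f hf using this
    exact ⟨⟨f, hf⟩⟩
  have hstep : ∀ f : P, ∃ f' : P, ∀ c,
      IsMesh k (fun j : {b // Arr b c} => f.1 (tau c) j.1) (fun j => f'.1 j.1 c) := by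
    intro f
    have : ∀ c, ∃ g : ∀ b, M b ⟶ M c,
        IsMesh k (fun j : {b // Arr b c} => f.1 (tau c) j.1) (fun j => g j.1) ∧
        ∀ b, Arr b c → g b ∉ radSq k (M b) (M c) := by
      intro c
      obtain ⟨g, hg, hg'⟩ := S.exists_mesh c (fun j : {b // Arr b c} => f.1 (tau c) j.1)
        (fun j => (f.2 _ _ ((S.arr_tau _ _).2 j.2)).1)
        (fun j => (f.2 _ _ ((S.arr_tau _ _).2 j.2)).2)
      have e : (fun j : {b // Arr b c} => if h : Arr j.1 c then g ⟨j.1, h⟩ else 0) = g := by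
        funext j
        simp [j.2]
      refine ⟨fun b => if h : Arr b c then g ⟨b, h⟩ else 0, ?_, fun b hb => ?_⟩
      · rw [e]; exact hg
      · simpa [hb] using hg' ⟨b, hb⟩
    choose g hg hg' using this
    refine ⟨⟨fun b c => g c b, fun b c h => ⟨?_, hg' c b h⟩⟩, fun c => hg c⟩
    exact (hg c).right_rad ⟨b, h⟩
  choose step hs using hstep
  let F : ℕ → P := fun n => Nat.rec h0.some (fun _ f => step f) n
  exact ⟨fun n => (F n).1, fun n b b' h => ((F n).2 b b' h).1,
    fun n b b' h => ((F n).2 b b' h).2, fun n c => hs (F n) c⟩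

end IsARSystem

variable {F : ℕ → ∀ b b' : ι, M b ⟶ M b'} {x : ι}

lemma isCompl_layer_zero (c : ι) : IsCompl (rad k (M x) (M c)) (layer k M Arr F x 0 c) :=
  Classical.choose_spec (exists_isCompl (rad k (M x) (M c)))

lemma mem_layer_succ {m : ℕ} {c : ι} {u : M x ⟶ M c} :
    u ∈ layer k M Arr F x (m + 1) c ↔ ∃ v : ∀ j : {b // Arr b c}, M x ⟶ M j.1,
      (∀ j, v j ∈ layer k M Arr F x m j.1) ∧ u = ∑ j, v j ≫ F m j.1 c := by
  rw [layer, LinearMap.mem_range]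
  constructor
  · rintro ⟨v, rfl⟩
    exact ⟨fun j => v j, fun j => (v j).2, by simp⟩
  · rintro ⟨v, hv, rfl⟩
    exact ⟨fun j => ⟨v j, hv j⟩, by simp⟩

lemma comp_mem_layer_succ {m : ℕ} {b c : ι} {u : M x ⟶ M b} (hu : u ∈ layer k M Arr F x m b)
    (h : Arr b c) : u ≫ F m b c ∈ layer k M Arr F x (m + 1) c := by
  classical
  rw [layer, LinearMap.mem_range]
  refine ⟨Pi.single ⟨b, h⟩ ⟨u, hu⟩, ?_⟩
  rw [LinearMap.sum_apply, Finset.sum_eq_single ⟨b, h⟩]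
  · simp
  · intro j _ hj
    simp [Pi.single_eq_of_ne hj]
  · simp

namespace IsMeshSystem

variable (S : IsARSystem k M Arr tau) (hF : IsMeshSystem k M Arr tau F)

include hF

lemma layer_le_radPow (m : ℕ) (c : ι) : layer k M Arr F x m c ≤ radPow k (M x) m (M c) := by
  induction m generalizing c with
  | zero => exact le_top
  | succ m ih =>
    intro u hu
    obtain ⟨v, hv, rfl⟩ := mem_layer_succ.1 hu
    exact sum_mem fun j _ => radPow_comp_rad (ih _ (hv j)) (hF.mem_rad m _ _ j.2)

include S

/-- In a composite, replace the first factor by its leading term and the last by a multiple of the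
chosen irreducible map; both errors lie one power deeper. -/
lemma radPow_eq_sup (m : ℕ) (c : ι) : radPow k (M x) m (M c) =
    layer k M Arr F x m c ⊔ radPow k (M x) (m + 1) (M c) := by
  refine le_antisymm ?_ (sup_le (hF.layer_le_radPow m c) (radPow_succ_le m _))
  induction m generalizing c with
  | zero =>
    rw [radPow_one, sup_comm, (isCompl_layer_zero c).sup_eq_top]
    exact le_top
  | succ m ih =>
    refine Submodule.span_le.2 ?_
    rintro _ ⟨Z, f, g, hf, hg, rfl⟩
    obtain ⟨n, d, p, s, hps⟩ := S.decomp Z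
    have e : f ≫ g = ∑ i, (f ≫ p i) ≫ (s i ≫ g) := by
      have : ∀ i, (f ≫ p i) ≫ (s i ≫ g) = f ≫ (p i ≫ s i) ≫ g := fun i => by simp
      simp_rw [this, ← Preadditive.comp_sum, ← Preadditive.sum_comp, hps, Category.id_comp]
    rw [e]
    refine sum_mem fun i _ => ?_
    have hg' : s i ≫ g ∈ rad k _ _ := comp_rad (s i) hg
    obtain ⟨h, hh, f', hf', e'⟩ := Submodule.mem_sup.1 (ih (d i) (radPow_comp hf (p i)))
    rw [← e', Preadditive.add_comp]
    refine add_mem ?_ (Submodule.mem_sup_right (radPow_comp_rad hf' hg'))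
    have hh' := hF.layer_le_radPow m _ hh
    by_cases hb : Arr (d i) c
    · obtain ⟨r, hr⟩ := exists_sub_smul_mem_radSq S.hfin (S.irr_one _ _ hb)
        (hF.mem_rad m _ _ hb) (hF.notMem_radSq m _ _ hb) hg'
      rw [← add_sub_cancel (r • F m (d i) c) (s i ≫ g), Preadditive.comp_add, Linear.comp_smul]
      exact Submodule.add_mem_sup (Submodule.smul_mem _ _ (comp_mem_layer_succ hh hb))
        (radPow_comp_radSq hh' hr)
    · exact Submodule.mem_sup_right (radPow_comp_radSq hh'
        (rad_le_radSq S.hfin (S.irr_zero _ _ hb) hg'))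

/-- Leading terms of elements which are almost annihilated by a left almost split family lie in
the socle. -/
lemma mem_socle_of_leading {i n : ℕ} {c : ι}
    (hI : ∀ b, Disjoint (layer k M Arr F x (i + 1) b) (radPow k (M x) (i + 2) (M b)))
    {h w : M x ⟶ M (tau c)} (hh : h ∈ layer k M Arr F x i (tau c))
    (hw : w - h ∈ radPow k (M x) (i + 1) (M (tau c)))
    (hwF : ∀ b, Arr b c → w ≫ F n (tau c) b ∈ radPow k (M x) (i + 2) (M b)) :
    h ∈ socle k (M x) (M (tau c)) := by
  have key : ∀ b, Arr b c → h ≫ F i (tau c) b = 0 := by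
    intro b hb
    have hb' := (S.arr_tau b c).2 hb
    refine (Submodule.disjoint_def.1 (hI b)) _ (comp_mem_layer_succ hh hb') ?_
    -- `F i` and `F n` agree up to a scalar modulo rad², so `h ≫ F i` lies both in layer `i + 1` and
    -- in rad^(i+2), hence is zero.
    obtain ⟨r, hr⟩ := exists_sub_smul_mem_radSq S.hfin (S.irr_one _ _ hb')
      (hF.mem_rad n _ _ hb') (hF.notMem_radSq n _ _ hb') (hF.mem_rad i _ _ hb')
    have e : h ≫ F i (tau c) b = r • (w ≫ F n (tau c) b - (w - h) ≫ F n (tau c) b) +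
        h ≫ (F i (tau c) b - r • F n (tau c) b) := by
      simp [Preadditive.comp_sub, Preadditive.sub_comp]
    rw [e]
    exact add_mem (Submodule.smul_mem _ _ (sub_mem (hwF b hb)
      (radPow_comp_rad hw (hF.mem_rad n _ _ hb'))))
      (radPow_comp_radSq (hF.layer_le_radPow i _ hh) hr)
  intro W r hr
  obtain ⟨t, rfl⟩ := (hF.mesh i c).left_lift W r hr
  rw [Preadditive.comp_sum]
  refine Finset.sum_eq_zero fun j _ => ?_
  rw [← Category.assoc, key j.1 j.2, zero_comp]

/-- As long as `w` has a leading term of degree below `m`, that term must lie in the socle; it is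
subtracted, and the degree goes up by one. -/
lemma exists_radPow_of_comp {m : ℕ} {c : ι}
    (hI : ∀ i ≤ m, ∀ b, Disjoint (layer k M Arr F x i b) (radPow k (M x) (i + 1) (M b)))
    (w : M x ⟶ M (tau c))
    (hw : ∀ b, Arr b c → w ≫ F m (tau c) b ∈ radPow k (M x) (m + 1) (M b)) :
    ∃ w' ∈ radPow k (M x) m (M (tau c)), w - w' ∈ socle k (M x) (M (tau c)) := by
  have : ∀ i ≤ m, ∃ w' ∈ radPow k (M x) i (M (tau c)), w - w' ∈ socle k (M x) (M (tau c)) := by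
    intro i
    induction i with
    | zero => exact fun _ => ⟨w, trivial, by simp⟩
    | succ i ih =>
      intro hi
      obtain ⟨w', hw', hs⟩ := ih (by omega)
      rw [hF.radPow_eq_sup S] at hw'
      obtain ⟨h, hh, w'', hw'', rfl⟩ := Submodule.mem_sup.1 hw'
      refine ⟨w'', hw'', ?_⟩
      have : h ∈ socle k (M x) (M (tau c)) := by
        refine hF.mem_socle_of_leading S (n := m) (w := h + w'') (hI (i + 1) hi) hh
          (by simpa using hw'') fun b hb => ?_
        have h1 := hs _ _ (hF.mem_rad m _ _ ((S.arr_tau b c).2 hb))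
        rw [Preadditive.sub_comp, sub_eq_zero] at h1
        rw [← h1]
        exact radPow_antitone _ (by omega) (hw b hb)
      have e : w - w'' = (w - (h + w'')) + h := by abel
      rw [e]
      exact add_mem hs this
  exact this m le_rfl

/-- Exactness of the layers at the middle of a mesh. -/
lemma layer_exact {m : ℕ} {c : ι}
    (hI : ∀ i ≤ m + 1, ∀ b, Disjoint (layer k M Arr F x i b) (radPow k (M x) (i + 1) (M b)))
    (v : ∀ j : {b // Arr b c}, M x ⟶ M j.1)
    (hv : ∀ j, v j ∈ layer k M Arr F x (m + 1) j.1)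
    (hu : ∑ j, v j ≫ F (m + 1) j.1 c ∈ radPow k (M x) (m + 3) (M c)) :
    ∃ h ∈ layer k M Arr F x m (tau c), ∀ j, v j = h ≫ F m (tau c) j.1 := by
  -- The lift `v'` lies in rad^(m+2), one power deeper than `v`. Then `v - v'` is an exact relation,
  -- and the leading term of the resulting `w` is the required `h`.
  obtain ⟨v', hv', e⟩ := (hF.mesh m c).radPow_lift hu
  obtain ⟨w, hw⟩ := (hF.mesh m c).exact (M x) (fun j => v j - v' j) (by
    simp only [Preadditive.sub_comp, Finset.sum_sub_distrib]
    rw [← e, sub_self])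
  have hwr : ∀ b, Arr b c → w ≫ F m (tau c) b ∈ radPow k (M x) (m + 1) (M b) := by
    intro b hb
    have := hw ⟨b, hb⟩
    simp only at this
    rw [← this]
    exact sub_mem (hF.layer_le_radPow _ _ (hv ⟨b, hb⟩)) (radPow_succ_le _ _ (hv' ⟨b, hb⟩))
  obtain ⟨w', hw', hs⟩ := hF.exists_radPow_of_comp S (fun i hi => hI i (by omega)) w hwr
  rw [hF.radPow_eq_sup S] at hw'
  obtain ⟨h, hh, w'', hw'', rfl⟩ := Submodule.mem_sup.1 hw'
  refine ⟨h, hh, fun j => ?_⟩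
  have hj := (S.arr_tau j.1 c).2 j.2
  have hmem := hF.mem_rad m _ _ hj
  rw [← sub_eq_zero]
  refine (Submodule.disjoint_def.1 (hI (m + 1) le_rfl j.1)) _
    (sub_mem (hv j) (comp_mem_layer_succ hh hj)) ?_
  have h1 := hs _ _ hmem
  have e1 : v j - h ≫ F m (tau c) j.1 = v' j + w'' ≫ F m (tau c) j.1 := by
    have h2 := hw j
    simp only [Preadditive.sub_comp, Preadditive.add_comp] at h1 h2
    rw [sub_eq_iff_eq_add.1 h2, sub_eq_zero.1 h1]
    abel
  rw [e1]
  exact add_mem (hv' j) (radPow_comp_rad hw'' hmem)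

/-- A nonzero map of layer zero is invertible, so at most one `v j` is nonzero; composing with its
inverse would put an irreducible map in rad². -/
lemma layer_one_injective {c : ι} (v : ∀ j : {b // Arr b c}, M x ⟶ M j.1)
    (hv : ∀ j, v j ∈ layer k M Arr F x 0 j.1)
    (hu : ∑ j, v j ≫ F 0 j.1 c ∈ radPow k (M x) 2 (M c)) : ∀ j, v j = 0 := by
  have hiso : ∀ j, v j ≠ 0 → IsIso (v j) := by
    intro j hj
    refine nonempty_iso_of_notMem_rad (k := k) (S.isLocalRing _) (S.isLocalRing _) fun h => hj ?_
    exact (Submodule.disjoint_def.1 (isCompl_layer_zero j.1).disjoint) _ h (hv j)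
  intro j
  by_contra hj
  have hj' := hiso j hj
  have hx := S.eq_of_iso _ _ ⟨asIso (v j)⟩
  rw [Finset.sum_eq_single j, radPow_two] at hu
  · refine hF.notMem_radSq 0 _ _ j.2 ?_
    have := comp_radSq (inv (v j)) hu
    simpa using this
  · intro i _ hij
    by_cases hi : v i = 0
    · rw [hi, zero_comp]
    · have hi' := hiso i hi
      exact (hij (Subtype.ext ((S.eq_of_iso _ _ ⟨asIso (v i)⟩).symm.trans hx))).elim
  · simp

/-- An element of layer `m + 2` that lies deeper in the filtration comes, by exactness, from layer
`m` at `τ c`, and the mesh relation kills it. -/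
lemma disjoint_layer (m : ℕ) (c : ι) :
    Disjoint (layer k M Arr F x m c) (radPow k (M x) (m + 1) (M c)) := by
  induction m using Nat.strong_induction_on generalizing c with
  | _ m ih =>
    match m with
    | 0 =>
      rw [radPow_one]
      exact (isCompl_layer_zero c).disjoint.symm
    | 1 =>
      refine Submodule.disjoint_def.2 fun u hu hr => ?_
      obtain ⟨v, hv, rfl⟩ := mem_layer_succ.1 hu
      have := hF.layer_one_injective S v hv hr
      simp [this]
    | m + 2 =>
      refine Submodule.disjoint_def.2 fun u hu hr => ?_
      obtain ⟨v, hv, rfl⟩ := mem_layer_succ.1 hu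
      obtain ⟨h, -, e⟩ := hF.layer_exact S (fun i hi b => ih i (by omega) b) v hv hr
      simp_rw [e, Category.assoc]
      rw [← Preadditive.comp_sum, (hF.mesh m c).sum_comp, comp_zero]

end IsMeshSystem

end Layers

/-! ### Graded dimensions of morphism spaces. -/

section Dimensions

universe w v u

variable {k : Type w} [Field k] {T : Type u} [Category.{v} T] [Preadditive T] [Linear k T]
  [HasZeroObject T] [HasShift T ℤ] [∀ n : ℤ, (shiftFunctor T n).Additive]
  [Pretriangulated T] {ι : Type} {M : ι → T} {Arr : ι → ι → Prop} {tau : ι → ι}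
  [Fintype ι] [DecidableRel Arr] {F : ℕ → ∀ b b' : ι, M b ⟶ M b'} {x : ι}

namespace IsMeshSystem

variable (S : IsARSystem k M Arr tau) (hF : IsMeshSystem k M Arr tau F)
include S

lemma finrank_layer_zero [IsAlgClosed k] [DecidableEq ι] (c : ι) :
    Module.finrank k (layer k M Arr F x 0 c) = if c = x then 1 else 0 := by
  have hc := isCompl_layer_zero (k := k) (M := M) (Arr := Arr) (F := F) (x := x) c
  split_ifs with h
  · subst h
    obtain ⟨ρ, hρ, h, hh, e⟩ := Submodule.mem_sup.1
      (show 𝟙 (M c) ∈ rad k (M c) (M c) ⊔ layer k M Arr F c 0 c by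
        rw [hc.sup_eq_top]; trivial)
    refine finrank_eq_one ⟨h, hh⟩ ?_ ?_
    · intro h0
      have h0' : h = 0 := congrArg Subtype.val h0
      rw [h0', add_zero] at e
      exact id_notMem_rad (k := k) (S.isLocalRing c) (e ▸ hρ)
    · rintro ⟨v, hv⟩
      obtain ⟨r, hr⟩ := exists_sub_smul_id_mem_rad S.hfin (S.isLocalRing c) v
      refine ⟨r, Subtype.ext ?_⟩
      change r • h = v
      rw [eq_comm, ← sub_eq_zero]
      refine (Submodule.disjoint_def.1 hc.disjoint) _ ?_
        (sub_mem hv (Submodule.smul_mem _ _ hh))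
      have e1 : v - r • h = (v - r • 𝟙 (M c)) + r • ρ := by
        rw [← e, smul_add]; abel
      rw [e1]
      exact add_mem hr (Submodule.smul_mem _ _ hρ)
  · have : layer k M Arr F x 0 c = ⊥ := by
      rw [Submodule.eq_bot_iff]
      intro v hv
      exact (Submodule.disjoint_def.1 hc.disjoint) _ (S.mem_rad_of_ne (Ne.symm h) v) hv
    rw [this, finrank_bot]

include hF

lemma finrank_layer_one (c : ι) : Module.finrank k (layer k M Arr F x 1 c) =
    ∑ j : {b // Arr b c}, Module.finrank k (layer k M Arr F x 0 j.1) := by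
  have := S.hfin
  have : ∀ j : {b // Arr b c}, Module.Finite k (layer k M Arr F x 0 j.1) := fun j => by
    have := S.hfin (M x) (M j.1)
    infer_instance
  rw [layer, LinearMap.finrank_range_of_inj, Module.finrank_pi_fintype]
  rw [← LinearMap.ker_eq_bot, LinearMap.ker_eq_bot']
  intro v hv
  have hv' : ∑ j, (v j).1 ≫ F 0 j.1 c = 0 := by simpa using hv
  funext j
  exact Subtype.ext (hF.layer_one_injective S (fun j => (v j).1) (fun j => (v j).2)
    (by rw [hv']; exact zero_mem _) j)

/-- Rank–nullity for L_m(τc) → ⊕ L_{m+1}(b) → L_{m+2}(c) → 0, given by `Ψ` and `Φ`. The kernel of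
`Ψ` is the socle part, since the maps of the mesh generate all radical maps out of `τ c`. -/
lemma finrank_layer_add_two (m : ℕ) (c : ι) :
    Module.finrank k (layer k M Arr F x (m + 2) c) +
      Module.finrank k (layer k M Arr F x m (tau c)) =
    ∑ j : {b // Arr b c}, Module.finrank k (layer k M Arr F x (m + 1) j.1) +
      Module.finrank k (layer k M Arr F x m (tau c) ⊓ socle k (M x) (M (tau c)) :
        Submodule k (M x ⟶ M (tau c))) := by
  have hfd : ∀ n b, Module.Finite k (layer k M Arr F x n b) := fun n b => by
    have := S.hfin (M x) (M b)
    infer_instance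
  let Φ : (∀ j : {b // Arr b c}, layer k M Arr F x (m + 1) j.1) →ₗ[k] (M x ⟶ M c) :=
    ∑ j : {b // Arr b c}, Linear.rightComp k (M x) (F (m + 1) j.1 c) ∘ₗ
      (layer k M Arr F x (m + 1) j.1).subtype ∘ₗ
        LinearMap.proj (R := k) (φ := fun j : {b // Arr b c} => layer k M Arr F x (m + 1) j.1) j
  have hΦ : ∀ v, Φ v = ∑ j, (v j).1 ≫ F (m + 1) j.1 c := fun v => by simp [Φ]
  let Ψ : layer k M Arr F x m (tau c) →ₗ[k] (∀ j : {b // Arr b c}, layer k M Arr F x (m + 1) j.1) :=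
    LinearMap.pi fun j => LinearMap.restrict (Linear.rightComp k (M x) (F m (tau c) j.1))
      fun u hu => comp_mem_layer_succ hu ((S.arr_tau _ _).2 j.2)
  have hΨ : ∀ w j, (Ψ w j).1 = w.1 ≫ F m (tau c) j.1 := fun w j => rfl
  have h1 : Module.finrank k (LinearMap.range Φ) + Module.finrank k (LinearMap.ker Φ) = _ :=
    Φ.finrank_range_add_finrank_ker
  have h2 : Module.finrank k (LinearMap.range Ψ) + Module.finrank k (LinearMap.ker Ψ) = _ :=
    Ψ.finrank_range_add_finrank_ker
  have h3 : LinearMap.ker Φ = LinearMap.range Ψ := by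
    ext v
    rw [LinearMap.mem_ker, LinearMap.mem_range, hΦ]
    constructor
    · intro hv
      obtain ⟨h, hh, e⟩ := hF.layer_exact S (fun i _ b => hF.disjoint_layer S i b)
        (fun j => (v j).1) (fun j => (v j).2) (by rw [hv]; exact zero_mem _)
      exact ⟨⟨h, hh⟩, funext fun j => Subtype.ext (e j).symm⟩
    · rintro ⟨w, rfl⟩
      simp_rw [hΨ, Category.assoc]
      rw [← Preadditive.comp_sum, (hF.mesh m c).sum_comp, comp_zero]
  have h4 : (LinearMap.ker Ψ).map (layer k M Arr F x m (tau c)).subtype =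
      layer k M Arr F x m (tau c) ⊓ socle k (M x) (M (tau c)) := by
    ext w
    simp only [Submodule.mem_map, Submodule.mem_inf, LinearMap.mem_ker]
    constructor
    · rintro ⟨w, hw, rfl⟩
      refine ⟨w.2, fun W r hr => ?_⟩
      obtain ⟨t, rfl⟩ := (hF.mesh m c).left_lift W r hr
      rw [Preadditive.comp_sum]
      refine Finset.sum_eq_zero fun j _ => ?_
      have := congrArg Subtype.val (congrFun hw j)
      rw [hΨ] at this
      change w.1 ≫ _ ≫ _ = _
      rw [← Category.assoc, this]
      exact zero_comp
    · rintro ⟨hw, hs⟩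
      exact ⟨⟨w, hw⟩, funext fun j => Subtype.ext (hs _ _ ((hF.mesh m c).left_rad j)), rfl⟩
  have h5 : Module.finrank k (LinearMap.ker Ψ) =
      Module.finrank k (layer k M Arr F x m (tau c) ⊓ socle k (M x) (M (tau c)) :
        Submodule k (M x ⟶ M (tau c))) := by
    rw [← h4]
    exact (LinearEquiv.finrank_eq (Submodule.equivMapOfInjective _
      (Submodule.injective_subtype _) _))
  have h6 : Module.finrank k (layer k M Arr F x (m + 2) c) =
    Module.finrank k (LinearMap.range Φ) := rfl
  rw [h3] at h1
  rw [Module.finrank_pi_fintype] at h1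
  rw [h6, ← h5]
  omega

/-- The number `m₀` is the radical degree of a generator of the socle. Its leading term is again in
the socle, hence spans it; and a line cannot meet two layers, as these are independent. -/
lemma exists_socle_level [IsAlgClosed k] [DecidableEq ι] [∀ n : ℤ, (shiftFunctor T n).Linear k] {x' : ι}
    (hx' : Nonempty ((M x)⟦(1 : ℤ)⟧ ≅ M x')) :
    ∃ m₀ : ℕ, ∀ m c, Module.finrank k (layer k M Arr F x m (tau c) ⊓
      socle k (M x) (M (tau c)) : Submodule k (M x ⟶ M (tau c))) =
        if m = m₀ ∧ c = x' then 1 else 0 := by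
  classical
  obtain ⟨N, hN⟩ := exists_radPow_eq_bot S.hfin M S.decomp (M x)
  obtain ⟨w, hw, hw0⟩ := S.exists_mem_socle hx'
  have hex : ∃ i, w ∉ radPow k (M x) i (M (tau x')) := ⟨N, by rw [hN]; simpa using hw0⟩
  obtain ⟨m₀, hm₀, hm₀'⟩ : ∃ i, w ∈ radPow k (M x) i (M (tau x')) ∧
      w ∉ radPow k (M x) (i + 1) (M (tau x')) := by
    have h1 := Nat.find_spec hex
    have h2 : Nat.find hex ≠ 0 := fun h => by
      rw [h] at h1; exact h1 trivial
    obtain ⟨i, hi⟩ := Nat.exists_eq_succ_of_ne_zero h2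
    refine ⟨i, ?_, by rw [hi] at h1; exact h1⟩
    by_contra h
    have := Nat.find_min' hex h
    omega
  rw [hF.radPow_eq_sup S] at hm₀
  obtain ⟨h, hh, w'', hw'', e⟩ := Submodule.mem_sup.1 hm₀
  have hs : h ∈ socle k (M x) (M (tau x')) := by
    refine hF.mem_socle_of_leading S (n := 0) (w := w) (fun b => hF.disjoint_layer S _ b) hh
      (by rw [← e]; simpa using hw'') fun b hb => ?_
    rw [hw _ _ (hF.mem_rad 0 _ _ ((S.arr_tau b x').2 hb))]
    exact zero_mem _
  have hne : h ≠ 0 := by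
    rintro rfl
    rw [zero_add] at e
    exact hm₀' (e ▸ hw'')
  refine ⟨m₀, fun m c => ?_⟩
  split_ifs with hc
  · obtain ⟨rfl, rfl⟩ := hc
    refine finrank_eq_one ⟨h, hh, hs⟩ (fun h0 => hne (congrArg Subtype.val h0)) ?_
    rintro ⟨v, -, hv⟩
    obtain ⟨r, hr⟩ := S.exists_smul_eq_of_mem_socle hs hne hv
    exact ⟨r, Subtype.ext hr.symm⟩
  · have : layer k M Arr F x m (tau c) ⊓ socle k (M x) (M (tau c)) = ⊥ := by
      rw [Submodule.eq_bot_iff]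
      rintro v ⟨hv, hvs⟩
      by_contra hv0
      obtain rfl := S.eq_of_mem_socle hx' hvs hv0
      have hm : m ≠ m₀ := fun h => hc ⟨h, rfl⟩
      rcases lt_or_gt_of_ne hm with hlt | hlt
      · obtain ⟨r, hr⟩ := S.exists_smul_eq_of_mem_socle hs hne hvs
        refine hv0 ((Submodule.disjoint_def.1 (hF.disjoint_layer S m _)) v hv ?_)
        rw [hr]
        exact Submodule.smul_mem _ _ (radPow_antitone _ (by omega) (hF.layer_le_radPow m₀ _ hh))
      · obtain ⟨r, hr⟩ := S.exists_smul_eq_of_mem_socle hvs hv0 hs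
        refine hne ((Submodule.disjoint_def.1 (hF.disjoint_layer S m₀ _)) h hh ?_)
        rw [hr]
        exact Submodule.smul_mem _ _ (radPow_antitone _ (by omega) (hF.layer_le_radPow m _ hv))
    rw [this, finrank_bot]

lemma finrank_radPow_zero_eq_sum (N : ℕ) (c : ι) :
    Module.finrank k (M x ⟶ M c) =
      ∑ m ∈ Finset.range N, Module.finrank k (layer k M Arr F x m c) +
        Module.finrank k (radPow k (M x) N (M c)) := by
  have := S.hfin (M x) (M c)
  induction N with
  | zero =>
    have : radPow k (M x) 0 (M c) = ⊤ := rfl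
    rw [this, finrank_top]; simp
  | succ N ih =>
    have h1 := Submodule.finrank_sup_add_finrank_inf_eq (layer k M Arr F x N c)
      (radPow k (M x) (N + 1) (M c))
    rw [(hF.disjoint_layer S N c).eq_bot, finrank_bot, ← hF.radPow_eq_sup S] at h1
    rw [Finset.sum_range_succ, ih]
    omega

end IsMeshSystem

/-- The graded dimensions of the morphism spaces which start in a fixed indecomposable object
satisfy the recursion given by the meshes of the Auslander–Reiten quiver. -/
lemma IsARSystem.exists_graded_dimension [IsAlgClosed k] [∀ n : ℤ, (shiftFunctor T n).Linear k]
    [DecidableEq ι] (S : IsARSystem k M Arr tau) {x x' : ι}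
    (hx' : Nonempty ((M x)⟦(1 : ℤ)⟧ ≅ M x')) :
    ∃ (D : ℕ → ι → ℕ) (m₀ N : ℕ), (∀ c, D 0 c = if c = x then 1 else 0) ∧
      (∀ c, D 1 c = ∑ j : {b // Arr b c}, D 0 j.1) ∧
      (∀ m c, D (m + 2) c + D m (tau c) =
        ∑ j : {b // Arr b c}, D (m + 1) j.1 + if m = m₀ ∧ c = x' then 1 else 0) ∧
      (∀ m, N ≤ m → ∀ c, D m c = 0) ∧
      ∀ c, Module.finrank k (M x ⟶ M c) = ∑ m ∈ Finset.range N, D m c := by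
  obtain ⟨F, hF⟩ := S.exists_isMeshSystem
  obtain ⟨N, hN⟩ := exists_radPow_eq_bot S.hfin M S.decomp (M x)
  obtain ⟨m₀, hm₀⟩ := hF.exists_socle_level S hx'
  refine ⟨fun m c => Module.finrank k (layer k M Arr F x m c), m₀, N,
    IsMeshSystem.finrank_layer_zero S, hF.finrank_layer_one S, fun m c => ?_, fun m hm c => ?_,
    fun c => ?_⟩
  · rw [← hm₀]
    exact hF.finrank_layer_add_two S m c
  · have : layer k M Arr F x m c = ⊥ := le_bot_iff.1
      ((hF.layer_le_radPow m c).trans ((radPow_antitone _ hm).trans (hN _).le))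
    change Module.finrank k (layer k M Arr F x m c) = 0
    rw [this, finrank_bot]
  · rw [hF.finrank_radPow_zero_eq_sum S N c, hN, finrank_bot, add_zero]

end Dimensions

namespace Dynkin

/-! ## Levels and distances -/

/-- A function on labels which increases by one along arrows. -/
def height : Dynkin → ℕ → ℤ
  | A _ _, q => q
  | D n _, q => if q ≤ n - 2 then q else (n : ℤ) - 3
  | E6, q | E7, q | E8, q => if q ≤ 3 then 3 - q else if q = 4 then 1 else (q : ℤ) - 4

/-- The distance of two labels in the diagram. -/
def labelDist : Dynkin → ℕ → ℕ → ℕ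
  | A _ _, a, b => (a - b) + (b - a)
  | D n _, a, b => if a ≠ b ∧ n - 1 ≤ a ∧ n - 1 ≤ b then 2 else
      (min a (n - 1) - min b (n - 1)) + (min b (n - 1) - min a (n - 1))
  | E6, a, b | E7, a, b | E8, a, b =>
      let depth := fun q => if q ≤ 3 then 3 - q else if q = 4 then 1 else q - 4
      let branch := fun q => if q ≤ 2 then 0 else if q = 4 then 1 else 2
      if branch a = branch b then (depth a - depth b) + (depth b - depth a)
      else depth a + depth b

instance (Δ : Dynkin) (a b : ℕ) : Decidable (Δ.ArrowLabel a b) := by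
  cases Δ <;> unfold ArrowLabel <;> infer_instance

instance (Δ : Dynkin) : Fintype Δ.Vertex :=
  Fintype.subtype (Finset.Icc 1 Δ.rank) fun _ => Finset.mem_Icc

/-- Two vertices are joined by an edge of the diagram. -/
def Adj (Δ : Dynkin) (a b : Δ.Vertex) : Prop := Δ.Arrow a b ∨ Δ.Arrow b a

instance (Δ : Dynkin) : DecidableRel Δ.Adj := fun a b =>
  inferInstanceAs (Decidable (Δ.ArrowLabel a.1 b.1 ∨ Δ.ArrowLabel b.1 a.1))

lemma Adj.symm {Δ : Dynkin} {a b : Δ.Vertex} (h : Δ.Adj a b) : Δ.Adj b a := Or.symm h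

lemma adj_comm {Δ : Dynkin} {a b : Δ.Vertex} : Δ.Adj a b ↔ Δ.Adj b a := Or.comm

lemma height_of_arrowLabel (Δ : Dynkin) {a b : ℕ} (ha : 1 ≤ a ∧ a ≤ Δ.rank)
    (hb : 1 ≤ b ∧ b ≤ Δ.rank) (h : Δ.ArrowLabel a b) : Δ.height b = Δ.height a + 1 := by
  cases Δ <;> simp only [rank, height, ArrowLabel] at * <;> (try split_ifs) <;> omega

/-- The level of a vertex of `ℤΔ`: it increases by one along arrows. -/
def level (Δ : Dynkin) (x : Δ.ZVertex) : ℤ := 2 * x.1 + Δ.height x.2.1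

lemma height_arrow {Δ : Dynkin} {a b : Δ.Vertex} (h : Δ.Arrow a b) :
    Δ.height b.1 = Δ.height a.1 + 1 :=
  Δ.height_of_arrowLabel a.2 b.2 h

lemma zArrow_iff {Δ : Dynkin} {x y : Δ.ZVertex} :
    Δ.ZArrow x y ↔ Δ.Adj x.2 y.2 ∧ Δ.level y = Δ.level x + 1 := by
  unfold ZArrow level
  constructor
  · rintro (⟨h, ha⟩ | ⟨h, ha⟩)
    · have := height_arrow ha
      exact ⟨Or.inl ha, by omega⟩
    · have := height_arrow ha
      exact ⟨Or.inr ha, by omega⟩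
  · rintro ⟨ha | ha, h⟩
    · have := height_arrow ha
      exact Or.inl ⟨by omega, ha⟩
    · have := height_arrow ha
      exact Or.inr ⟨by omega, ha⟩

lemma eq_of_level {Δ : Dynkin} {x y : Δ.ZVertex} (h : x.2 = y.2) (hl : Δ.level x = Δ.level y) :
    x = y := by
  unfold level at hl
  rw [h] at hl
  exact Prod.ext (by omega) h

lemma level_tau (Δ : Dynkin) (x : Δ.ZVertex) : Δ.level (Δ.tau x) = Δ.level x - 2 := by
  simp only [level, tau, Equiv.coe_fn_mk]
  ring

/-- The distance of two vertices in the diagram. -/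
def dist (Δ : Dynkin) (a b : Δ.Vertex) : ℕ := Δ.labelDist a.1 b.1

lemma dist_self (Δ : Dynkin) (a : Δ.Vertex) : Δ.dist a a = 0 := by
  cases Δ <;> simp [dist, labelDist]

lemma dist_step_exceptional :
    (∀ a b c : E6.Vertex, E6.Adj b c → E6.dist a c = E6.dist a b + 1 ∨
      E6.dist a b = E6.dist a c + 1) ∧
    (∀ a b c : E7.Vertex, E7.Adj b c → E7.dist a c = E7.dist a b + 1 ∨
      E7.dist a b = E7.dist a c + 1) ∧
    (∀ a b c : E8.Vertex, E8.Adj b c → E8.dist a c = E8.dist a b + 1 ∨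
      E8.dist a b = E8.dist a c + 1) := by
  decide +kernel

lemma dist_of_adj {Δ : Dynkin} (a : Δ.Vertex) {b c : Δ.Vertex} (h : Δ.Adj b c) :
    Δ.dist a c = Δ.dist a b + 1 ∨ Δ.dist a b = Δ.dist a c + 1 := by
  cases Δ with
  | A n hn =>
    obtain ⟨a, ha⟩ := a; obtain ⟨b, hb⟩ := b; obtain ⟨c, hc⟩ := c
    simp only [Adj, Arrow, ArrowLabel, dist, labelDist] at *
    omega
  | D n hn =>
    obtain ⟨a, ha⟩ := a; obtain ⟨b, hb⟩ := b; obtain ⟨c, hc⟩ := c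
    simp only [Adj, Arrow, ArrowLabel, dist, labelDist] at *
    split_ifs <;> omega
  | E6 => exact dist_step_exceptional.1 a b c h
  | E7 => exact dist_step_exceptional.2.1 a b c h
  | E8 => exact dist_step_exceptional.2.2 a b c h

lemma exists_closer_exceptional :
    (∀ a b : E6.Vertex, a ≠ b → ∃ c, E6.Adj b c ∧ E6.dist a b = E6.dist a c + 1) ∧
    (∀ a b : E7.Vertex, a ≠ b → ∃ c, E7.Adj b c ∧ E7.dist a b = E7.dist a c + 1) ∧
    (∀ a b : E8.Vertex, a ≠ b → ∃ c, E8.Adj b c ∧ E8.dist a b = E8.dist a c + 1) := by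
  decide +kernel

lemma exists_closer {Δ : Dynkin} {a b : Δ.Vertex} (h : a ≠ b) :
    ∃ c, Δ.Adj b c ∧ Δ.dist a b = Δ.dist a c + 1 := by
  cases Δ with
  | A n hn =>
    obtain ⟨a, ha⟩ := a; obtain ⟨b, hb⟩ := b
    have h' : a ≠ b := fun e => h (Subtype.ext e)
    simp only [rank] at ha hb
    by_cases hab : a < b
    · refine ⟨⟨b - 1, by simp only [rank]; omega⟩, ?_⟩
      simp only [Adj, Arrow, ArrowLabel, dist, labelDist]
      omega
    · refine ⟨⟨b + 1, by simp only [rank]; omega⟩, ?_⟩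
      simp only [Adj, Arrow, ArrowLabel, dist, labelDist, true_and, true_or]
      omega
  | D n hn =>
    obtain ⟨a, ha⟩ := a; obtain ⟨b, hb⟩ := b
    have h' : a ≠ b := fun e => h (Subtype.ext e)
    simp only [rank] at ha hb
    by_cases hb' : n - 1 ≤ b
    · refine ⟨⟨n - 2, by simp only [rank]; omega⟩, ?_⟩
      simp only [Adj, Arrow, ArrowLabel, dist, labelDist, and_true]
      split_ifs <;> omega
    · by_cases hab : a < b
      · refine ⟨⟨b - 1, by simp only [rank]; omega⟩, ?_⟩
        simp only [Adj, Arrow, ArrowLabel, dist, labelDist]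
        split_ifs <;> omega
      · by_cases hb2 : b = n - 2
        · refine ⟨⟨a, by simp only [rank]; omega⟩, ?_⟩
          simp only [Adj, Arrow, ArrowLabel, dist, labelDist]
          split_ifs <;> omega
        · refine ⟨⟨b + 1, by simp only [rank]; omega⟩, ?_⟩
          simp only [Adj, Arrow, ArrowLabel, dist, labelDist, true_and]
          split_ifs <;> omega
  | E6 => exact exists_closer_exceptional.1 a b h
  | E7 => exact exists_closer_exceptional.2.1 a b h
  | E8 => exact exists_closer_exceptional.2.2 a b h

lemma closer_unique_E6 (a b c : E6.Vertex) (h : E6.Adj b c) (hd : E6.dist a b = E6.dist a c + 1) :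
    ∀ c', E6.Adj b c' → E6.dist a b = E6.dist a c' + 1 → c = c' := by
  revert a b c
  decide +kernel

lemma closer_unique_E7 (a b c : E7.Vertex) (h : E7.Adj b c) (hd : E7.dist a b = E7.dist a c + 1) :
    ∀ c', E7.Adj b c' → E7.dist a b = E7.dist a c' + 1 → c = c' := by
  revert a b c
  decide +kernel

lemma closer_unique_E8 (a b c : E8.Vertex) (h : E8.Adj b c) (hd : E8.dist a b = E8.dist a c + 1) :
    ∀ c', E8.Adj b c' → E8.dist a b = E8.dist a c' + 1 → c = c' := by
  revert a b c
  decide +kernel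

/-- The diagram is a tree: there is only one first step on the way from `b` to `a`. -/
lemma closer_unique {Δ : Dynkin} {a b c c' : Δ.Vertex} (h : Δ.Adj b c) (h' : Δ.Adj b c')
    (hd : Δ.dist a b = Δ.dist a c + 1) (hd' : Δ.dist a b = Δ.dist a c' + 1) : c = c' := by
  cases Δ with
  | A n hn =>
    obtain ⟨a, ha⟩ := a; obtain ⟨b, hb⟩ := b; obtain ⟨c, hc⟩ := c; obtain ⟨c', hc'⟩ := c'
    simp only [Adj, Arrow, ArrowLabel, dist, labelDist, rank] at *
    exact Subtype.ext (by simp only; omega)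
  | D n hn =>
    obtain ⟨a, ha⟩ := a; obtain ⟨b, hb⟩ := b; obtain ⟨c, hc⟩ := c; obtain ⟨c', hc'⟩ := c'
    simp only [Adj, Arrow, ArrowLabel, dist, labelDist, rank] at *
    refine Subtype.ext ?_
    simp only
    split_ifs at hd hd' <;> omega
  | E6 => exact closer_unique_E6 a b c h hd c' h' hd'
  | E7 => exact closer_unique_E7 a b c h hd c' h' hd'
  | E8 => exact closer_unique_E8 a b c h hd c' h' hd'

lemma eq_of_dist_eq_zero {Δ : Dynkin} {a b : Δ.Vertex} (h : Δ.dist a b = 0) : a = b := by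
  by_contra hne
  obtain ⟨c, -, hc⟩ := exists_closer hne
  omega

lemma height_of_adj {Δ : Dynkin} {a b : Δ.Vertex} (h : Δ.Adj a b) :
    Δ.height b.1 = Δ.height a.1 + 1 ∨ Δ.height a.1 = Δ.height b.1 + 1 :=
  h.imp height_arrow height_arrow

/-- The diagram is bipartite by the parity of heights. This is what gives every label a vertex at
the level that the cone demands. -/
lemma even_dist_add_height {Δ : Dynkin} (a b : Δ.Vertex) :
    Even ((Δ.dist a b : ℤ) + Δ.height a.1 + Δ.height b.1) := by
  induction hn : Δ.dist a b generalizing b with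
  | zero =>
    obtain rfl := eq_of_dist_eq_zero hn
    exact ⟨Δ.height a.1, by simp⟩
  | succ n ih =>
    have hne : a ≠ b := by
      rintro rfl
      rw [dist_self] at hn
      omega
    obtain ⟨c, hbc, hc⟩ := exists_closer hne
    obtain ⟨t, ht⟩ := ih c (by omega)
    rcases height_of_adj hbc with h | h
    · exact ⟨t, by push_cast; omega⟩
    · exact ⟨t + 1, by push_cast; omega⟩

/-! ## Slices -/

/-- The vertices of the slice which starts at `x`. -/
def cone (Δ : Dynkin) (x : Δ.ZVertex) : Set Δ.ZVertex :=
  {z | Δ.level z = Δ.level x + Δ.dist x.2 z.2}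

lemma even_level_sub {Δ : Dynkin} (x z : Δ.ZVertex) :
    Even (Δ.level z - Δ.level x - Δ.dist x.2 z.2) := by
  obtain ⟨t, ht⟩ := even_dist_add_height x.2 z.2
  exact ⟨z.1 - x.1 + Δ.height z.2.1 - t, by unfold level; omega⟩

lemma exists_mem_cone {Δ : Dynkin} (x : Δ.ZVertex) (q : Δ.Vertex) : ∃ r : ℤ, (r, q) ∈ Δ.cone x := by
  obtain ⟨t, ht⟩ := even_level_sub x (0, q)
  refine ⟨-t, ?_⟩
  simp only [cone, Set.mem_ofPred_eq]
  simp only [level] at ht ⊢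
  omega

lemma mem_cone_self {Δ : Dynkin} (x : Δ.ZVertex) : x ∈ Δ.cone x := by
  simp [cone, dist_self]

lemma exists_pred_mem_cone {Δ : Dynkin} {x z : Δ.ZVertex} (hz : z ∈ Δ.cone x) (hne : z ≠ x) :
    ∃ y ∈ Δ.cone x, Δ.ZArrow y z ∧ Δ.dist x.2 z.2 = Δ.dist x.2 y.2 + 1 := by
  have hq : x.2 ≠ z.2 := fun h => hne (by
    refine eq_of_level h.symm ?_
    simp only [cone, Set.mem_ofPred_eq, ← h, dist_self] at hz
    simpa using hz)
  obtain ⟨c, hc, hd⟩ := exists_closer hq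
  obtain ⟨r, hr⟩ := exists_mem_cone x c
  refine ⟨(r, c), hr, zArrow_iff.2 ⟨hc.symm, ?_⟩, hd⟩
  simp only [cone, Set.mem_ofPred_eq] at hz hr
  omega

lemma isSliceStartingAt_cone {Δ : Dynkin} (x : Δ.ZVertex) :
    Δ.IsSliceStartingAt x (Δ.cone x) := by
  have hj : ∀ z ∈ Δ.cone x, Δ.Joined (Δ.cone x) x z := by
    intro z hz
    induction hn : Δ.dist x.2 z.2 generalizing z with
    | zero =>
      have hx : z = x := eq_of_level (eq_of_dist_eq_zero hn).symm (by
        simp only [cone, Set.mem_ofPred_eq] at hz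
        omega)
      rw [hx]
      exact Relation.ReflTransGen.refl
    | succ n ih =>
      have hne : z ≠ x := by
        rintro rfl
        rw [dist_self] at hn
        omega
      obtain ⟨y, hy, hyz, hd⟩ := exists_pred_mem_cone hz hne
      exact (ih y hy (by omega)).tail ⟨hy, hz, Or.inl hyz⟩
  refine ⟨⟨fun q => ?_, fun y hy z hz => ?_⟩, mem_cone_self x, fun y hy => ⟨fun h => ?_, ?_⟩⟩
  · obtain ⟨r, hr⟩ := exists_mem_cone x q
    refine ⟨r, hr, fun r' hr' => ?_⟩
    simp only [cone, Set.mem_ofPred_eq, level] at hr hr'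
    omega
  · refine Relation.ReflTransGen.trans ?_ (hj z hz)
    exact Std.Symm.symm (self := @Relation.ReflTransGen.stdSymm _ _
      ⟨fun a b h => ⟨h.2.1, h.1, h.2.2.symm⟩⟩) _ _ (hj y hy)
  · by_contra hne
    obtain ⟨z, hz, hzy, -⟩ := exists_pred_mem_cone hy hne
    exact h z hz hzy
  · rintro rfl z hz hzy
    have := (zArrow_iff.1 hzy).2
    simp only [cone, Set.mem_ofPred_eq] at hz
    omega

/-- Induction on the level along predecessors in the slice. Each step must lead away from the label
of `x`: a step back would return to the label of the preceding vertex at a different level, and a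
slice has one vertex per label. Levels on `L` are bounded below, so the induction starts. -/
lemma eq_cone_of_isSliceStartingAt {Δ : Dynkin} {x : Δ.ZVertex} {L : Set Δ.ZVertex}
    (h : Δ.IsSliceStartingAt x L) : L = Δ.cone x := by
  obtain ⟨⟨hL, -⟩, hx, hs⟩ := h
  have huniq : ∀ y ∈ L, ∀ z ∈ L, y.2 = z.2 → y = z := by
    rintro ⟨r, q⟩ hy ⟨r', q'⟩ hz (rfl : q = q')
    rw [(hL q).unique hy hz]
  choose r hr using fun q => (hL q).exists
  obtain ⟨B, hB⟩ : ∃ B : ℤ, ∀ q, B ≤ Δ.level (r q, q) := by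
    obtain ⟨B, hB⟩ := (Set.finite_range fun q => Δ.level (r q, q)).bddBelow
    exact ⟨B, fun q => hB ⟨q, rfl⟩⟩
  have hB' : ∀ y ∈ L, B ≤ Δ.level y := fun y hy => by
    rw [huniq y hy _ (hr y.2) rfl]
    exact hB _
  have hpred : ∀ y ∈ L, y ≠ x → ∃ z ∈ L, Δ.ZArrow z y := by
    intro y hy hne
    by_contra! hc
    exact hne ((hs y hy).1 hc)
  have hsub : ∀ n : ℕ, ∀ y ∈ L, Δ.level y ≤ B + n → y ∈ Δ.cone x := by
    intro n
    induction n with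
    | zero =>
      intro y hy hle
      by_cases hne : y = x
      · rw [hne]; exact mem_cone_self x
      · obtain ⟨z, hz, hzy⟩ := hpred y hy hne
        have h1 := (zArrow_iff.1 hzy).2
        have h2 := hB' z hz
        push_cast at hle
        omega
    | succ n ih =>
      intro y hy hle
      by_cases hne : y = x
      · rw [hne]; exact mem_cone_self x
      obtain ⟨z, hz, hzy⟩ := hpred y hy hne
      obtain ⟨hadj, hl⟩ := zArrow_iff.1 hzy
      have hzc := ih z hz (by push_cast at hle; omega)
      have hzc' : Δ.level z = Δ.level x + Δ.dist x.2 z.2 := hzc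
      rcases dist_of_adj x.2 hadj with hd | hd
      · change Δ.level y = Δ.level x + Δ.dist x.2 y.2
        omega
      · exfalso
        have hzx : z ≠ x := by
          rintro rfl
          rw [dist_self] at hd
          omega
        obtain ⟨w, hw, hwz⟩ := hpred z hz hzx
        obtain ⟨hadj', hl'⟩ := zArrow_iff.1 hwz
        have hwc : Δ.level w = Δ.level x + Δ.dist x.2 w.2 :=
          ih w hw (by push_cast at hle; omega)
        have := huniq w hw y hy (closer_unique hadj'.symm hadj (by omega) hd)
        rw [this] at hl'
        omega
  refine Set.Subset.antisymm (fun y hy => hsub (Δ.level y - B).toNat y hy (by omega)) ?_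
  intro z hz
  have h1 := hr z.2
  have h2 : Δ.level (r z.2, z.2) = Δ.level x + Δ.dist x.2 z.2 :=
    hsub (Δ.level (r z.2, z.2) - B).toNat _ h1 (by omega)
  rwa [← eq_of_level (x := (r z.2, z.2)) (y := z) rfl (h2.trans (Eq.symm hz))]

/-! ## Additive functions -/

/-- The sum of the values of `f` at the neighbours of `q`. -/
def nbrSum (Δ : Dynkin) {R : Type*} [AddCommMonoid R] (f : Δ.Vertex → R) (q : Δ.Vertex) : R :=
  ∑ a, if Δ.Adj q a then f a else 0

lemma nbrSum_add {Δ : Dynkin} (f g : Δ.Vertex → ℤ) (q : Δ.Vertex) :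
    Δ.nbrSum (fun a => f a + g a) q = Δ.nbrSum f q + Δ.nbrSum g q := by
  unfold nbrSum
  rw [← Finset.sum_add_distrib]
  exact Finset.sum_congr rfl fun a _ => by split_ifs <;> simp

lemma nbrSum_sub {Δ : Dynkin} (f g : Δ.Vertex → ℤ) (q : Δ.Vertex) :
    Δ.nbrSum (fun a => f a - g a) q = Δ.nbrSum f q - Δ.nbrSum g q := by
  unfold nbrSum
  rw [← Finset.sum_sub_distrib]
  exact Finset.sum_congr rfl fun a _ => by split_ifs <;> simp

lemma nbrSum_neg {Δ : Dynkin} (f : Δ.Vertex → ℤ) (q : Δ.Vertex) :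
    Δ.nbrSum (fun a => -f a) q = -Δ.nbrSum f q := by
  unfold nbrSum
  rw [← Finset.sum_neg_distrib]
  exact Finset.sum_congr rfl fun a _ => by split_ifs <;> simp

lemma nbrSum_zero {Δ : Dynkin} {f : Δ.Vertex → ℤ} {q : Δ.Vertex}
    (h : ∀ a, Δ.Adj q a → f a = 0) : Δ.nbrSum f q = 0 :=
  Finset.sum_eq_zero fun a _ => by
    split_ifs with ha
    · exact h a ha
    · rfl

lemma nbrSum_single {Δ : Dynkin} (a q : Δ.Vertex) :
    Δ.nbrSum (fun b => if b = a then (1 : ℤ) else 0) q = if Δ.Adj q a then 1 else 0 := by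
  unfold nbrSum
  rw [Finset.sum_eq_single a]
  · simp
  · intro b _ hb
    simp [hb]
  · simp

lemma nbrSum_cast {Δ : Dynkin} (f : Δ.Vertex → ℕ) (q : Δ.Vertex) :
    Δ.nbrSum (fun a => (f a : ℤ)) q = (Δ.nbrSum f q : ℕ) := by
  unfold nbrSum
  rw [Nat.cast_sum]
  exact Finset.sum_congr rfl fun a _ => by split_ifs <;> simp

/-- The solution of `u (n + 2) + u n = nbrSum (u (n + 1))` with `u 0 = 0` and `u 1` the indicator
function of `s`. -/
def wave (Δ : Dynkin) (s : Δ.Vertex) : ℕ → Δ.Vertex → ℤ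
  | 0, _ => 0
  | 1, q => if q = s then 1 else 0
  | n + 2, q => Δ.nbrSum (Δ.wave s (n + 1)) q - Δ.wave s n q

lemma wave_zero {Δ : Dynkin} (s q : Δ.Vertex) : Δ.wave s 0 q = 0 := by rw [wave]

lemma wave_one {Δ : Dynkin} (s q : Δ.Vertex) : Δ.wave s 1 q = if q = s then 1 else 0 := by
  rw [wave]

lemma wave_add_two {Δ : Dynkin} (s : Δ.Vertex) (n : ℕ) (q : Δ.Vertex) :
    Δ.wave s (n + 2) q = Δ.nbrSum (Δ.wave s (n + 1)) q - Δ.wave s n q := by rw [wave]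

/-- The wave front moves at unit speed and keeps height 1, because on a tree each vertex is reached
from a single closer neighbour. It traces the slice on which `f_x` is 1. -/
lemma wave_of_le_dist {Δ : Dynkin} (s : Δ.Vertex) (j : ℕ) (q : Δ.Vertex) :
    (j ≤ Δ.dist s q → Δ.wave s j q = 0) ∧ (j = Δ.dist s q + 1 → Δ.wave s j q = 1) := by
  induction j using Nat.strong_induction_on generalizing q with
  | _ j ih =>
    match j with
    | 0 => exact ⟨fun _ => wave_zero s q, fun h => by omega⟩
    | 1 =>
      rw [wave_one]
      refine ⟨fun h => if_neg ?_, fun h => if_pos ?_⟩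
      · rintro rfl
        rw [dist_self] at h
        omega
      · exact (eq_of_dist_eq_zero (by omega)).symm
    | j + 2 =>
      rw [wave_add_two]
      refine ⟨fun h => ?_, fun h => ?_⟩
      · rw [(ih j (by omega) q).1 (by omega), nbrSum_zero, sub_zero]
        intro a ha
        refine (ih (j + 1) (by omega) a).1 ?_
        have := dist_of_adj s ha
        omega
      · rw [(ih j (by omega) q).1 (by omega), sub_zero]
        have hne : s ≠ q := by
          rintro rfl
          rw [dist_self] at h
          omega
        obtain ⟨c, hc, hd⟩ := exists_closer hne
        unfold nbrSum
        rw [Finset.sum_eq_single c]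
        · rw [if_pos hc]
          exact (ih (j + 1) (by omega) c).2 (by omega)
        · intro a _ hac
          split_ifs with ha
          · refine (ih (j + 1) (by omega) a).1 ?_
            rcases dist_of_adj s ha with h1 | h1
            · omega
            · exact (hac (closer_unique ha hc h1 hd)).elim
          · rfl
        · simp

/-- The extension of `wave` to negative indices. -/
def waveZ (Δ : Dynkin) (s : Δ.Vertex) (i : ℤ) (q : Δ.Vertex) : ℤ :=
  if 0 ≤ i then Δ.wave s i.toNat q else -Δ.wave s (-i).toNat q

lemma waveZ_natCast {Δ : Dynkin} (s : Δ.Vertex) (n : ℕ) (q : Δ.Vertex) :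
    Δ.waveZ s n q = Δ.wave s n q := by
  simp [waveZ]

lemma waveZ_neg {Δ : Dynkin} (s : Δ.Vertex) (i : ℤ) (q : Δ.Vertex) :
    Δ.waveZ s (-i) q = -Δ.waveZ s i q := by
  unfold waveZ
  rcases lt_trichotomy i 0 with h | rfl | h
  · rw [if_pos (by omega), if_neg (by omega)]; simp
  · simp [wave_zero]
  · rw [if_neg (by omega), if_pos (by omega)]; simp

/-- The recursion is symmetric under time reversal, so the odd extension satisfies it too, including
at time 0. -/
lemma waveZ_rec {Δ : Dynkin} (s : Δ.Vertex) (i : ℤ) (q : Δ.Vertex) :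
    Δ.waveZ s (i + 1) q + Δ.waveZ s (i - 1) q = Δ.nbrSum (Δ.waveZ s i) q := by
  have key : ∀ n : ℕ, Δ.waveZ s ((n : ℤ) + 1) q + Δ.waveZ s ((n : ℤ) - 1) q =
      Δ.nbrSum (Δ.waveZ s n) q := by
    intro n
    cases n with
    | zero =>
      rw [nbrSum_zero (fun a _ => by simp [waveZ, wave_zero])]
      have := waveZ_neg s 1 q
      simp only [Nat.cast_zero, zero_add, zero_sub]
      omega
    | succ n =>
      have e1 : Δ.waveZ s ((n + 1 : ℕ) + 1) q = Δ.wave s (n + 2) q := waveZ_natCast s (n + 2) q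
      have e2 : Δ.waveZ s ((n + 1 : ℕ) - 1) q = Δ.wave s n q := by
        rw [← waveZ_natCast]; congr 1; push_cast; ring
      have e3 : Δ.waveZ s (n + 1 : ℕ) = Δ.wave s (n + 1) := funext fun a => waveZ_natCast s _ a
      rw [e1, e2, e3, wave_add_two]
      ring
  rcases le_total 0 i with h | h
  · have := key i.toNat
    rwa [Int.toNat_of_nonneg h] at this
  · have := key (-i).toNat
    rw [Int.toNat_of_nonneg (by omega)] at this
    have e3 : Δ.waveZ s (-i) = fun a => -Δ.waveZ s i a := funext fun a => waveZ_neg s i a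
    have e1 : (-i + 1) = -(i - 1) := by ring
    have e2 : (-i - 1) = -(i + 1) := by ring
    rw [e1, e2, waveZ_neg, waveZ_neg, e3, nbrSum_neg] at this
    linarith

/-- The predecessor of `x` in `ℤΔ` with label `a`, for a neighbour `a` of the label of `x`. -/
def pred (Δ : Dynkin) (x : Δ.ZVertex) (a : Δ.Vertex) : Δ.ZVertex :=
  (if Δ.ArrowLabel a.1 x.2.1 then x.1 else x.1 - 1, a)

lemma level_pred {Δ : Dynkin} (x : Δ.ZVertex) {a : Δ.Vertex} (h : Δ.Adj x.2 a) :
    Δ.level (Δ.pred x a) = Δ.level x - 1 := by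
  unfold level pred
  by_cases h1 : Δ.ArrowLabel a.1 x.2.1
  · rw [if_pos h1]
    have := height_arrow (show Δ.Arrow a x.2 from h1)
    simp only
    omega
  · rw [if_neg h1]
    have := height_arrow (h.resolve_right h1)
    simp only
    omega

lemma pred_zArrow {Δ : Dynkin} (x : Δ.ZVertex) {a : Δ.Vertex} (h : Δ.Adj x.2 a) :
    Δ.ZArrow (Δ.pred x a) x :=
  zArrow_iff.2 ⟨h.symm, by rw [level_pred x h]; ring⟩

lemma eq_pred_of_zArrow {Δ : Dynkin} {x y : Δ.ZVertex} (h : Δ.ZArrow y x) :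
    y = Δ.pred x y.2 := by
  obtain ⟨ha, hl⟩ := zArrow_iff.1 h
  exact eq_of_level rfl (by rw [level_pred x ha.symm]; omega)

lemma finsum_zArrow {Δ : Dynkin} (f : Δ.ZVertex → ℤ) (x : Δ.ZVertex) :
    ∑ᶠ (y : Δ.ZVertex) (_ : Δ.ZArrow y x), f y = Δ.nbrSum (fun a => f (Δ.pred x a)) x.2 := by
  classical
  have hs : {y | Δ.ZArrow y x} =
      ((Finset.univ.filter fun a => Δ.Adj x.2 a).image (Δ.pred x) : Finset Δ.ZVertex) := by
    ext y
    simp only [Set.mem_ofPred_eq, Finset.coe_image, Finset.coe_filter, Finset.mem_univ, true_and,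
      Set.mem_image]
    exact ⟨fun h => ⟨y.2, (zArrow_iff.1 h).1.symm, (eq_pred_of_zArrow h).symm⟩,
      fun ⟨a, ha, e⟩ => e ▸ pred_zArrow x ha⟩
  have h1 : ∑ᶠ (y : Δ.ZVertex) (_ : Δ.ZArrow y x), f y = ∑ᶠ y ∈ {y | Δ.ZArrow y x}, f y := rfl
  rw [h1, hs, finsum_mem_coe_finset, Finset.sum_image, Finset.sum_filter]
  · rfl
  · intro a _ b _ hab
    exact congrArg Prod.snd hab

lemma isAdditive_waveZ {Δ : Dynkin} (x : Δ.ZVertex) :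
    Δ.IsAdditive fun z => Δ.waveZ x.2 (Δ.level z - Δ.level x + 1) z.2 := by
  intro z
  rw [finsum_zArrow]
  have e : Δ.nbrSum (fun a => Δ.waveZ x.2 (Δ.level (Δ.pred z a) - Δ.level x + 1) (Δ.pred z a).2)
      z.2 = Δ.nbrSum (Δ.waveZ x.2 (Δ.level z - Δ.level x)) z.2 := by
    refine Finset.sum_congr rfl fun a _ => ?_
    split_ifs with ha
    · beta_reduce
      rw [level_pred z ha, show Δ.level z - 1 - Δ.level x + 1 = Δ.level z - Δ.level x by ring]
      rfl
    · rfl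
  have e' : Δ.level (Δ.tau z) - Δ.level x + 1 = Δ.level z - Δ.level x - 1 := by
    rw [level_tau]
    ring
  change _ + Δ.waveZ x.2 (Δ.level (Δ.tau z) - Δ.level x + 1) z.2 = _
  rw [e, ← waveZ_rec, e']

/-- Each mesh has three consecutive levels, so the values on the cone propagate upwards by solving
for `g z` and downwards by solving for `g (τ z)`. -/
lemma eq_zero_of_isAdditive {Δ : Dynkin} {x : Δ.ZVertex} {g : Δ.ZVertex → ℤ}
    (hg : Δ.IsAdditive g) (h0 : ∀ z ∈ Δ.cone x, g z = 0) : g = 0 := by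
  have hg' : ∀ z, g z + g (Δ.tau z) = Δ.nbrSum (fun a => g (Δ.pred z a)) z.2 := fun z => by
    rw [hg z, finsum_zArrow]
  have hup : ∀ n : ℕ, ∀ z, Δ.level z = Δ.level x + n → (Δ.dist x.2 z.2 : ℤ) ≤ n → g z = 0 := by
    intro n
    induction n using Nat.strong_induction_on with
    | _ n ih =>
      intro z hz hd
      by_cases hc : (Δ.dist x.2 z.2 : ℤ) = n
      · exact h0 z (by change _ = _; rw [hz, hc])
      · obtain ⟨t, ht⟩ := even_level_sub x z
        have h1 := hg' z
        rw [ih (n - 2) (by omega) (Δ.tau z) (by rw [level_tau]; omega)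
          (by change (Δ.dist x.2 z.2 : ℤ) ≤ _; omega), nbrSum_zero, add_zero] at h1
        · exact h1
        · intro a ha
          refine ih (n - 1) (by omega) _ (by rw [level_pred z ha]; omega) ?_
          change (Δ.dist x.2 a : ℤ) ≤ _
          have := dist_of_adj x.2 ha
          omega
  -- The downward induction starts at the level `level x + B`, above which no vertex lies on or
  -- below the cone.
  obtain ⟨B, hB⟩ : ∃ B : ℕ, ∀ q, Δ.dist x.2 q ≤ B := by
    obtain ⟨B, hB⟩ := (Set.finite_range fun q => Δ.dist x.2 q).bddAbove
    exact ⟨B, fun q => hB ⟨q, rfl⟩⟩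
  have hdown : ∀ n : ℕ, ∀ z, Δ.level z = Δ.level x + B - n → Δ.level z ≤ Δ.level x + Δ.dist x.2 z.2 →
      g z = 0 := by
    intro n
    induction n using Nat.strong_induction_on with
    | _ n ih =>
      intro z hz hd
      by_cases hc : Δ.level z = Δ.level x + Δ.dist x.2 z.2
      · exact h0 z hc
      · obtain ⟨t, ht⟩ := even_level_sub x z
        have hBz := hB z.2
        set w := Δ.tau⁻¹ z with hw
        have hwz : Δ.tau w = z := by rw [hw]; exact Δ.tau.apply_symm_apply z
        have hwl : Δ.level w = Δ.level z + 2 := by rw [← hwz, level_tau]; ring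
        have hw2 : w.2 = z.2 := by rw [← hwz]; rfl
        have h1 := hg' w
        rw [hwz, ih (n - 2) (by omega) w (by omega) (by rw [hw2]; omega), nbrSum_zero,
          zero_add] at h1
        · exact h1
        · intro a ha
          have hda := dist_of_adj x.2 ha
          rw [hw2] at hda
          refine ih (n - 1) (by omega) _ (by rw [level_pred w ha]; omega) ?_
          rw [level_pred w ha]
          change _ ≤ _ + (Δ.dist x.2 a : ℤ)
          omega
  funext z
  rcases le_total (Δ.level x + Δ.dist x.2 z.2) (Δ.level z) with h | h
  · exact hup (Δ.level z - Δ.level x).toNat z (by omega) (by omega)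
  · have := hB z.2
    exact hdown (Δ.level x + B - Δ.level z).toNat z (by omega) h

/-- Both the slice and the additive function are unique, which pins down the chosen function. The `+
1` is there because the indicator of the starting vertex is the wave at time 1. -/
lemma addFun_eq {Δ : Dynkin} (x z : Δ.ZVertex) :
    Δ.addFun x z = Δ.waveZ x.2 (Δ.level z - Δ.level x + 1) z.2 := by
  set f : Δ.ZVertex → ℤ := fun z => Δ.waveZ x.2 (Δ.level z - Δ.level x + 1) z.2 with hf
  have h1 : ∀ y ∈ Δ.cone x, f y = 1 := by
    intro y hy
    have hy' : Δ.level y = Δ.level x + Δ.dist x.2 y.2 := hy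
    have e : Δ.level y - Δ.level x + 1 = ((Δ.dist x.2 y.2 + 1 : ℕ) : ℤ) := by push_cast; omega
    rw [hf]
    simp only [e]
    rw [waveZ_natCast]
    exact (wave_of_le_dist x.2 _ y.2).2 rfl
  have hex : ∃ f : Δ.ZVertex → ℤ, Δ.IsAdditive f ∧
      ∃ L, Δ.IsSliceStartingAt x L ∧ ∀ y ∈ L, f y = 1 :=
    ⟨f, isAdditive_waveZ x, Δ.cone x, isSliceStartingAt_cone x, h1⟩
  obtain ⟨ha, L, hL, h2⟩ := Classical.epsilon_spec hex
  change Δ.IsAdditive (Δ.addFun x) at ha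
  change ∀ y ∈ L, Δ.addFun x y = 1 at h2
  rw [eq_cone_of_isSliceStartingAt hL] at h2
  have h0 : (fun z => Δ.addFun x z - f z) = 0 := by
    refine eq_zero_of_isAdditive (x := x) (fun z => ?_) fun y hy => by
      rw [h1 y hy, h2 y hy, sub_self]
    have e1 := ha z
    have e2 := isAdditive_waveZ x z
    rw [finsum_zArrow] at e1 e2 ⊢
    rw [nbrSum_sub, ← e1]
    change _ = _ - Δ.nbrSum (fun a => f (Δ.pred z a)) z.2
    have e2' : f z + f (Δ.tau z) = Δ.nbrSum (fun a => f (Δ.pred z a)) z.2 := e2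
    rw [← e2']
    ring
  have := congrFun h0 z
  simp only [Pi.zero_apply] at this
  linarith

/-! ## Truncated waves -/

/-- The recursion also determines `u n` from the two later values. -/
lemma eq_zero_of_eventually_zero {Δ : Dynkin} {u : ℕ → Δ.Vertex → ℤ}
    (hu : ∀ n q, u (n + 2) q = Δ.nbrSum (u (n + 1)) q - u n q) {N : ℕ}
    (hN : ∀ n, N ≤ n → ∀ q, u n q = 0) : ∀ n q, u n q = 0 := by
  induction N with
  | zero => exact fun n => hN n (Nat.zero_le n)
  | succ N ih =>
    refine ih fun n hn q => ?_
    have h := hu n q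
    rw [hN (n + 2) (by omega), nbrSum_zero fun a _ => hN (n + 1) (by omega) a] at h
    omega

lemma eq_zero_of_consecutive_zeros {Δ : Dynkin} {u : ℕ → Δ.Vertex → ℤ}
    (hu : ∀ n q, u (n + 2) q = Δ.nbrSum (u (n + 1)) q - u n q) {N : ℕ}
    (h0 : ∀ q, u N q = 0) (h1 : ∀ q, u (N + 1) q = 0) : ∀ n q, u n q = 0 := by
  have h : ∀ i, (∀ q, u (N + i) q = 0) ∧ ∀ q, u (N + i + 1) q = 0 := by
    intro i
    induction i with
    | zero => exact ⟨h0, h1⟩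
    | succ i ih =>
      refine ⟨ih.2, fun q => ?_⟩
      rw [show N + (i + 1) + 1 = N + i + 2 by ring, hu, nbrSum_zero fun a _ => ih.2 a, ih.1]
      rfl
  refine eq_zero_of_eventually_zero hu (N := N) fun n hn q => ?_
  rw [← Nat.add_sub_of_le hn]
  exact (h _).1 q

lemma nbrSum_comm {Δ : Dynkin} (F : Δ.Vertex → Δ.Vertex → ℤ) (s a : Δ.Vertex) :
    Δ.nbrSum (fun s' => Δ.nbrSum (F s') a) s =
      Δ.nbrSum (fun b => Δ.nbrSum (fun s' => F s' b) s) a := by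
  have h1 : ∀ (f : Δ.Vertex → ℤ) (p : Prop) [Decidable p] (q : Δ.Vertex),
      (if p then ∑ b, (if Δ.Adj q b then f b else 0) else 0) =
        ∑ b, if p then (if Δ.Adj q b then f b else 0) else 0 := by
    intro f p _ q
    split_ifs <;> simp
  unfold nbrSum
  simp only [h1]
  rw [Finset.sum_comm]
  refine Finset.sum_congr rfl fun b _ => Finset.sum_congr rfl fun c _ => ?_
  split_ifs <;> rfl

/-- As a matrix in `s` and `a`, the wave at time `j` is a Chebyshev-type polynomial in the adjacency
matrix, so it commutes with that matrix. -/
lemma nbrSum_wave_comm {Δ : Dynkin} (s : Δ.Vertex) (j : ℕ) (a : Δ.Vertex) :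
    Δ.nbrSum (fun s' => Δ.wave s' j a) s = Δ.nbrSum (Δ.wave s j) a := by
  induction j using Nat.strong_induction_on generalizing a with
  | _ j ih =>
    match j with
    | 0 => rw [nbrSum_zero fun b _ => wave_zero b a, nbrSum_zero fun b _ => wave_zero s b]
    | 1 =>
      have e1 : (fun s' => Δ.wave s' 1 a) = fun s' => if s' = a then (1 : ℤ) else 0 :=
        funext fun s' => by rw [wave_one]; exact if_congr eq_comm rfl rfl
      have e2 : Δ.wave s 1 = fun b => if b = s then (1 : ℤ) else 0 := funext fun b => wave_one s b
      rw [e1, e2, nbrSum_single, nbrSum_single]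
      exact if_congr adj_comm rfl rfl
    | j + 2 =>
      have e1 : (fun s' => Δ.wave s' (j + 2) a) =
          fun s' => Δ.nbrSum (Δ.wave s' (j + 1)) a - Δ.wave s' j a :=
        funext fun s' => wave_add_two s' j a
      have e2 : Δ.wave s (j + 2) = fun b => Δ.nbrSum (Δ.wave s (j + 1)) b - Δ.wave s j b :=
        funext fun b => wave_add_two s j b
      rw [e1, e2, nbrSum_sub, nbrSum_sub, nbrSum_comm, ih j (by omega)]
      congr 2
      exact funext fun b => ih (j + 1) (by omega) b

/-- A sequence of functions on the vertices which starts in the indicator function of `s`,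
propagates like a wave except for one additional pulse, which occurs at the vertices with
property `P` at time `m + 2`, and finally vanishes. -/
structure IsPulse (Δ : Dynkin) (s : Δ.Vertex) (D : ℕ → Δ.Vertex → ℕ) (m : ℕ) (P : Δ.Vertex → Prop)
    [DecidablePred P] : Prop where
  zero : ∀ q, D 0 q = if q = s then 1 else 0
  one : ∀ q, D 1 q = Δ.nbrSum (D 0) q
  add_two : ∀ n q, D (n + 2) q + D n q = Δ.nbrSum (D (n + 1)) q + if n = m ∧ P q then 1 else 0
  eventually : ∃ N, ∀ n, N ≤ n → ∀ q, D n q = 0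
  unique : ∀ q q', P q → P q' → q = q'

namespace IsPulse

variable {Δ : Dynkin} {s : Δ.Vertex} {D : ℕ → Δ.Vertex → ℕ} {m : ℕ} {P : Δ.Vertex → Prop}
  [DecidablePred P]

lemma cast_add_two (h : Δ.IsPulse s D m P) (n : ℕ) (q : Δ.Vertex) :
    (D (n + 2) q : ℤ) = Δ.nbrSum (fun a => (D (n + 1) a : ℤ)) q - D n q +
      if n = m ∧ P q then 1 else 0 := by
  have h1 := h.add_two n q
  rw [nbrSum_cast]
  split_ifs at h1 ⊢ <;> omega

lemma cast_zero (h : Δ.IsPulse s D m P) (q : Δ.Vertex) : (D 0 q : ℤ) = Δ.wave s 1 q := by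
  rw [h.zero, wave_one]
  split_ifs <;> rfl

lemma cast_one (h : Δ.IsPulse s D m P) (q : Δ.Vertex) : (D 1 q : ℤ) = Δ.wave s 2 q := by
  rw [h.one, ← nbrSum_cast, wave_add_two, wave_zero, sub_zero]
  congr 1
  exact funext fun a => h.cast_zero a

lemma eq_wave (h : Δ.IsPulse s D m P) (n : ℕ) (q : Δ.Vertex)
    (hn : n ≤ m + 1 ∨ ∀ q, ¬ P q) : (D n q : ℤ) = Δ.wave s (n + 1) q := by
  induction n using Nat.strong_induction_on generalizing q with
  | _ n ih =>
    match n with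
    | 0 => exact h.cast_zero q
    | 1 => exact h.cast_one q
    | n + 2 =>
      have hP : ¬ (n = m ∧ P q) := by
        rintro ⟨h1, h2⟩
        rcases hn with hn | hn
        · omega
        · exact hn q h2
      rw [h.cast_add_two, if_neg hP, add_zero, wave_add_two s (n + 1),
        ih n (by omega) q (hn.imp_left (by omega))]
      congr 2
      exact funext fun a => ih (n + 1) (by omega) a (hn.imp_left (by omega))

lemma not_forall_wave_eq_zero (s : Δ.Vertex) : ¬ ∀ n q, Δ.wave s n q = 0 := by
  intro h
  have := h 1 s
  rw [wave_one, if_pos rfl] at this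
  omega

lemma exists_pulse (h : Δ.IsPulse s D m P) : ∃ t, P t := by
  by_contra! hP
  obtain ⟨N, hN⟩ := h.eventually
  refine not_forall_wave_eq_zero s (eq_zero_of_eventually_zero (wave_add_two s) (N := N + 1) ?_)
  intro n hn q
  obtain ⟨n, rfl⟩ : ∃ i, n = i + 1 := ⟨n - 1, by omega⟩
  rw [← h.eq_wave n q (Or.inr hP), hN n (by omega)]
  rfl

lemma eq_add (h : Δ.IsPulse s D m P) {t : Δ.Vertex} (ht : P t) (i : ℕ) (q : Δ.Vertex) :
    (D (m + 1 + i) q : ℤ) = Δ.wave s (m + 2 + i) q + Δ.wave t i q := by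
  induction i using Nat.strong_induction_on generalizing q with
  | _ i ih =>
    match i with
    | 0 =>
      rw [wave_zero]
      simp only [add_zero]
      exact h.eq_wave _ q (Or.inl le_rfl)
    | 1 =>
      rw [show m + 1 + 1 = m + 2 by ring, h.cast_add_two, h.eq_wave m q (Or.inl (by omega)),
        show m + 2 + 1 = (m + 1) + 2 by ring, wave_add_two, wave_one]
      have e : (fun a => (D (m + 1) a : ℤ)) = Δ.wave s (m + 1 + 1) :=
        funext fun a => h.eq_wave _ a (Or.inl le_rfl)
      rw [e]
      congr 1
      exact if_congr ⟨fun hq => h.unique q t hq.2 ht, fun e => ⟨rfl, e ▸ ht⟩⟩ rfl rfl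
    | i + 2 =>
      have e : (fun a => (D (m + 1 + i + 1) a : ℤ)) =
          fun a => Δ.wave s (m + 2 + i + 1) a + Δ.wave t (i + 1) a :=
        funext fun a => ih (i + 1) (by omega) a
      rw [show m + 1 + (i + 2) = m + 1 + i + 2 by ring, h.cast_add_two, e, if_neg (by omega),
        ih i (by omega), nbrSum_add, show m + 2 + (i + 2) = m + 2 + i + 2 by ring, wave_add_two,
        wave_add_two]
      ring

/-- After the pulse `D` is the old wave plus the wave started by the pulse. This sum solves the
pulse-free recursion and vanishes eventually, hence from the start: the pulse cancels the wave
exactly. -/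
lemma wave_add_wave (h : Δ.IsPulse s D m P) {t : Δ.Vertex} (ht : P t) (i : ℕ) (q : Δ.Vertex) :
    Δ.wave s (m + 2 + i) q + Δ.wave t i q = 0 := by
  obtain ⟨N, hN⟩ := h.eventually
  refine eq_zero_of_eventually_zero
    (u := fun i q => Δ.wave s (m + 2 + i) q + Δ.wave t i q) (N := N) ?_ ?_ i q
  · intro n q
    rw [nbrSum_add, show m + 2 + (n + 2) = m + 2 + n + 2 by ring, wave_add_two, wave_add_two]
    simp only [← add_assoc]
    ring
  · intro n hn q
    rw [← h.eq_add ht, hN _ (by omega)]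
    rfl

lemma eq_zero (h : Δ.IsPulse s D m P) {n : ℕ} (hn : m + 1 ≤ n) (q : Δ.Vertex) : D n q = 0 := by
  obtain ⟨t, ht⟩ := h.exists_pulse
  obtain ⟨i, rfl⟩ := Nat.exists_eq_add_of_le hn
  have := h.eq_add ht i q
  rw [h.wave_add_wave ht] at this
  exact_mod_cast this

lemma wave_eq_zero (h : Δ.IsPulse s D m P) (q : Δ.Vertex) : Δ.wave s (m + 2) q = 0 := by
  rw [← h.eq_wave (m + 1) q (Or.inl le_rfl), h.eq_zero le_rfl]
  rfl

lemma wave_top (h : Δ.IsPulse s D m P) {t : Δ.Vertex} (ht : P t) (q : Δ.Vertex) :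
    Δ.wave s (m + 1) q = if q = t then 1 else 0 := by
  have h1 := h.wave_add_wave ht 1 q
  rw [show m + 2 + 1 = m + 1 + 2 by ring, wave_add_two, nbrSum_zero fun a _ => h.wave_eq_zero a,
    wave_one] at h1
  omega

lemma wave_nonneg (h : Δ.IsPulse s D m P) {j : ℕ} (hj : j ≤ m + 2) (q : Δ.Vertex) :
    0 ≤ Δ.wave s j q := by
  cases j with
  | zero => rw [wave_zero]
  | succ j =>
    rw [← h.eq_wave j q (Or.inl (by omega))]
    exact Int.natCast_nonneg _

/-- If the wave vanished at `j`, its values just before and just after would be opposite and both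
non-negative, hence zero; two consecutive zeros kill the whole wave. -/
lemma exists_wave_ne_zero (h : Δ.IsPulse s D m P) {j : ℕ} (h1 : 1 ≤ j) (hj : j ≤ m + 1) :
    ∃ q, Δ.wave s j q ≠ 0 := by
  by_contra! hc
  obtain ⟨j, rfl⟩ : ∃ i, j = i + 1 := ⟨j - 1, by omega⟩
  refine not_forall_wave_eq_zero s (eq_zero_of_consecutive_zeros (wave_add_two s) (N := j) ?_ hc)
  intro q
  have h2 := wave_add_two s j q
  rw [nbrSum_zero fun a _ => hc a] at h2
  have h3 := h.wave_nonneg (j := j) (by omega) q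
  have h4 := h.wave_nonneg (j := j + 2) (by omega) q
  omega

end IsPulse

lemma eq_const_of_closed {Δ : Dynkin} {S : Δ.Vertex → Prop} {s : Δ.Vertex} (hs : S s)
    (hS : ∀ a b, Δ.Adj a b → S a → S b) (b : Δ.Vertex) : S b := by
  induction hn : Δ.dist s b generalizing b with
  | zero => exact eq_of_dist_eq_zero hn ▸ hs
  | succ n ih =>
    have hne : s ≠ b := by
      rintro rfl
      rw [dist_self] at hn
      omega
    obtain ⟨c, hc, hd⟩ := exists_closer hne
    exact hS c b hc.symm (ih c (by omega))

lemma nbrSum_eq_zero_iff {Δ : Dynkin} {f : Δ.Vertex → ℤ} {q : Δ.Vertex}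
    (hf : ∀ a, Δ.Adj q a → 0 ≤ f a) (h : Δ.nbrSum f q = 0) : ∀ a, Δ.Adj q a → f a = 0 := by
  unfold nbrSum at h
  rw [Finset.sum_eq_zero_iff_of_nonneg] at h
  · intro a ha
    simpa [ha] using h a (Finset.mem_univ a)
  · intro a _
    split_ifs with ha
    · exact hf a ha
    · rfl

/-- The times of the pulses do not depend on the starting vertex. -/
lemma pulse_time_eq {Δ : Dynkin} {D : Δ.Vertex → ℕ → Δ.Vertex → ℕ} {m : Δ.Vertex → ℕ}
    {P : Δ.Vertex → Δ.Vertex → Prop} [∀ s, DecidablePred (P s)]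
    (h : ∀ s, Δ.IsPulse s (D s) (m s) (P s)) (s s' : Δ.Vertex) : m s = m s' := by
  obtain ⟨r, hr⟩ : ∃ r, ∀ s, m r ≤ m s := by
    have : Nonempty Δ.Vertex := ⟨s⟩
    exact Finite.exists_min m
  have key : ∀ s, m s = m r := by
    refine eq_const_of_closed (s := r) rfl fun a b hab ha => ?_
    -- By commutation the waves from all neighbours of `a` add up to zero at time `m a + 2`. As `m
    -- a` is minimal, they are still non-negative then, so each one vanishes.
    have h0 : ∀ t, Δ.wave b (m a + 2) t = 0 := by
      intro t
      refine nbrSum_eq_zero_iff (f := fun s' => Δ.wave s' (m a + 2) t) (q := a) ?_ ?_ b hab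
      · intro s' _
        have := hr s'
        exact (h s').wave_nonneg (by omega) t
      · rw [nbrSum_wave_comm, nbrSum_zero fun q _ => (h a).wave_eq_zero q]
    by_contra hne
    have := hr b
    obtain ⟨t, ht⟩ := (h b).exists_wave_ne_zero (j := m a + 2) (by omega) (by omega)
    exact ht (h0 t)
  rw [key s, key s']

/-- The Coxeter number. -/
def coxeterNumber : Dynkin → ℕ
  | A n _ => n + 1
  | D n _ => 2 * n - 2
  | E6 => 12
  | E7 => 18
  | E8 => 30

/-- The vertex with label `1`. -/
def firstVertex (Δ : Dynkin) : Δ.Vertex :=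
  ⟨1, le_rfl, by cases Δ <;> simp only [rank] <;> omega⟩

lemma sum_vertex {Δ : Dynkin} (f : ℕ → ℤ) : ∑ a : Δ.Vertex, f a.1 = ∑ a ∈ Finset.Icc 1 Δ.rank, f a :=
  (Finset.sum_subtype _ (fun _ => Finset.mem_Icc) f).symm

lemma nbrSum_indicator {Δ : Dynkin} (j : ℕ) (q : Δ.Vertex) :
    Δ.nbrSum (fun b => if b.1 = j then (1 : ℤ) else 0) q =
      if (1 ≤ j ∧ j ≤ Δ.rank) ∧ (Δ.ArrowLabel q.1 j ∨ Δ.ArrowLabel j q.1) then 1 else 0 := by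
  by_cases hj : 1 ≤ j ∧ j ≤ Δ.rank
  · have e : (fun b : Δ.Vertex => if b.1 = j then (1 : ℤ) else 0) =
        fun b => if b = ⟨j, hj⟩ then 1 else 0 :=
      funext fun b => if_congr (Subtype.ext_iff (a2 := ⟨j, hj⟩)).symm rfl rfl
    rw [e, nbrSum_single]
    exact if_congr ⟨fun h => ⟨hj, h⟩, fun h => h.2⟩ rfl rfl
  · rw [if_neg fun h => hj h.1]
    refine nbrSum_zero fun a _ => if_neg ?_
    rintro rfl
    exact hj a.2

lemma wave_A {n : ℕ} (hn : 1 ≤ n) (j : ℕ) (hj : j ≤ n + 1) (q : (A n hn).Vertex) :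
    (A n hn).wave (A n hn).firstVertex j q = if q.1 = j then 1 else 0 := by
  induction j using Nat.strong_induction_on generalizing q with
  | _ j ih =>
    have hq := q.2
    simp only [rank] at hq
    match j with
    | 0 => rw [wave_zero, if_neg (by omega)]
    | 1 => rw [wave_one]; exact if_congr Subtype.ext_iff rfl rfl
    | j + 2 =>
      rw [wave_add_two, ih j (by omega) (by omega)]
      have e : (A n hn).wave (A n hn).firstVertex (j + 1) =
          fun b => if b.1 = j + 1 then (1 : ℤ) else 0 :=
        funext fun b => ih (j + 1) (by omega) (by omega) b
      rw [e, nbrSum_indicator]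
      simp only [rank, ArrowLabel]
      split_ifs <;> omega

/-- The wave runs from vertex 1 to the fork and back. The `t`s are its positions at three
consecutive times; the `u`s are the extra position `n`, occupied only at time `n - 1`, with the
non-label 0 meaning "absent". Naming the positions and splitting by the place of `j` relative to the
fork keeps each case linear. -/
lemma wave_D_step {n j q t₀ t₁ t₂ u₀ u₁ u₂ : ℕ} (hn : 4 ≤ n) (hj : j + 2 ≤ 2 * n - 2)
    (hq : 1 ≤ q ∧ q ≤ n)
    (h₀ : j ≤ n - 1 → t₀ = j) (h₀' : ¬ j ≤ n - 1 → t₀ = 2 * n - 2 - j)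
    (h₁ : j + 1 ≤ n - 1 → t₁ = j + 1) (h₁' : ¬ j + 1 ≤ n - 1 → t₁ = 2 * n - 2 - (j + 1))
    (h₂ : j + 2 ≤ n - 1 → t₂ = j + 2) (h₂' : ¬ j + 2 ≤ n - 1 → t₂ = 2 * n - 2 - (j + 2))
    (g₀ : j = n - 1 → u₀ = n) (g₀' : ¬ j = n - 1 → u₀ = 0)
    (g₁ : j + 1 = n - 1 → u₁ = n) (g₁' : ¬ j + 1 = n - 1 → u₁ = 0)
    (g₂ : j + 2 = n - 1 → u₂ = n) (g₂' : ¬ j + 2 = n - 1 → u₂ = 0)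
    {p₁ p₂ : Prop} [Decidable p₁] [Decidable p₂]
    (hp₁ : p₁ ↔ (1 ≤ t₁ ∧ t₁ ≤ n) ∧ ((t₁ = q + 1 ∧ t₁ ≤ n - 2 ∨ (q = n - 1 ∨ q = n) ∧ t₁ = n - 2) ∨
        q = t₁ + 1 ∧ q ≤ n - 2 ∨ (t₁ = n - 1 ∨ t₁ = n) ∧ q = n - 2))
    (hp₂ : p₂ ↔ (1 ≤ u₁ ∧ u₁ ≤ n) ∧ ((u₁ = q + 1 ∧ u₁ ≤ n - 2 ∨ (q = n - 1 ∨ q = n) ∧ u₁ = n - 2) ∨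
        q = u₁ + 1 ∧ q ≤ n - 2 ∨ (u₁ = n - 1 ∨ u₁ = n) ∧ q = n - 2)) :
    ((if p₁ then (1 : ℤ) else 0) + if p₂ then 1 else 0) -
      ((if q = t₀ then 1 else 0) + if q = u₀ then 1 else 0) =
    (if q = t₂ then 1 else 0) + if q = u₂ then 1 else 0 := by
  obtain h | h | h | h | h : j + 2 < n - 1 ∨ j + 2 = n - 1 ∨ j + 1 = n - 1 ∨ j = n - 1 ∨
    n - 1 < j := by
      clear hp₁ hp₂ h₀ h₁ h₂ g₀ g₁ g₂ h₀' h₁' h₂' g₀' g₁' g₂'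
      omega
  · obtain ⟨e₀, e₁, e₂, e₃, e₄, e₅⟩ :
        t₀ = j ∧ t₁ = j + 1 ∧ t₂ = j + 2 ∧ u₀ = 0 ∧ u₁ = 0 ∧ u₂ = 0 := by
      clear hp₁ hp₂
      refine ⟨?_, ?_, ?_, ?_, ?_, ?_⟩ <;> omega
    clear h₀ h₁ h₂ g₀ g₁ g₂ h₀' h₁' h₂' g₀' g₁' g₂'
    rw [if_congr (hp₁.trans (c := q = j ∨ q = j + 2) ?_) rfl rfl,
      if_congr (hp₂.trans (c := q = 0) ?_) rfl rfl] <;> clear hp₁ hp₂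
    · split_ifs <;> omega
    · omega
    · omega
  · obtain ⟨e₀, e₁, e₂, e₃, e₄, e₅⟩ :
        t₀ = j ∧ t₁ = j + 1 ∧ t₂ = j + 2 ∧ u₀ = 0 ∧ u₁ = 0 ∧ u₂ = n := by
      clear hp₁ hp₂
      refine ⟨?_, ?_, ?_, ?_, ?_, ?_⟩ <;> omega
    clear h₀ h₁ h₂ g₀ g₁ g₂ h₀' h₁' h₂' g₀' g₁' g₂'
    rw [if_congr (hp₁.trans (c := q = j ∨ q = j + 2 ∨ q = n) ?_) rfl rfl,
      if_congr (hp₂.trans (c := q = 0) ?_) rfl rfl] <;> clear hp₁ hp₂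
    · split_ifs <;> omega
    · omega
    · omega
  · obtain ⟨e₀, e₁, e₂, e₃, e₄, e₅⟩ :
        t₀ = j ∧ t₁ = j + 1 ∧ t₂ = j ∧ u₀ = 0 ∧ u₁ = n ∧ u₂ = 0 := by
      clear hp₁ hp₂
      refine ⟨?_, ?_, ?_, ?_, ?_, ?_⟩ <;> omega
    clear h₀ h₁ h₂ g₀ g₁ g₂ h₀' h₁' h₂' g₀' g₁' g₂'
    rw [if_congr (hp₁.trans (c := q = j) ?_) rfl rfl,
      if_congr (hp₂.trans (c := q = j) ?_) rfl rfl] <;> clear hp₁ hp₂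
    · split_ifs <;> omega
    · omega
    · omega
  · obtain ⟨e₀, e₁, e₂, e₃, e₄, e₅⟩ :
        t₀ = j ∧ t₁ + 1 = j ∧ t₂ + 2 = j ∧ u₀ = n ∧ u₁ = 0 ∧ u₂ = 0 := by
      clear hp₁ hp₂
      refine ⟨?_, ?_, ?_, ?_, ?_, ?_⟩ <;> omega
    clear h₀ h₁ h₂ g₀ g₁ g₂ h₀' h₁' h₂' g₀' g₁' g₂'
    rw [if_congr (hp₁.trans (c := q = t₂ ∨ q = j ∨ q = n) ?_) rfl rfl,
      if_congr (hp₂.trans (c := q = 0) ?_) rfl rfl] <;> clear hp₁ hp₂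
    · split_ifs <;> omega
    · omega
    · omega
  · obtain ⟨e₀, e₁, e₂, e₃, e₄, e₅⟩ :
        t₀ = 2 * n - 2 - j ∧ t₁ + 1 = t₀ ∧ t₂ + 2 = t₀ ∧ u₀ = 0 ∧ u₁ = 0 ∧ u₂ = 0 := by
      clear hp₁ hp₂
      refine ⟨?_, ?_, ?_, ?_, ?_, ?_⟩ <;> omega
    clear h₀ h₁ h₂ g₀ g₁ g₂ h₀' h₁' h₂' g₀' g₁' g₂'
    rw [if_congr (hp₁.trans (c := q = t₂ ∨ q = t₀) ?_) rfl rfl,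
      if_congr (hp₂.trans (c := q = 0) ?_) rfl rfl] <;> clear hp₁ hp₂
    · split_ifs <;> omega
    · omega
    · omega

lemma wave_D {n : ℕ} (hn : 4 ≤ n) (j : ℕ) (hj : j ≤ 2 * n - 2) (q : (D n hn).Vertex) :
    (D n hn).wave (D n hn).firstVertex j q =
      (if q.1 = (if j ≤ n - 1 then j else 2 * n - 2 - j) then 1 else 0) +
        if q.1 = (if j = n - 1 then n else 0) then 1 else 0 := by
  induction j using Nat.strong_induction_on generalizing q with
  | _ j ih =>
    have hq := q.2
    simp only [rank] at hq
    match j with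
    | 0 =>
      rw [wave_zero]
      split_ifs <;> omega
    | 1 =>
      rw [wave_one, if_congr (Subtype.ext_iff (a2 := (D n hn).firstVertex)) rfl rfl]
      change (if q.1 = 1 then (1 : ℤ) else 0) = _
      split_ifs <;> omega
    | j + 2 =>
      rw [wave_add_two, ih j (by omega) (by omega)]
      have e : (D n hn).wave (D n hn).firstVertex (j + 1) = fun b =>
          (if b.1 = (if j + 1 ≤ n - 1 then j + 1 else 2 * n - 2 - (j + 1)) then (1 : ℤ) else 0) +
            if b.1 = (if j + 1 = n - 1 then n else 0) then 1 else 0 :=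
        funext fun b => ih (j + 1) (by omega) (by omega) b
      rw [e, nbrSum_add, nbrSum_indicator, nbrSum_indicator]
      simp only [rank, ArrowLabel]
      exact wave_D_step hn hj hq (fun h => if_pos h) (fun h => if_neg h) (fun h => if_pos h)
        (fun h => if_neg h) (fun h => if_pos h) (fun h => if_neg h) (fun h => if_pos h)
        (fun h => if_neg h) (fun h => if_pos h) (fun h => if_neg h) (fun h => if_pos h)
        (fun h => if_neg h) Iff.rfl Iff.rfl

/-! ## Waves of the exceptional diagrams -/

/-- One step of the recursion of waves, for functions given by the lists of their values. -/
def stepList (Δ : Dynkin) (u v : List ℤ) : List ℤ :=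
  (List.range Δ.rank).map fun i =>
    (((List.range Δ.rank).filter fun j =>
      decide (Δ.ArrowLabel (i + 1) (j + 1) ∨ Δ.ArrowLabel (j + 1) (i + 1))).map
        fun j => v.getD j 0).sum - u.getD i 0

/-- The lists of the values of `wave s n` and `wave s (n + 1)`. -/
def waveList (Δ : Dynkin) (s : ℕ) : ℕ → List ℤ × List ℤ
  | 0 => (List.replicate Δ.rank 0, (List.range Δ.rank).map fun i => if i + 1 = s then 1 else 0)
  | n + 1 => ((Δ.waveList s n).2, Δ.stepList (Δ.waveList s n).1 (Δ.waveList s n).2)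

lemma nbrSum_label {Δ : Dynkin} (f : ℕ → ℤ) (q : Δ.Vertex) :
    Δ.nbrSum (fun a => f (a.1 - 1)) q = (((List.range Δ.rank).filter fun j =>
      decide (Δ.ArrowLabel q.1 (j + 1) ∨ Δ.ArrowLabel (j + 1) q.1)).map f).sum := by
  have h1 : Δ.nbrSum (fun a => f (a.1 - 1)) q = ∑ a ∈ Finset.Icc 1 Δ.rank,
      if Δ.ArrowLabel q.1 a ∨ Δ.ArrowLabel a q.1 then f (a - 1) else 0 :=
    sum_vertex fun a => if Δ.ArrowLabel q.1 a ∨ Δ.ArrowLabel a q.1 then f (a - 1) else 0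
  have h2 : ∀ (l : List ℕ) (p : ℕ → Prop) [DecidablePred p],
      ((l.filter fun j => decide (p j)).map f).sum = (l.map fun j => if p j then f j else 0).sum := by
    intro l p _
    induction l with
    | nil => rfl
    | cons a l ih =>
      by_cases ha : p a <;> simp [ha, ih]
  rw [h1, h2]
  change _ = ∑ j ∈ Finset.range Δ.rank,
    if Δ.ArrowLabel q.1 (j + 1) ∨ Δ.ArrowLabel (j + 1) q.1 then f j else 0
  rw [Finset.range_eq_Ico]
  exact (Finset.sum_Ico_add' (fun a =>
    if Δ.ArrowLabel q.1 a ∨ Δ.ArrowLabel a q.1 then f (a - 1) else 0) 0 Δ.rank 1).symm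

lemma getD_map_range (f : ℕ → ℤ) {n i : ℕ} (h : i < n) :
    ((List.range n).map f).getD i 0 = f i := by
  simp [List.getD, h]

lemma wave_eq_getD {Δ : Dynkin} (s : Δ.Vertex) (n : ℕ) :
    (∀ q : Δ.Vertex, Δ.wave s n q = (Δ.waveList s.1 n).1.getD (q.1 - 1) 0) ∧
      ∀ q : Δ.Vertex, Δ.wave s (n + 1) q = (Δ.waveList s.1 n).2.getD (q.1 - 1) 0 := by
  induction n with
  | zero =>
    refine ⟨fun q => ?_, fun q => ?_⟩
    · have := q.2
      rw [wave_zero, waveList]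
      exact (List.getD_replicate (x := (0 : ℤ)) (y := 0) (by omega)).symm
    · have := q.2
      rw [wave_one, waveList]
      dsimp only
      rw [getD_map_range _ (by omega), if_congr Subtype.ext_iff rfl rfl]
      refine if_congr ?_ rfl rfl
      omega
  | succ n ih =>
    refine ⟨ih.2, fun q => ?_⟩
    have := q.2
    rw [wave_add_two, waveList, ih.1, funext ih.2, nbrSum_label fun j => (Δ.waveList s.1 n).2.getD j 0]
    dsimp only
    rw [stepList, getD_map_range _ (by omega), Nat.sub_add_cancel q.2.1]

/-- The lists of values of the waves have the properties expected from the Coxeter number and the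
Nakayama permutation. -/
def WaveListsGood (Δ : Dynkin) : Prop :=
  (∀ j ∈ Finset.range (Δ.coxeterNumber + 1), ∀ x ∈ (Δ.waveList 1 j).1, 0 ≤ x) ∧
  (Δ.waveList 1 Δ.coxeterNumber).1 = (List.range Δ.rank).map (fun _ => 0) ∧
  ∀ s ∈ Finset.Icc 1 Δ.rank, (Δ.waveList s (Δ.coxeterNumber - 1)).1 =
    (List.range Δ.rank).map fun i => if i + 1 = Δ.nakayamaLabel s then (1 : ℤ) else 0

lemma waveListsGood_exceptional :
    E6.WaveListsGood ∧ E7.WaveListsGood ∧ E8.WaveListsGood := by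
  unfold WaveListsGood
  decide +kernel

lemma WaveListsGood.nonneg {Δ : Dynkin} (h : Δ.WaveListsGood) {j : ℕ} (hj : j ≤ Δ.coxeterNumber)
    (q : Δ.Vertex) : 0 ≤ Δ.wave Δ.firstVertex j q := by
  rw [(wave_eq_getD _ j).1]
  have h1 := h.1 j (Finset.mem_range.2 (by omega))
  rw [List.getD_eq_getElem?_getD]
  cases hx : (Δ.waveList Δ.firstVertex.1 j).1[q.1 - 1]? with
  | none => simp
  | some x => exact h1 x (List.mem_of_getElem? hx)

lemma WaveListsGood.eq_zero {Δ : Dynkin} (h : Δ.WaveListsGood) (q : Δ.Vertex) :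
    Δ.wave Δ.firstVertex Δ.coxeterNumber q = 0 := by
  have := q.2
  rw [(wave_eq_getD _ _).1]
  change (Δ.waveList 1 Δ.coxeterNumber).1.getD _ _ = _
  rw [h.2.1, getD_map_range _ (by omega)]

lemma WaveListsGood.top {Δ : Dynkin} (h : Δ.WaveListsGood) (s q : Δ.Vertex) :
    Δ.wave s (Δ.coxeterNumber - 1) q = if q = Δ.nakayamaVertex s then 1 else 0 := by
  have := q.2
  rw [(wave_eq_getD _ _).1, h.2.2 s.1 (Finset.mem_Icc.2 s.2), getD_map_range _ (by omega),
    Nat.sub_add_cancel q.2.1, if_congr Subtype.ext_iff rfl rfl]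
  rfl

/-! ## The final pulse -/

lemma wave_firstVertex_nonneg {Δ : Dynkin} {j : ℕ} (hj : j ≤ Δ.coxeterNumber) (q : Δ.Vertex) :
    0 ≤ Δ.wave Δ.firstVertex j q := by
  cases Δ with
  | A n hn =>
    rw [wave_A hn j hj]
    split_ifs <;> omega
  | D n hn =>
    rw [wave_D hn j hj]
    split_ifs <;> omega
  | E6 => exact waveListsGood_exceptional.1.nonneg hj q
  | E7 => exact waveListsGood_exceptional.2.1.nonneg hj q
  | E8 => exact waveListsGood_exceptional.2.2.nonneg hj q

lemma wave_firstVertex_coxeterNumber {Δ : Dynkin} (q : Δ.Vertex) :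
    Δ.wave Δ.firstVertex Δ.coxeterNumber q = 0 := by
  have hq := q.2
  cases Δ with
  | A n hn =>
    simp only [rank] at hq
    rw [wave_A hn (A n hn).coxeterNumber le_rfl, if_neg]
    simp only [coxeterNumber]
    omega
  | D n hn =>
    simp only [rank] at hq
    rw [wave_D hn (D n hn).coxeterNumber le_rfl]
    simp only [coxeterNumber, show ¬ (2 * n - 2 ≤ n - 1) by omega,
      show ¬ (2 * n - 2 = n - 1) by omega, if_false]
    rw [if_neg (by omega), if_neg (by omega)]
    rfl
  | E6 => exact waveListsGood_exceptional.1.eq_zero q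
  | E7 => exact waveListsGood_exceptional.2.1.eq_zero q
  | E8 => exact waveListsGood_exceptional.2.2.eq_zero q

lemma two_le_coxeterNumber (Δ : Dynkin) : 2 ≤ Δ.coxeterNumber := by
  cases Δ <;> simp only [coxeterNumber] <;> omega

/-- The pulse makes the wave nonzero at times 1 to `m + 1` and gives it a value -1 at time `m + 3`.
The explicit wave is zero at the Coxeter number and non-negative up to it, so only `m + 2` is
possible. -/
lemma coxeterNumber_eq {Δ : Dynkin} {D : ℕ → Δ.Vertex → ℕ} {m : ℕ} {P : Δ.Vertex → Prop}
    [DecidablePred P] (h : Δ.IsPulse Δ.firstVertex D m P) : Δ.coxeterNumber = m + 2 := by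
  have h2 := two_le_coxeterNumber Δ
  rcases lt_trichotomy Δ.coxeterNumber (m + 2) with hlt | heq | hgt
  · obtain ⟨q, hq⟩ := h.exists_wave_ne_zero (j := Δ.coxeterNumber) (by omega) (by omega)
    exact (hq (wave_firstVertex_coxeterNumber q)).elim
  · exact heq
  · obtain ⟨t, ht⟩ := h.exists_pulse
    have h1 := h.wave_add_wave ht 1 t
    rw [wave_one, if_pos rfl] at h1
    have h3 := wave_firstVertex_nonneg (Δ := Δ) (j := m + 2 + 1) (by omega) t
    omega

/-! ## The position of the final pulse -/

section Top

variable {Δ : Dynkin} {j : ℕ} {t : Δ.Vertex → Δ.Vertex}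

/-- Commutation with the adjacency matrix, specialized to a time when all waves are indicators: it
forces `t` to respect edges and to be injective on neighbours, almost determining it from one value.
-/
lemma nbrSum_top (ht : ∀ s q, Δ.wave s j q = if q = t s then 1 else 0) (s a : Δ.Vertex) :
    Δ.nbrSum (fun s' => if a = t s' then (1 : ℤ) else 0) s = if Δ.Adj a (t s) then 1 else 0 := by
  have h1 := nbrSum_wave_comm s j a
  have e : Δ.wave s j = fun q => if q = t s then (1 : ℤ) else 0 := funext (ht s)
  rw [e, nbrSum_single] at h1
  rw [← h1]
  congr 1
  exact funext fun s' => (ht s' a).symm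

lemma adj_top (ht : ∀ s q, Δ.wave s j q = if q = t s then 1 else 0) {s s' : Δ.Vertex}
    (h : Δ.Adj s s') : Δ.Adj (t s) (t s') := by
  have h1 := nbrSum_top ht s (t s')
  by_contra hc
  rw [if_neg fun h => hc h.symm] at h1
  have := nbrSum_eq_zero_iff (fun a _ => by split_ifs <;> omega) h1 s' h
  simp at this

lemma top_injective_on_neighbours (ht : ∀ s q, Δ.wave s j q = if q = t s then 1 else 0)
    {s a b : Δ.Vertex} (ha : Δ.Adj s a) (hb : Δ.Adj s b) (h : t a = t b) : a = b := by
  by_contra hne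
  have h1 := nbrSum_top ht s (t a)
  have h2 : ∑ c ∈ {a, b}, (if Δ.Adj s c then (if t a = t c then (1 : ℤ) else 0) else 0) ≤
      Δ.nbrSum (fun s' => if t a = t s' then (1 : ℤ) else 0) s :=
    Finset.sum_le_sum_of_subset_of_nonneg (Finset.subset_univ _) fun c _ _ => by
      split_ifs <;> omega
  rw [Finset.sum_pair hne, if_pos ha, if_pos hb, if_pos rfl, if_pos h, h1] at h2
  split_ifs at h2 <;> omega

end Top

lemma adj_A {n : ℕ} {hn : 1 ≤ n} {a b : (A n hn).Vertex} :
    (A n hn).Adj a b ↔ b.1 = a.1 + 1 ∨ a.1 = b.1 + 1 := Iff.rfl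

lemma adj_D {n : ℕ} {hn : 4 ≤ n} {a b : (D n hn).Vertex} : (D n hn).Adj a b ↔
    ((b.1 = a.1 + 1 ∧ b.1 ≤ n - 2) ∨ ((a.1 = n - 1 ∨ a.1 = n) ∧ b.1 = n - 2)) ∨
      ((a.1 = b.1 + 1 ∧ a.1 ≤ n - 2) ∨ ((b.1 = n - 1 ∨ b.1 = n) ∧ a.1 = n - 2)) := Iff.rfl

/-- The explicit wave sends vertex 1 to `n`; adjacency and injectivity on neighbours then force each
next step along the line. -/
lemma top_A {n : ℕ} {hn : 1 ≤ n} {t : (A n hn).Vertex → (A n hn).Vertex}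
    (ht : ∀ s q, (A n hn).wave s n q = if q = t s then 1 else 0) (s : (A n hn).Vertex) :
    (t s).1 = n + 1 - s.1 := by
  have hv : ∀ q : (A n hn).Vertex, 1 ≤ q.1 ∧ q.1 ≤ n := fun q => q.2
  induction hi : s.1 using Nat.strong_induction_on generalizing s with
  | _ i ih =>
    have hs := hv s
    match i with
    | 0 => omega
    | 1 =>
      have h0 : s = (A n hn).firstVertex := Subtype.ext hi
      have h1 := ht s (t s)
      rw [if_pos rfl, h0, wave_A hn n (by omega)] at h1
      rw [h0]
      split_ifs at h1 <;> omega
    | i + 2 =>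
      obtain ⟨s₁, hs₁⟩ : ∃ s₁ : (A n hn).Vertex, s₁.1 = i + 1 :=
        ⟨⟨i + 1, by omega, by simp only [rank]; omega⟩, rfl⟩
      have e₁ := ih (i + 1) (by omega) s₁ hs₁
      have h1 := adj_A.1 (adj_top ht (s := s₁) (s' := s) (adj_A.2 (by omega)))
      have h2 := hv (t s)
      rcases Nat.eq_zero_or_pos i with rfl | hpos
      · omega
      · obtain ⟨s₀, hs₀⟩ : ∃ s₀ : (A n hn).Vertex, s₀.1 = i :=
          ⟨⟨i, by omega, by simp only [rank]; omega⟩, rfl⟩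
        have e₀ := ih i (by omega) s₀ hs₀
        have h3 : (t s₀).1 ≠ (t s).1 := fun h => by
          have := top_injective_on_neighbours ht (s := s₁) (a := s₀) (b := s)
            (adj_A.2 (by omega)) (adj_A.2 (by omega)) (Subtype.ext h)
          rw [this] at hs₀
          omega
        omega

lemma top_D_of_le {n : ℕ} {hn : 4 ≤ n} {t : (D n hn).Vertex → (D n hn).Vertex}
    (ht : ∀ s q, (D n hn).wave s (2 * n - 3) q = if q = t s then 1 else 0) (s : (D n hn).Vertex)
    (hle : s.1 ≤ n - 2) : (t s).1 = s.1 := by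
  have hv : ∀ q : (D n hn).Vertex, 1 ≤ q.1 ∧ q.1 ≤ n := fun q => q.2
  induction hi : s.1 using Nat.strong_induction_on generalizing s with
  | _ i ih =>
    have hs := hv s
    match i with
    | 0 => omega
    | 1 =>
      have h0 : s = (D n hn).firstVertex := Subtype.ext hi
      have h1 := ht s (t s)
      have h2 := hv (t (D n hn).firstVertex)
      rw [if_pos rfl, h0, wave_D hn (2 * n - 3) (by omega)] at h1
      rw [h0]
      simp only [show ¬ (2 * n - 3 ≤ n - 1) by omega, show ¬ (2 * n - 3 = n - 1) by omega,
        if_false] at h1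
      split_ifs at h1 <;> omega
    | i + 2 =>
      obtain ⟨s₁, hs₁⟩ : ∃ s₁ : (D n hn).Vertex, s₁.1 = i + 1 :=
        ⟨⟨i + 1, by omega, by simp only [rank]; omega⟩, rfl⟩
      have e₁ := ih (i + 1) (by omega) s₁ (by omega) hs₁
      have h1 := adj_D.1 (adj_top ht (s := s₁) (s' := s) (adj_D.2 (by omega)))
      have h2 := hv (t s)
      rcases Nat.eq_zero_or_pos i with rfl | hpos
      · omega
      · obtain ⟨s₀, hs₀⟩ : ∃ s₀ : (D n hn).Vertex, s₀.1 = i :=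
          ⟨⟨i, by omega, by simp only [rank]; omega⟩, rfl⟩
        have e₀ := ih i (by omega) s₀ (by omega) hs₀
        have h3 : (t s₀).1 ≠ (t s).1 := fun h => by
          have := top_injective_on_neighbours ht (s := s₁) (a := s₀) (b := s)
            (adj_D.2 (by omega)) (adj_D.2 (by omega)) (Subtype.ext h)
          rw [this] at hs₀
          omega
        omega

/-- The difference of the waves from the two ends of the fork alternates. -/
lemma wave_D_sub {n : ℕ} {hn : 4 ≤ n} {a b : (D n hn).Vertex} (ha : a.1 = n - 1) (hb : b.1 = n)
    (i : ℕ) (q : (D n hn).Vertex) :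
    (D n hn).wave a (2 * i) q = (D n hn).wave b (2 * i) q ∧
      (D n hn).wave a (2 * i + 1) q - (D n hn).wave b (2 * i + 1) q =
        (-1) ^ i * ((if q = a then 1 else 0) - if q = b then 1 else 0) := by
  have hne : a ≠ b := by
    rintro rfl
    omega
  induction i generalizing q with
  | zero =>
    rw [mul_zero, zero_add, wave_zero, wave_zero, wave_one, wave_one]
    simp
  | succ i ih =>
    have h1 : ∀ q, (D n hn).wave a (2 * i + 2) q = (D n hn).wave b (2 * i + 2) q := by
      intro q
      rw [← sub_eq_zero, wave_add_two, wave_add_two, (ih q).1, sub_sub_sub_cancel_right,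
        ← nbrSum_sub, funext fun q => (ih q).2]
      have e : (D n hn).nbrSum (fun q => (-1 : ℤ) ^ i *
          ((if q = a then 1 else 0) - if q = b then 1 else 0)) q = (-1) ^ i *
          (D n hn).nbrSum (fun q => (if q = a then (1 : ℤ) else 0) - if q = b then 1 else 0) q := by
        unfold nbrSum
        rw [Finset.mul_sum]
        exact Finset.sum_congr rfl fun c _ => by split_ifs <;> simp
      rw [e, nbrSum_sub, nbrSum_single, nbrSum_single,
        if_congr (show (D n hn).Adj q a ↔ (D n hn).Adj q b by
          have := q.2
          simp only [rank] at this
          rw [adj_D, adj_D]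
          omega) rfl rfl, sub_self, mul_zero]
    refine ⟨h1 q, ?_⟩
    rw [show 2 * (i + 1) + 1 = 2 * i + 1 + 2 by ring, wave_add_two, wave_add_two,
      funext (fun q => h1 q : ∀ q, (D n hn).wave a (2 * i + 1 + 1) q =
        (D n hn).wave b (2 * i + 1 + 1) q), sub_sub_sub_cancel_left, pow_succ, ← neg_sub, (ih q).2]
    ring

lemma top_D {n : ℕ} {hn : 4 ≤ n} {t : (D n hn).Vertex → (D n hn).Vertex}
    (ht : ∀ s q, (D n hn).wave s (2 * n - 3) q = if q = t s then 1 else 0) (s : (D n hn).Vertex) :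
    (t s).1 = (D n hn).nakayamaLabel s.1 := by
  have hs : 1 ≤ s.1 ∧ s.1 ≤ n := s.2
  obtain ⟨a, ha⟩ : ∃ a : (D n hn).Vertex, a.1 = n - 1 :=
    ⟨⟨n - 1, by omega, by simp only [rank]; omega⟩, rfl⟩
  obtain ⟨b, hb⟩ : ∃ b : (D n hn).Vertex, b.1 = n := ⟨⟨n, by omega, le_rfl⟩, rfl⟩
  have hne : a ≠ b := by
    rintro rfl
    omega
  have h1 := (wave_D_sub ha hb (n - 2) a).2
  have h2 := (wave_D_sub ha hb (n - 2) b).2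
  -- One less than the Coxeter number is the odd time with `i = n - 2`. The sign (-1)^(n-2) decides
  -- whether the two ends of the fork are fixed or exchanged.
  rw [show 2 * (n - 2) + 1 = 2 * n - 3 by omega, ht, ht] at h1 h2
  simp only [if_true, hne, hne.symm, if_false] at h1 h2
  by_cases hle : s.1 ≤ n - 2
  · rw [top_D_of_le ht s hle]
    simp only [nakayamaLabel]
    split_ifs <;> omega
  · have hsab : s = a ∨ s = b := by
      rcases (show s.1 = n - 1 ∨ s.1 = n by omega) with h | h
      · exact Or.inl (Subtype.ext (h.trans ha.symm))
      · exact Or.inr (Subtype.ext (h.trans hb.symm))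
    simp only [nakayamaLabel]
    by_cases he : Even n
    · have hp : (-1 : ℤ) ^ (n - 2) = 1 := Even.neg_one_pow (by
        obtain ⟨r, hr⟩ := he
        exact ⟨r - 1, by omega⟩)
      rw [hp] at h1 h2
      rw [if_pos he]
      have e1 : a = t a := by
        by_contra hc
        simp only [hc, if_false] at h1
        split_ifs at h1 <;> omega
      have e2 : b = t b := by
        by_contra hc
        simp only [hc, if_false] at h2
        split_ifs at h2 <;> omega
      rcases hsab with rfl | rfl
      · rw [← e1]
      · rw [← e2]
    · have hp : (-1 : ℤ) ^ (n - 2) = -1 := Odd.neg_one_pow (by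
        obtain ⟨r, hr⟩ := Nat.not_even_iff_odd.1 he
        exact ⟨r - 1, by omega⟩)
      rw [hp] at h1 h2
      rw [if_neg he]
      have e1 : a = t b := by
        by_contra hc
        simp only [hc, if_false] at h1
        split_ifs at h1 <;> omega
      have e2 : b = t a := by
        by_contra hc
        simp only [hc, if_false] at h2
        split_ifs at h2 <;> omega
      rcases hsab with rfl | rfl
      · rw [← e2, if_neg (by omega), if_pos ha, hb]
      · rw [← e1, if_pos hb, ha]

/-- The final pulse of a wave is at the position given by the Nakayama permutation. -/
lemma top_eq_nakayamaVertex {Δ : Dynkin} {t : Δ.Vertex → Δ.Vertex}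
    (ht : ∀ s q, Δ.wave s (Δ.coxeterNumber - 1) q = if q = t s then 1 else 0) (s : Δ.Vertex) :
    t s = Δ.nakayamaVertex s := by
  have key : Δ.WaveListsGood → t s = Δ.nakayamaVertex s := by
    intro h
    have h1 := ht s (t s)
    rw [if_pos rfl, h.top] at h1
    by_contra hc
    rw [if_neg hc] at h1
    omega
  cases Δ with
  | A n hn => exact Subtype.ext (top_A ht s)
  | D n hn =>
    exact Subtype.ext (top_D (fun s q => by
      rw [← ht, show (D n hn).coxeterNumber - 1 = 2 * n - 3 by
        simp only [coxeterNumber]; omega]) s)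
  | E6 => exact key waveListsGood_exceptional.1
  | E7 => exact key waveListsGood_exceptional.2.1
  | E8 => exact key waveListsGood_exceptional.2.2

/-! ## The functions `h_x` -/

/-- The shape of the waves: they are non-negative up to the Coxeter number, where they vanish,
and the last values form the indicator function of a vertex. -/
structure HasFiniteWaves (Δ : Dynkin) : Prop where
  nonneg : ∀ s j q, j ≤ Δ.coxeterNumber → 0 ≤ Δ.wave s j q
  vanish : ∀ s q, Δ.wave s Δ.coxeterNumber q = 0

section Pulse

variable {Δ : Dynkin} {D : Δ.Vertex → ℕ → Δ.Vertex → ℕ} {m : Δ.Vertex → ℕ}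
    {P : Δ.Vertex → Δ.Vertex → Prop} [∀ s, DecidablePred (P s)]

lemma coxeterNumber_eq_of_pulse (h : ∀ s, Δ.IsPulse s (D s) (m s) (P s)) (s : Δ.Vertex) :
    Δ.coxeterNumber = m s + 2 := by
  rw [pulse_time_eq h s Δ.firstVertex]
  exact coxeterNumber_eq (h Δ.firstVertex)

/-- Non-negativity is inherited from the natural-number values of `D`, so waves from arbitrary
vertices need not be computed. -/
lemma hasFiniteWaves_of_pulse (h : ∀ s, Δ.IsPulse s (D s) (m s) (P s)) : Δ.HasFiniteWaves where
  nonneg s j q hj := (h s).wave_nonneg (coxeterNumber_eq_of_pulse h s ▸ hj) q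
  vanish s q := by
    rw [coxeterNumber_eq_of_pulse h s]
    exact (h s).wave_eq_zero q

lemma pulse_at_nakayamaVertex (h : ∀ s, Δ.IsPulse s (D s) (m s) (P s)) (s : Δ.Vertex) :
    P s (Δ.nakayamaVertex s) := by
  choose t ht using fun s => (h s).exists_pulse
  have e := top_eq_nakayamaVertex (t := t) (fun s q => by
    rw [coxeterNumber_eq_of_pulse h s]
    exact (h s).wave_top (ht s) q) s
  exact e ▸ ht s

end Pulse

/-- Arrows change the level by one, and `f_x` vanishes one level below `x` and again at wave time
`coxeterNumber`; a walk through positive values cannot cross either level. -/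
lemma HasFiniteWaves.level_of_joined {Δ : Dynkin} (h : Δ.HasFiniteWaves) {x z : Δ.ZVertex}
    (hz : Δ.Joined {z | 0 < Δ.addFun x z} x z) :
    Δ.level x ≤ Δ.level z ∧ Δ.level z + 2 ≤ Δ.level x + Δ.coxeterNumber := by
  have h2 := two_le_coxeterNumber Δ
  induction hz with
  | refl => exact ⟨le_rfl, by omega⟩
  | @tail b c _ hbc ih =>
    have hc : 0 < Δ.addFun x c := hbc.2.1
    rw [addFun_eq] at hc
    have hl : Δ.level c = Δ.level b + 1 ∨ Δ.level b = Δ.level c + 1 :=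
      hbc.2.2.imp (fun h => (zArrow_iff.1 h).2) fun h => (zArrow_iff.1 h).2
    have h3 : Δ.level c - Δ.level x + 1 ≠ (0 : ℕ) := by
      intro h0
      rw [h0, waveZ_natCast, wave_zero] at hc
      omega
    have h4 : Δ.level c - Δ.level x + 1 ≠ Δ.coxeterNumber := by
      intro h0
      rw [h0, waveZ_natCast, h.vanish] at hc
      omega
    push_cast at h3
    omega

lemma addFun_eq_wave {Δ : Dynkin} {x z : Δ.ZVertex} {n : ℕ} (hn : Δ.level z = Δ.level x + n) :
    Δ.addFun x z = Δ.wave x.2 (n + 1) z.2 := by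
  rw [addFun_eq, ← waveZ_natCast]
  congr 1
  push_cast
  omega

/-- A positive value has a positive predecessor: otherwise the recursion would make it minus a
non-negative number. Going down level by level reaches `x`. -/
lemma HasFiniteWaves.joined {Δ : Dynkin} (h : Δ.HasFiniteWaves) {x : Δ.ZVertex} {n : ℕ}
    (hn : n + 2 ≤ Δ.coxeterNumber) {z : Δ.ZVertex} (hz : Δ.level z = Δ.level x + n)
    (hw : Δ.wave x.2 (n + 1) z.2 ≠ 0) : Δ.Joined {z | 0 < Δ.addFun x z} x z := by
  induction n generalizing z with
  | zero =>
    rw [wave_one] at hw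
    have hzx : z.2 = x.2 := by
      by_contra hc
      exact hw (if_neg hc)
    rw [eq_of_level hzx (by simpa using hz)]
    exact Relation.ReflTransGen.refl
  | succ n ih =>
    have hpos : 0 < Δ.wave x.2 (n + 2) z.2 :=
      lt_of_le_of_ne (h.nonneg _ _ _ (by omega)) (Ne.symm hw)
    obtain ⟨a, ha, hwa⟩ : ∃ a, Δ.Adj z.2 a ∧ Δ.wave x.2 (n + 1) a ≠ 0 := by
      by_contra! hc
      have h1 := wave_add_two x.2 n z.2
      rw [nbrSum_zero hc] at h1
      have h2 := h.nonneg x.2 n z.2 (by omega)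
      omega
    have hl : Δ.level (Δ.pred z a) = Δ.level x + n := by
      rw [level_pred z ha]
      push_cast at hz
      omega
    refine (ih (by omega) hl hwa).tail ⟨?_, ?_, Or.inl (pred_zArrow z ha)⟩
    · change 0 < Δ.addFun x _
      rw [addFun_eq_wave hl]
      exact lt_of_le_of_ne (h.nonneg _ _ _ (by omega)) (Ne.symm hwa)
    · change 0 < Δ.addFun x _
      rw [addFun_eq_wave hz]
      exact hpos

lemma HasFiniteWaves.hFun_eq_wave {Δ : Dynkin} (h : Δ.HasFiniteWaves) {x z : Δ.ZVertex} {n : ℕ}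
    (hn : n + 2 ≤ Δ.coxeterNumber) (hz : Δ.level z = Δ.level x + n) :
    Δ.hFun x z = Δ.wave x.2 (n + 1) z.2 := by
  unfold hFun
  split_ifs with hj
  · exact addFun_eq_wave hz
  · by_contra hc
    exact hj (h.joined hn hz (Ne.symm hc))

lemma HasFiniteWaves.hFun_eq_zero {Δ : Dynkin} (h : Δ.HasFiniteWaves) {x z : Δ.ZVertex}
    (hz : Δ.level z < Δ.level x ∨ Δ.level x + Δ.coxeterNumber < Δ.level z + 2) :
    Δ.hFun x z = 0 := by
  unfold hFun
  rw [if_neg]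
  intro hj
  have := h.level_of_joined hj
  omega

/-! ## Levels and the Nakayama permutation -/

lemma nakayamaVertex_adj_E6 :
    ∀ a b : E6.Vertex, E6.Adj a b → E6.Adj (E6.nakayamaVertex a) (E6.nakayamaVertex b) := by
  unfold nakayamaVertex
  decide +kernel

lemma Adj.nakayamaVertex {Δ : Dynkin} {a b : Δ.Vertex} (h : Δ.Adj a b) :
    Δ.Adj (Δ.nakayamaVertex a) (Δ.nakayamaVertex b) := by
  cases Δ with
  | A n hn =>
    obtain ⟨a, ha⟩ := a; obtain ⟨b, hb⟩ := b
    have ha' : 1 ≤ a ∧ a ≤ n := ha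
    have hb' : 1 ≤ b ∧ b ≤ n := hb
    simp only [Adj, Arrow, Dynkin.nakayamaVertex, rank, ArrowLabel, nakayamaLabel] at *
    omega
  | D n hn =>
    obtain ⟨a, ha⟩ := a; obtain ⟨b, hb⟩ := b
    have ha' : 1 ≤ a ∧ a ≤ n := ha
    have hb' : 1 ≤ b ∧ b ≤ n := hb
    simp only [Adj, Arrow, Dynkin.nakayamaVertex, rank, ArrowLabel, nakayamaLabel] at *
    split_ifs <;> omega
  | E6 => exact nakayamaVertex_adj_E6 a b h
  | E7 => exact h
  | E8 => exact h

lemma height_nakayamaLabel {Δ : Dynkin} {q : ℕ} (hq : 1 ≤ q ∧ q ≤ Δ.rank) :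
    2 * Δ.nakayamaAmount q + Δ.height (Δ.nakayamaLabel q) =
      Δ.height q + (Δ.coxeterNumber - 2 : ℕ) := by
  cases Δ <;> simp only [rank, height, nakayamaLabel, nakayamaAmount, coxeterNumber] at *
  case A => omega
  case D => split_ifs <;> omega
  case E6 => split_ifs <;> omega
  all_goals exact add_comm _ _

lemma level_nakayama (Δ : Dynkin) (z : Δ.ZVertex) :
    Δ.level (Δ.nakayama z) = Δ.level z + (Δ.coxeterNumber - 2 : ℕ) := by
  have := height_nakayamaLabel z.2.2
  change 2 * (z.1 + Δ.nakayamaAmount z.2.1) + Δ.height (Δ.nakayamaLabel z.2.1) = _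
  unfold level
  omega

lemma perm_apply_inv {α : Type*} (g : Equiv.Perm α) (x : α) : g (g⁻¹ x) = x :=
  g.apply_symm_apply x

lemma level_tau_inv (Δ : Dynkin) (z : Δ.ZVertex) : Δ.level (Δ.tau⁻¹ z) = Δ.level z + 2 := by
  have := Δ.level_tau (Δ.tau⁻¹ z)
  rw [perm_apply_inv] at this
  omega

lemma shift_snd (Δ : Dynkin) (z : Δ.ZVertex) : (Δ.shift z).2 = Δ.nakayamaVertex z.2 := rfl

lemma level_shift (Δ : Dynkin) (z : Δ.ZVertex) :
    Δ.level (Δ.shift z) = Δ.level z + Δ.coxeterNumber := by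
  have := two_le_coxeterNumber Δ
  rw [shift, Equiv.Perm.mul_apply, level_nakayama, level_tau_inv]
  omega

lemma adj_nakayama {Δ : Dynkin} {x y : Δ.ZVertex} (h : Δ.Adj x.2 y.2) :
    Δ.Adj (Δ.nakayama x).2 (Δ.nakayama y).2 := h.nakayamaVertex

/-- Permutations of `ℤΔ` which shift all levels by a constant and preserve adjacency of labels. -/
def translations (Δ : Dynkin) : Subgroup (Equiv.Perm Δ.ZVertex) where
  carrier := {g | (∃ c : ℤ, ∀ z, Δ.level (g z) = Δ.level z + c) ∧
    ∀ x y, Δ.Adj (g x).2 (g y).2 ↔ Δ.Adj x.2 y.2}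
  one_mem' := ⟨⟨0, fun z => by simp⟩, fun x y => Iff.rfl⟩
  mul_mem' := by
    rintro g g' ⟨⟨c, hc⟩, h⟩ ⟨⟨c', hc'⟩, h'⟩
    refine ⟨⟨c' + c, fun z => ?_⟩, fun x y => ?_⟩
    · rw [Equiv.Perm.mul_apply, hc, hc', add_assoc]
    · rw [Equiv.Perm.mul_apply, Equiv.Perm.mul_apply, h, h']
  inv_mem' := by
    rintro g ⟨⟨c, hc⟩, h⟩
    refine ⟨⟨-c, fun z => ?_⟩, fun x y => ?_⟩
    · have := hc (g⁻¹ z)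
      rw [perm_apply_inv] at this
      omega
    · rw [← h, perm_apply_inv, perm_apply_inv]

lemma zArrow_of_mem_translations {Δ : Dynkin} {g : Equiv.Perm Δ.ZVertex}
    (hg : g ∈ Δ.translations) {x y : Δ.ZVertex} : Δ.ZArrow (g x) (g y) ↔ Δ.ZArrow x y := by
  obtain ⟨⟨c, hc⟩, h⟩ := hg
  rw [zArrow_iff, zArrow_iff, h, hc, hc]
  exact and_congr_right fun _ => by omega

lemma nakayama_mem_translations (Δ : Dynkin) : Δ.nakayama ∈ Δ.translations := by
  refine ⟨⟨_, Δ.level_nakayama⟩, fun x y => ⟨fun h => ?_, adj_nakayama⟩⟩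
  have := h.nakayamaVertex
  change Δ.Adj (Δ.nakayamaVertex (Δ.nakayamaVertex x.2)) (Δ.nakayamaVertex (Δ.nakayamaVertex y.2))
    at this
  rwa [nakayamaVertex_invol, nakayamaVertex_invol] at this

lemma tau_mem_translations (Δ : Dynkin) : Δ.tau ∈ Δ.translations :=
  ⟨⟨-2, Δ.level_tau⟩, fun _ _ => Iff.rfl⟩

lemma shift_mem_translations (Δ : Dynkin) : Δ.shift ∈ Δ.translations :=
  mul_mem Δ.nakayama_mem_translations (inv_mem Δ.tau_mem_translations)

lemma nakayamaShift_mem_translations (Δ : Dynkin) (d : ℕ) :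
    Δ.nakayamaShift d ∈ Δ.translations :=
  mul_mem Δ.nakayama_mem_translations (pow_mem Δ.shift_mem_translations d)

lemma level_shift_pow (Δ : Dynkin) (d : ℕ) (z : Δ.ZVertex) :
    Δ.level ((Δ.shift ^ d) z) = Δ.level z + d * Δ.coxeterNumber := by
  induction d with
  | zero => simp
  | succ d ih =>
    rw [pow_succ', Equiv.Perm.mul_apply, level_shift, ih]
    push_cast
    ring

/-- The amount by which `𝕊[d]` raises the levels. -/
def period (Δ : Dynkin) (d : ℕ) : ℕ := Δ.coxeterNumber - 2 + d * Δ.coxeterNumber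

lemma period_pos (Δ : Dynkin) {d : ℕ} (hd : 1 ≤ d) : 0 < Δ.period d := by
  have := two_le_coxeterNumber Δ
  have : 1 * Δ.coxeterNumber ≤ d * Δ.coxeterNumber := Nat.mul_le_mul_right _ hd
  unfold period
  omega

lemma level_nakayamaShift (Δ : Dynkin) (d : ℕ) (z : Δ.ZVertex) :
    Δ.level (Δ.nakayamaShift d z) = Δ.level z + Δ.period d := by
  rw [nakayamaShift, Equiv.Perm.mul_apply, level_nakayama, level_shift_pow]
  unfold period
  push_cast
  ring

lemma level_nakayamaShift_zpow (Δ : Dynkin) (d : ℕ) (m : ℤ) (z : Δ.ZVertex) :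
    Δ.level ((Δ.nakayamaShift d ^ m) z) = Δ.level z + m * Δ.period d := by
  induction m with
  | zero => simp
  | succ i ih =>
    rw [add_comm, zpow_add, zpow_one, Equiv.Perm.mul_apply, level_nakayamaShift, ih]
    ring
  | pred i ih =>
    have h := Δ.level_nakayamaShift d ((Δ.nakayamaShift d ^ (-(i : ℤ) - 1)) z)
    rw [← Equiv.Perm.mul_apply, ← zpow_one_add, show 1 + (-(i : ℤ) - 1) = -i by ring, ih] at h
    linarith

/-! ## The quotient quiver -/

lemma proj_eq_iff {Δ : Dynkin} {d : ℕ} {x y : Δ.ZVertex} :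
    Δ.proj d x = Δ.proj d y ↔ ∃ m : ℤ, (Δ.nakayamaShift d ^ m) y = x := by
  refine (Quotient.eq (r := Δ.orbitSetoid d) (x := x) (y := y)).trans ?_
  constructor
  · rintro ⟨⟨_, m, rfl⟩, h⟩
    exact ⟨m, h⟩
  · rintro ⟨m, h⟩
    exact ⟨⟨_, m, rfl⟩, h⟩

lemma exists_proj {Δ : Dynkin} {d : ℕ} (c : Δ.QVertex d) : ∃ z, Δ.proj d z = c :=
  Quotient.exists_rep c

lemma proj_zpow {Δ : Dynkin} {d : ℕ} (m : ℤ) (x : Δ.ZVertex) :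
    Δ.proj d ((Δ.nakayamaShift d ^ m) x) = Δ.proj d x :=
  proj_eq_iff.2 ⟨m, rfl⟩

/-- `𝕊[d]` raises levels by a positive constant, so an orbit meets each level at most once; the
level picks out a representative. -/
lemma eq_of_proj_eq {Δ : Dynkin} {d : ℕ} (hd : 1 ≤ d) {x y : Δ.ZVertex}
    (h : Δ.proj d x = Δ.proj d y) (hl : Δ.level x = Δ.level y) : x = y := by
  obtain ⟨m, rfl⟩ := proj_eq_iff.1 h
  rw [level_nakayamaShift_zpow] at hl
  have h1 : m * (Δ.period d : ℤ) = 0 := by omega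
  have h2 := Δ.period_pos hd
  rcases mul_eq_zero.1 h1 with h0 | h0
  · rw [h0, zpow_zero]
    rfl
  · omega

lemma qTau_proj (Δ : Dynkin) (d : ℕ) (z : Δ.ZVertex) :
    Δ.qTau d (Δ.proj d z) = Δ.proj d (Δ.tau z) := rfl

lemma qUnshift_proj_shift (Δ : Dynkin) (d : ℕ) (z : Δ.ZVertex) :
    Δ.qUnshift d (Δ.proj d (Δ.shift z)) = Δ.proj d z := by
  change Δ.proj d (Δ.shift⁻¹ (Δ.shift z)) = _
  congr 1
  exact Δ.shift.symm_apply_apply z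

lemma qArrow_proj {Δ : Dynkin} {d : ℕ} {b : Δ.QVertex d} {z : Δ.ZVertex} :
    Δ.QArrow d b (Δ.proj d z) ↔ ∃ x, Δ.proj d x = b ∧ Δ.ZArrow x z := by
  constructor
  · rintro ⟨x, y, rfl, hy, h⟩
    obtain ⟨m, rfl⟩ := proj_eq_iff.1 hy
    refine ⟨(Δ.nakayamaShift d ^ (-m)) x, proj_zpow _ _, ?_⟩
    rw [← zArrow_of_mem_translations (zpow_mem (Δ.nakayamaShift_mem_translations d) m),
      ← Equiv.Perm.mul_apply, ← zpow_add, add_neg_cancel, zpow_zero]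
    exact h
  · rintro ⟨x, rfl, h⟩
    exact ⟨x, z, rfl, rfl, h⟩

lemma proj_qArrow {Δ : Dynkin} {d : ℕ} {b : Δ.QVertex d} {z : Δ.ZVertex} :
    Δ.QArrow d (Δ.proj d z) b ↔ ∃ y, Δ.proj d y = b ∧ Δ.ZArrow z y := by
  constructor
  · rintro ⟨x, y, hx, rfl, h⟩
    obtain ⟨m, rfl⟩ := proj_eq_iff.1 hx
    refine ⟨(Δ.nakayamaShift d ^ (-m)) y, proj_zpow _ _, ?_⟩
    rw [← zArrow_of_mem_translations (zpow_mem (Δ.nakayamaShift_mem_translations d) m),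
      ← Equiv.Perm.mul_apply, ← zpow_add, add_neg_cancel, zpow_zero]
    exact h
  · rintro ⟨y, rfl, h⟩
    exact ⟨z, y, rfl, rfl, h⟩

lemma zArrow_tau {Δ : Dynkin} {x y : Δ.ZVertex} : Δ.ZArrow (Δ.tau x) y ↔ Δ.ZArrow y x := by
  rw [zArrow_iff, zArrow_iff, level_tau, adj_comm]
  exact and_congr Iff.rfl (by omega)

lemma qArrow_qTau {Δ : Dynkin} {d : ℕ} (b c : Δ.QVertex d) :
    Δ.QArrow d (Δ.qTau d c) b ↔ Δ.QArrow d b c := by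
  obtain ⟨z, rfl⟩ := exists_proj c
  rw [qTau_proj, proj_qArrow, qArrow_proj]
  simp only [zArrow_tau]

lemma finite_level (Δ : Dynkin) (l : ℤ) : {z : Δ.ZVertex | Δ.level z = l}.Finite := by
  refine Set.Finite.of_finite_image (f := Prod.snd) (Set.toFinite _) ?_
  intro x hx y hy h
  exact eq_of_level h (Eq.trans hx (Eq.symm hy))

lemma finite_qVertex (Δ : Dynkin) {d : ℕ} (hd : 1 ≤ d) : Finite (Δ.QVertex d) := by
  have hK := Δ.period_pos hd
  have hfin : (⋃ l ∈ Finset.range (Δ.period d), {z : Δ.ZVertex | Δ.level z = (l : ℤ)}).Finite :=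
    Set.Finite.biUnion (Finset.finite_toSet _) fun l _ => Δ.finite_level l
  refine Set.finite_univ_iff.1 ((hfin.image (Δ.proj d)).subset fun c _ => ?_)
  obtain ⟨z, rfl⟩ := exists_proj c
  -- Division with remainder moves `z` within its orbit to a level in [0, period).
  refine ⟨(Δ.nakayamaShift d ^ (-(Δ.level z / Δ.period d))) z, ?_, proj_zpow _ _⟩
  have h1 := Int.emod_nonneg (Δ.level z) (b := Δ.period d) (by omega)
  have h2 := Int.emod_lt_of_pos (Δ.level z) (b := Δ.period d) (by omega)
  have h3 := Int.emod_add_mul_ediv (Δ.level z) (Δ.period d)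
  simp only [Set.mem_iUnion, Finset.mem_range, Set.mem_ofPred_eq]
  refine ⟨(Δ.level z % Δ.period d).toNat, by omega, ?_⟩
  rw [level_nakayamaShift_zpow, Int.toNat_of_nonneg h1]
  linarith

lemma sum_qArrow {Δ : Dynkin} {d : ℕ} (hd : 1 ≤ d) (z : Δ.ZVertex)
    [Fintype {b // Δ.QArrow d b (Δ.proj d z)}] (g : Δ.QVertex d → ℕ) :
    ∑ b : {b // Δ.QArrow d b (Δ.proj d z)}, g b.1 =
      Δ.nbrSum (fun a => g (Δ.proj d (Δ.pred z a))) z.2 := by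
  unfold nbrSum
  rw [← Finset.sum_filter]
  symm
  refine Finset.sum_bij (fun a ha => ⟨Δ.proj d (Δ.pred z a), qArrow_proj.2
    ⟨_, rfl, pred_zArrow z (Finset.mem_filter.1 ha).2⟩⟩) (fun _ _ => Finset.mem_univ _) ?_ ?_
    fun _ _ => rfl
  · intro a ha a' ha' h
    have h1 : Δ.proj d (Δ.pred z a) = Δ.proj d (Δ.pred z a') := congrArg Subtype.val h
    have h2 := eq_of_proj_eq hd h1 (by
      rw [level_pred z (Finset.mem_filter.1 ha).2, level_pred z (Finset.mem_filter.1 ha').2])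
    exact congrArg Prod.snd h2
  · rintro ⟨b, hb⟩ -
    obtain ⟨x, rfl, hx⟩ := qArrow_proj.1 hb
    refine ⟨x.2, Finset.mem_filter.2 ⟨Finset.mem_univ _, (zArrow_iff.1 hx).1.symm⟩, ?_⟩
    exact Subtype.ext (congrArg (Δ.proj d) (eq_pred_of_zArrow hx).symm)

/-! ## Pulses on the quotient quiver -/

open Classical in
/-- A sequence of functions on the vertices of `ℤΔ / 𝕊[d]` which starts in the indicator function
of the image of `x`, propagates additively except for one pulse at `x'`, and finally vanishes. -/
structure IsQuotientPulse (Δ : Dynkin) (d : ℕ) (x : Δ.ZVertex) (D : ℕ → Δ.QVertex d → ℕ) (m : ℕ)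
    (x' : Δ.QVertex d) : Prop where
  zero : ∀ c, D 0 c = if c = Δ.proj d x then 1 else 0
  one : ∀ z, D 1 (Δ.proj d z) = Δ.nbrSum (fun a => D 0 (Δ.proj d (Δ.pred z a))) z.2
  add_two : ∀ n z, D (n + 2) (Δ.proj d z) + D n (Δ.proj d (Δ.tau z)) =
    Δ.nbrSum (fun a => D (n + 1) (Δ.proj d (Δ.pred z a))) z.2 +
      if n = m ∧ Δ.proj d z = x' then 1 else 0
  eventually : ∃ N, ∀ n, N ≤ n → ∀ c, D n c = 0

lemma exists_zArrow_of_adj {Δ : Dynkin} (w : Δ.ZVertex) {q : Δ.Vertex} (h : Δ.Adj q w.2) :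
    ∃ z : Δ.ZVertex, z.2 = q ∧ Δ.level z = Δ.level w + 1 := by
  refine ⟨Δ.tau⁻¹ (Δ.pred w q), rfl, ?_⟩
  rw [level_tau_inv, level_pred w h.symm]
  ring

open Classical in
/-- The function on labels whose value at `q` is the value of `f` at the vertex with label `q` and
level `l`, if there is one. -/
noncomputable def restrict {Δ : Dynkin} {d : ℕ} (f : Δ.QVertex d → ℕ) (l : ℤ) (q : Δ.Vertex) : ℕ :=
  if h : ∃ z : Δ.ZVertex, z.2 = q ∧ Δ.level z = l then f (Δ.proj d h.choose) else 0

lemma restrict_eq {Δ : Dynkin} {d : ℕ} (f : Δ.QVertex d → ℕ) (z : Δ.ZVertex) {l : ℤ}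
    (hl : Δ.level z = l) : restrict f l z.2 = f (Δ.proj d z) := by
  have h : ∃ z' : Δ.ZVertex, z'.2 = z.2 ∧ Δ.level z' = l := ⟨z, rfl, hl⟩
  unfold restrict
  rw [dif_pos h, eq_of_level h.choose_spec.1 (h.choose_spec.2.trans hl.symm)]

lemma restrict_eq_zero {Δ : Dynkin} {d : ℕ} (f : Δ.QVertex d → ℕ) {l : ℤ} {q : Δ.Vertex}
    (h : ¬ ∃ z : Δ.ZVertex, z.2 = q ∧ Δ.level z = l) : restrict f l q = 0 :=
  dif_neg h

lemma nbrSum_nat_congr {Δ : Dynkin} {f g : Δ.Vertex → ℕ} {q : Δ.Vertex}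
    (h : ∀ a, Δ.Adj q a → f a = g a) : Δ.nbrSum f q = Δ.nbrSum g q :=
  Finset.sum_congr rfl fun a _ => by
    split_ifs with ha
    · exact h a ha
    · rfl

lemma nbrSum_nat_zero {Δ : Dynkin} {f : Δ.Vertex → ℕ} {q : Δ.Vertex}
    (h : ∀ a, Δ.Adj q a → f a = 0) : Δ.nbrSum f q = 0 := by
  rw [nbrSum_nat_congr (g := fun _ => 0) h]
  unfold nbrSum
  simp

lemma nbrSum_restrict {Δ : Dynkin} {d : ℕ} (f : Δ.QVertex d → ℕ) (z : Δ.ZVertex) {l : ℤ}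
    (hl : Δ.level z = l + 1) :
    Δ.nbrSum (restrict f l) z.2 = Δ.nbrSum (fun a => f (Δ.proj d (Δ.pred z a))) z.2 :=
  nbrSum_nat_congr fun a ha => restrict_eq f (Δ.pred z a) (by rw [level_pred z ha]; omega)

lemma nbrSum_restrict_eq_zero {Δ : Dynkin} {d : ℕ} (f : Δ.QVertex d → ℕ) {q : Δ.Vertex} {l : ℤ}
    (h : ¬ ∃ z : Δ.ZVertex, z.2 = q ∧ Δ.level z = l + 1) : Δ.nbrSum (restrict f l) q = 0 := by
  refine nbrSum_nat_zero fun a ha => restrict_eq_zero f ?_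
  rintro ⟨w, rfl, rfl⟩
  exact h (exists_zArrow_of_adj w ha)

namespace IsQuotientPulse

variable {Δ : Dynkin} {d : ℕ} {x : Δ.ZVertex} {D : ℕ → Δ.QVertex d → ℕ} {m : ℕ}
  {x' : Δ.QVertex d}

-- Reading step `n` only at level `level x + n` unwinds the quotient to ℤΔ. This loses nothing by
-- `exists_level`.
open Classical in
lemma isPulse (hd : 1 ≤ d) (h : Δ.IsQuotientPulse d x D m x') :
    Δ.IsPulse x.2 (fun n => restrict (D n) (Δ.level x + n)) m
      (fun q => ∃ z : Δ.ZVertex, z.2 = q ∧ Δ.level z = Δ.level x + m + 2 ∧ Δ.proj d z = x') where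
  zero q := by
    by_cases hz : ∃ z : Δ.ZVertex, z.2 = q ∧ Δ.level z = Δ.level x + (0 : ℕ)
    · obtain ⟨z, rfl, hl⟩ := hz
      rw [restrict_eq _ z hl, h.zero]
      refine if_congr ⟨fun e => ?_, fun e => ?_⟩ rfl rfl
      · rw [eq_of_proj_eq hd e (by simpa using hl)]
      · rw [eq_of_level e (by simpa using hl)]
    · rw [restrict_eq_zero _ hz, if_neg]
      rintro rfl
      exact hz ⟨x, rfl, by simp⟩
  one q := by
    by_cases hz : ∃ z : Δ.ZVertex, z.2 = q ∧ Δ.level z = Δ.level x + (0 : ℕ) + 1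
    · obtain ⟨z, rfl, hl⟩ := hz
      rw [nbrSum_restrict _ z hl, restrict_eq _ z (by push_cast at hl ⊢; omega), h.one]
    · rw [nbrSum_restrict_eq_zero _ hz, restrict_eq_zero]
      rintro ⟨z, h1, h2⟩
      exact hz ⟨z, h1, by push_cast at h2 ⊢; omega⟩
  add_two n q := by
    by_cases hz : ∃ z : Δ.ZVertex, z.2 = q ∧ Δ.level z = Δ.level x + (n + 1 : ℕ) + 1
    · obtain ⟨z, rfl, hl⟩ := hz
      have e := restrict_eq (D n) (Δ.tau z) (l := Δ.level x + n)
        (by rw [level_tau]; push_cast at hl; omega)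
      rw [nbrSum_restrict _ z hl, restrict_eq _ z (by push_cast at hl ⊢; omega)]
      change _ + restrict (D n) (Δ.level x + n) (Δ.tau z).2 = _
      rw [e, h.add_two]
      congr 1
      refine if_congr (and_congr_right fun hn => ?_) rfl rfl
      subst hn
      constructor
      · exact fun e => ⟨z, rfl, by push_cast at hl; omega, e⟩
      · rintro ⟨w, h1, h2, h3⟩
        rwa [eq_of_level h1 (by push_cast at hl; omega)] at h3
    · rw [nbrSum_restrict_eq_zero _ hz, restrict_eq_zero, restrict_eq_zero, if_neg]
      · rintro ⟨rfl, w, h1, h2, -⟩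
        exact hz ⟨w, h1, by push_cast; omega⟩
      · rintro ⟨w, h1, h2⟩
        refine hz ⟨Δ.tau⁻¹ w, h1, ?_⟩
        rw [level_tau_inv]
        push_cast
        omega
      · rintro ⟨w, h1, h2⟩
        exact hz ⟨w, h1, by push_cast at h2 ⊢; omega⟩
  eventually := by
    obtain ⟨N, hN⟩ := h.eventually
    refine ⟨N, fun n hn q => ?_⟩
    by_cases hz : ∃ z : Δ.ZVertex, z.2 = q ∧ Δ.level z = Δ.level x + n
    · obtain ⟨z, rfl, hl⟩ := hz
      rw [restrict_eq _ z hl, hN n hn]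
    · exact restrict_eq_zero _ hz
  unique := by
    rintro q q' ⟨z, rfl, hl, hz⟩ ⟨z', rfl, hl', hz'⟩
    rw [eq_of_proj_eq hd (hz.trans hz'.symm) (hl.trans hl'.symm)]

lemma exists_level (hd : 1 ≤ d) (h : Δ.IsQuotientPulse d x D m x') {n : ℕ} {w : Δ.ZVertex}
    (hw : D n (Δ.proj d w) ≠ 0) :
    ∃ z, Δ.proj d z = Δ.proj d w ∧ Δ.level z = Δ.level x + n := by
  classical
  have step : ∀ (n : ℕ) (w : Δ.ZVertex),
      (∀ w', D n (Δ.proj d w') ≠ 0 →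
        ∃ z, Δ.proj d z = Δ.proj d w' ∧ Δ.level z = Δ.level x + n) →
      Δ.nbrSum (fun a => D n (Δ.proj d (Δ.pred w a))) w.2 ≠ 0 →
      ∃ z, Δ.proj d z = Δ.proj d w ∧ Δ.level z = Δ.level x + (n + 1 : ℕ) := by
    intro n w ih hs
    obtain ⟨a, ha, hne⟩ : ∃ a, Δ.Adj w.2 a ∧ D n (Δ.proj d (Δ.pred w a)) ≠ 0 := by
      by_contra! hc
      exact hs (nbrSum_nat_zero hc)
    obtain ⟨z, hz, hl⟩ := ih _ hne
    obtain ⟨k, rfl⟩ := proj_eq_iff.1 hz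
    refine ⟨(Δ.nakayamaShift d ^ k) w, proj_zpow _ _, ?_⟩
    rw [level_nakayamaShift_zpow] at hl ⊢
    rw [level_pred w ha] at hl
    push_cast
    linarith
  induction n using Nat.strong_induction_on generalizing w with
  | _ n ih =>
    match n with
    | 0 =>
      rw [h.zero] at hw
      have hx : Δ.proj d w = Δ.proj d x := by
        by_contra hc
        exact hw (if_neg hc)
      exact ⟨x, hx.symm, by simp⟩
    | 1 =>
      rw [h.one] at hw
      exact step 0 w (fun w' => ih 0 (by omega)) hw
    | n + 2 =>
      have h1 := h.add_two n w
      by_cases hs : Δ.nbrSum (fun a => D (n + 1) (Δ.proj d (Δ.pred w a))) w.2 = 0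
      · rw [hs] at h1
        obtain ⟨rfl, hx'⟩ : n = m ∧ Δ.proj d w = x' := by
          by_contra hc
          rw [if_neg hc] at h1
          omega
        -- Here `w` is the vertex of the pulse. The unwound sequence must receive its pulse too, or
        -- it would never die out, so this orbit does have a vertex at the required level.
        obtain ⟨t, z, -, hl, hz⟩ := (h.isPulse hd).exists_pulse
        exact ⟨z, hz.trans hx'.symm, by push_cast; omega⟩
      · exact step (n + 1) w (fun w' => ih (n + 1) (by omega)) hs

end IsQuotientPulse

section Family

variable {Δ : Dynkin} {d : ℕ} {D : Δ.ZVertex → ℕ → Δ.QVertex d → ℕ} {m : Δ.ZVertex → ℕ}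
  {x' : Δ.ZVertex → Δ.QVertex d}

open Classical in
lemma pulse_family (hd : 1 ≤ d) (h : ∀ x, Δ.IsQuotientPulse d x (D x) (m x) (x' x)) (r : ℤ)
    (s : Δ.Vertex) : Δ.IsPulse s (fun n => restrict (D (r, s) n) (Δ.level (r, s) + n)) (m (r, s))
      (fun q => ∃ z : Δ.ZVertex, z.2 = q ∧ Δ.level z = Δ.level (r, s) + m (r, s) + 2 ∧
        Δ.proj d z = x' (r, s)) :=
  (h (r, s)).isPulse hd

/-- The final pulse takes place at the image of `x` under the shift permutation. -/
lemma eq_proj_shift (hd : 1 ≤ d) (h : ∀ x, Δ.IsQuotientPulse d x (D x) (m x) (x' x))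
    (x : Δ.ZVertex) : x' x = Δ.proj d (Δ.shift x) := by
  classical
  obtain ⟨z, h1, h2, h3⟩ := pulse_at_nakayamaVertex (pulse_family hd h x.1) x.2
  have h4 := coxeterNumber_eq_of_pulse (pulse_family hd h x.1) x.2
  change Δ.level z = Δ.level x + m x + 2 at h2
  change Δ.proj d z = x' x at h3
  change Δ.coxeterNumber = m x + 2 at h4
  rw [← h3, eq_of_level (x := z) (y := Δ.shift x) (by rw [h1, shift_snd])]
  rw [level_shift, h4, h2]
  push_cast
  ring

/-- The values of the functions `h_x` on the quotient are the total dimensions. -/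
lemma hBar_eq_sum (hd : 1 ≤ d) (h : ∀ x, Δ.IsQuotientPulse d x (D x) (m x) (x' x))
    (x : Δ.ZVertex) (c : Δ.QVertex d) {N : ℕ} (hN : ∀ n, N ≤ n → ∀ c, D x n c = 0) :
    Δ.hBar d x c = (∑ n ∈ Finset.range N, D x n c : ℕ) := by
  classical
  have hP := pulse_family hd h x.1
  have hW := hasFiniteWaves_of_pulse hP
  have hm : Δ.coxeterNumber = m x + 2 := coxeterNumber_eq_of_pulse hP x.2
  have hD : ∀ (n : ℕ) (z), Δ.level z = Δ.level x + n → n ≤ m x → (D x n (Δ.proj d z) : ℤ) = Δ.hFun x z := by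
    intro n z hz hn
    rw [hW.hFun_eq_wave (n := n) (by omega) hz, ← ((h x).isPulse hd).eq_wave n z.2
      (Or.inl (by omega)), restrict_eq _ z hz]
  have hD0 : ∀ n, m x + 1 ≤ n → ∀ c, D x n c = 0 := by
    intro n hn c
    obtain ⟨w, rfl⟩ := exists_proj c
    by_contra hc
    obtain ⟨z, hz, hl⟩ := (h x).exists_level hd hc
    rw [← hz, ← restrict_eq (D x n) z hl] at hc
    exact hc (((h x).isPulse hd).eq_zero hn z.2)
  have hsum : ∑ n ∈ Finset.range N, D x n c = ∑ n ∈ Finset.range (m x + 1), D x n c := by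
    rcases le_total N (m x + 1) with hle | hle
    · refine Finset.sum_subset (Finset.range_mono hle) fun n _ hn => hN n ?_ c
      simpa using hn
    · refine (Finset.sum_subset (Finset.range_mono hle) fun n _ hn => hD0 n ?_ c).symm
      simpa using hn
  rw [hsum]
  -- `g n` isolates the at most one vertex over `c` at level `level x + n`; exchanging the two sums
  -- turns the sum over the fibre into a sum over degrees.
  set g : ℕ → Δ.ZVertex → ℤ := fun n z =>
    if Δ.proj d z = c ∧ Δ.level z = Δ.level x + n then D x n c else 0 with hg
  have hg1 : ∀ z, (∑ᶠ (_ : Δ.proj d z = c), Δ.hFun x z) =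
      ∑ n ∈ Finset.range (m x + 1), g n z := by
    intro z
    by_cases hz : Δ.proj d z = c
    · rw [finsum_eq_if, if_pos hz]
      by_cases hl : Δ.level x ≤ Δ.level z ∧ Δ.level z ≤ Δ.level x + m x
      · obtain ⟨n, hn⟩ : ∃ n : ℕ, Δ.level z = Δ.level x + n :=
          ⟨(Δ.level z - Δ.level x).toNat, by omega⟩
        rw [Finset.sum_eq_single n]
        · rw [hg]
          simp only
          rw [if_pos ⟨hz, hn⟩, ← hz, hD n z hn (by omega)]
        · intro i _ hi
          exact if_neg fun hc => hi (by omega)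
        · intro hi
          simp only [Finset.mem_range] at hi
          omega
      · rw [hW.hFun_eq_zero (by omega), Finset.sum_eq_zero]
        intro n hn
        simp only [Finset.mem_range] at hn
        exact if_neg fun hc => hl (by omega)
    · rw [finsum_eq_if, if_neg hz, Finset.sum_eq_zero]
      intro n _
      exact if_neg fun hc => hz hc.1
  have hg2 : ∀ n, ∑ᶠ z, g n z = (D x n c : ℤ) := by
    intro n
    by_cases hz : ∃ z, Δ.proj d z = c ∧ Δ.level z = Δ.level x + n
    · obtain ⟨z, hz⟩ := hz
      rw [finsum_eq_single _ z]
      · exact if_pos hz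
      · intro w hw
        refine if_neg fun hc => hw ?_
        exact eq_of_proj_eq hd (hc.1.trans hz.1.symm) (hc.2.trans hz.2.symm)
    · have h0 : D x n c = 0 := by
        by_contra hc
        obtain ⟨w, rfl⟩ := exists_proj c
        exact hz ((h x).exists_level hd hc)
      rw [h0]
      refine finsum_eq_zero_of_forall_eq_zero fun z => ?_
      exact if_neg fun hc => hz ⟨z, hc⟩
  unfold hBar
  rw [finsum_congr hg1, finsum_sum_comm]
  · push_cast
    exact Finset.sum_congr rfl fun n _ => hg2 n
  · intro n _
    refine (Δ.finite_level (Δ.level x + n)).subset fun z hz => ?_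
    by_contra hc
    exact hz (if_neg fun h => hc h.2)

end Family

end Dynkin

universe w v u

/-! ## Representatives of the isomorphism classes of indecomposable objects -/

lemma indMk_eq_iff {T : Type u} [Category.{v} T] [HasZeroMorphisms T] [HasBinaryBiproducts T]
    {X Y : IndecObj T} : indMk X = indMk Y ↔ Nonempty (X.1 ≅ Y.1) :=
  Quotient.eq (r := indecSetoid T)

section Representatives

variable {k : Type w} [Field k] {T : Type u} [Category.{v} T] [Preadditive T] [Linear k T]
  [HasZeroObject T] [HasShift T ℤ] [∀ n : ℤ, (shiftFunctor T n).Additive] [Pretriangulated T]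
  {Δ : Dynkin} {d : ℕ}

/-- The indecomposable object which corresponds to a vertex. -/
noncomputable def representative (e : IndClass T ≃ Δ.QVertex d) (b : Δ.QVertex d) : IndecObj T :=
  Quotient.out (s := indecSetoid T) (e.symm b)

lemma apply_indMk_representative (e : IndClass T ≃ Δ.QVertex d) (b : Δ.QVertex d) :
    e (indMk (representative e b)) = b := by
  have h : indMk (representative e b) = e.symm b := Quotient.out_eq (s := indecSetoid T) (e.symm b)
  rw [h, Equiv.apply_symm_apply]

lemma nonempty_iso_representative (e : IndClass T ≃ Δ.QVertex d) (X : IndecObj T) :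
    Nonempty (X.1 ≅ (representative e (e (indMk X))).1) :=
  indMk_eq_iff.1 (e.injective (apply_indMk_representative e _).symm)

lemma isARSystem_representative (hfin : IsHomFinite k T) (hKS : IsKrullSchmidt T)
    (e : IndClass T ≃ Δ.QVertex d) (he : IsARQuiverIso k Δ d e) :
    IsARSystem k (fun b => (representative e b).1) (Δ.QArrow d) (Δ.qTau d) where
  hfin := hfin
  isLocalRing b := isLocalRing_end_of_indecomposable hKS (representative e b).2
  eq_of_iso b b' h := by
    rw [← apply_indMk_representative e b, ← apply_indMk_representative e b', indMk_eq_iff.2 h]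
  decomp := exists_decomposition hKS (fun b => (representative e b).1) fun X hX =>
    ⟨e (indMk ⟨X, hX⟩), nonempty_iso_representative e ⟨X, hX⟩⟩
  irr_one b b' h := by
    rw [he.1, if_pos]
    rwa [apply_indMk_representative, apply_indMk_representative]
  irr_zero b b' h := by
    rw [he.1, if_neg]
    rwa [apply_indMk_representative, apply_indMk_representative]
  arr_tau b c := Dynkin.qArrow_qTau b c
  almostSplit c := (he.2 _ _).2 (by rw [apply_indMk_representative, apply_indMk_representative])

lemma indecomposable_shift (hKS : IsKrullSchmidt T) {X : T} (hX : Indecomposable X) (n : ℤ) :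
    Indecomposable (X⟦n⟧) :=
  indecomposable_of_isLocalRing
    (isLocalRing_end_shift n (isLocalRing_end_of_indecomposable hKS hX))

end Representatives

/-! ### Morphism spaces and shifts expressed by the functions h̄. -/

section Dimensions

variable {k : Type w} [Field k] [IsAlgClosed k] {T : Type u} [Category.{v} T] [Preadditive T]
  [Linear k T] [HasZeroObject T] [HasShift T ℤ] [∀ n : ℤ, (shiftFunctor T n).Additive]
  [∀ n : ℤ, (shiftFunctor T n).Linear k] [Pretriangulated T]
  (hfin : IsHomFinite k T) (hKS : IsKrullSchmidt T) {Δ : Dynkin} {d : ℕ} (hd : 1 ≤ d)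
  {e : IndClass T ≃ Δ.QVertex d} (he : IsARQuiverIso k Δ d e)
include hfin hKS hd he

/-- The shift functor corresponds to the shift permutation, and the dimensions of morphism spaces
are the values of the functions `h_x`. -/
lemma shift_and_finrank (x : Δ.ZVertex) :
    e (indMk ⟨(representative e (Δ.proj d x)).1⟦(1 : ℤ)⟧,
        indecomposable_shift hKS (representative e _).2 1⟩) =
        Δ.proj d (Δ.shift x) ∧
      ∀ c, (Module.finrank k ((representative e (Δ.proj d x)).1 ⟶ (representative e c).1) : ℤ) =
        Δ.hBar d x c := by
  classical
  have := Δ.finite_qVertex hd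
  have := Fintype.ofFinite (Δ.QVertex d)
  have S := isARSystem_representative hfin hKS e he
  choose D m N h0 h1 h2 h3 h4 using fun x : Δ.ZVertex => S.exists_graded_dimension
    (x := Δ.proj d x) (nonempty_iso_representative e
      ⟨(representative e (Δ.proj d x)).1⟦(1 : ℤ)⟧,
        indecomposable_shift hKS (representative e _).2 1⟩)
  have hP : ∀ x, Δ.IsQuotientPulse d x (D x) (m x) (e (indMk
      ⟨(representative e (Δ.proj d x)).1⟦(1 : ℤ)⟧,
        indecomposable_shift hKS (representative e _).2 1⟩)) := by
    intro x
    refine ⟨fun c => ?_, fun z => ?_, fun n z => ?_, ⟨N x, h3 x⟩⟩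
    · rw [h0 x]
    · rw [h1 x, Dynkin.sum_qArrow hd z (D x 0)]
    · rw [← Δ.qTau_proj, h2 x, Dynkin.sum_qArrow hd z (D x (n + 1))]
  refine ⟨Dynkin.eq_proj_shift hd hP x, fun c => ?_⟩
  rw [Dynkin.hBar_eq_sum hd hP x c (h3 x), h4 x]

lemma finrank_hom {X Y : IndecObj T} {x : Δ.ZVertex} (hx : Δ.proj d x = e (indMk X)) :
    (Module.finrank k (X.1 ⟶ Y.1) : ℤ) = Δ.hBar d x (e (indMk Y)) := by
  rw [← (shift_and_finrank hfin hKS hd he x).2, hx]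
  have i := (nonempty_iso_representative e X).some
  have j := (nonempty_iso_representative e Y).some
  rw [(Linear.homCongr k i j).finrank_eq]

lemma apply_shift {X X' : IndecObj T} (hX : Nonempty (X.1⟦(1 : ℤ)⟧ ≅ X'.1)) :
    Δ.qUnshift d (e (indMk X')) = e (indMk X) := by
  obtain ⟨x, hx⟩ := Dynkin.exists_proj (e (indMk X))
  have h1 := (shift_and_finrank hfin hKS hd he x).1
  have h2 : indMk X' = indMk ⟨(representative e (Δ.proj d x)).1⟦(1 : ℤ)⟧,
      indecomposable_shift hKS (representative e _).2 1⟩ := by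
    rw [indMk_eq_iff, hx]
    exact ⟨hX.some.symm ≪≫ (shiftFunctor T (1 : ℤ)).mapIso (nonempty_iso_representative e X).some⟩
  rw [h2, h1, Dynkin.qUnshift_proj_shift, hx]

lemma apply_unshift (Y : IndecObj T) (j : ℕ) :
    e (indMk ⟨Y.1⟦-(j : ℤ)⟧, indecomposable_shift hKS Y.2 _⟩) =
      (Δ.qUnshift d)^[j] (e (indMk Y)) := by
  induction j with
  | zero =>
    refine congrArg e (indMk_eq_iff.2 ⟨?_⟩)
    exact (shiftFunctorZero' T (-((0 : ℕ) : ℤ)) (by simp)).app Y.1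
  | succ j ih =>
    rw [Function.iterate_succ_apply', ← ih]
    refine (apply_shift hfin hKS hd he ⟨?_⟩).symm
    exact ((shiftFunctorAdd' T (-((j + 1 : ℕ) : ℤ)) 1 (-(j : ℤ)) (by push_cast; ring)).app Y.1).symm

lemma finrank_hom_unshift {X Y : IndecObj T} {x : Δ.ZVertex} (hx : Δ.proj d x = e (indMk X))
    (j : ℕ) : (Module.finrank k (X.1 ⟶ Y.1⟦-(j : ℤ)⟧) : ℤ) =
      Δ.hBar d x ((Δ.qUnshift d)^[j] (e (indMk Y))) := by
  rw [← apply_unshift hfin hKS hd he Y j]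
  exact finrank_hom hfin hKS hd he hx (Y := ⟨Y.1⟦-(j : ℤ)⟧, indecomposable_shift hKS Y.2 _⟩)

lemma hBar_eq_zero_iff {X Y : IndecObj T} {x : Δ.ZVertex} (hx : Δ.proj d x = e (indMk X)) (j : ℕ) :
    Δ.hBar d x ((Δ.qUnshift d)^[j] (e (indMk Y))) = 0 ↔ ∀ f : X.1 ⟶ Y.1⟦-(j : ℤ)⟧, f = 0 := by
  have : Module.Finite k (X.1 ⟶ Y.1⟦-(j : ℤ)⟧) := hfin _ _
  rw [← finrank_hom_unshift hfin hKS hd he hx j, Nat.cast_eq_zero, Module.finrank_zero_iff,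
    subsingleton_iff_forall_eq 0]

end Dimensions

end NegCY

theorem theorem4p13 {k : Type*} [Field k] [IsAlgClosed k]
    {T : Type*} [Category* T] [Preadditive T] [Linear k T]
    [HasZeroObject T] [HasShift T ℤ] [∀ n : ℤ, (shiftFunctor T n).Additive]
    [∀ n : ℤ, (shiftFunctor T n).Linear k] [Pretriangulated T] [IsTriangulated T]
    (hfin : IsHomFinite k T) (hKS : IsKrullSchmidt T)
    (Δ : Dynkin) (d : ℕ) (hd : 1 ≤ d)
    (e : IndClass T ≃ Δ.QVertex d) (he : IsARQuiverIso k Δ d e) (C : Set (IndClass T)) :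
    IsCYConfiguration k d C ↔ Δ.IsCombConfiguration d (e '' C) := by
  classical
  have hX : ∀ c : IndClass T, ∃ X : IndecObj T, indMk X = c := fun c => Quotient.exists_rep c
  have hx : ∀ c : IndClass T, ∃ x, Δ.proj d x = e c := fun c => Dynkin.exists_proj (e c)
  have hmem : ∀ X : IndecObj T, e (indMk X) ∈ e '' C ↔ indMk X ∈ C := fun X =>
    e.injective.mem_set_image
  have hcast : ∀ (p : Prop) [Decidable p], ((if p then 1 else 0 : ℕ) : ℤ) = if p then 1 else 0 :=
    fun p _ => by split_ifs <;> rfl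
  -- The three conditions correspond separately. Objects of `C` are matched with arbitrary lifts to
  -- ℤΔ, and `finrank_hom` and `hBar_eq_zero_iff` translate between the two sides.
  refine and_congr ?_ (and_congr ?_ ?_)
  · constructor
    · rintro h x ⟨a, ha, hxa⟩ _ ⟨b, hb, rfl⟩
      obtain ⟨X, rfl⟩ := hX a
      obtain ⟨Y, rfl⟩ := hX b
      rw [← finrank_hom hfin hKS hd he hxa.symm, h X Y ha hb, hcast, ← hxa]
      exact if_congr e.injective.eq_iff.symm rfl rfl
    · intro h X Y hXC hYC
      obtain ⟨x, hxX⟩ := hx (indMk X)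
      have h1 := h x (hxX ▸ (hmem X).2 hXC) _ ((hmem Y).2 hYC)
      rw [← finrank_hom hfin hKS hd he hxX, hxX, if_congr e.injective.eq_iff rfl rfl, ← hcast] at h1
      exact Nat.cast_injective h1
  · constructor
    · rintro h x ⟨a, ha, hxa⟩ _ ⟨b, hb, rfl⟩ j hj hjd
      obtain ⟨X, rfl⟩ := hX a
      obtain ⟨Y, rfl⟩ := hX b
      exact (hBar_eq_zero_iff hfin hKS hd he hxa.symm j).2 (h X Y ha hb j hj hjd)
    · intro h X Y hXC hYC j hj hjd
      obtain ⟨x, hxX⟩ := hx (indMk X)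
      exact (hBar_eq_zero_iff hfin hKS hd he hxX j).1
        (h x (hxX ▸ (hmem X).2 hXC) _ ((hmem Y).2 hYC) j hj hjd)
  · constructor
    · intro h z
      obtain ⟨M, hM⟩ := hX (e.symm z)
      obtain ⟨X, hXC, j, hj, f, hf⟩ := h M
      obtain ⟨x, hxX⟩ := hx (indMk X)
      refine ⟨x, hxX ▸ (hmem X).2 hXC, j, hj, fun h0 => hf ?_⟩
      rw [← e.apply_symm_apply z, ← hM] at h0
      exact (hBar_eq_zero_iff hfin hKS hd he hxX j).1 h0 f
    · intro h M
      obtain ⟨x, ⟨a, ha, hxa⟩, j, hj, hne⟩ := h (e (indMk M))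
      obtain ⟨X, rfl⟩ := hX a
      refine ⟨X, ha, j, hj, ?_⟩
      by_contra! hc
      exact hne ((hBar_eq_zero_iff hfin hKS hd he hxa.symm j).2 hc)
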